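/- Let $b\in\mathbb R$, $\sigma\neq 0$, $r>0$, $K_1,K_0>0$, $K\in\mathbb R$, and let $h:\,]0,\infty[\,\to\mathbb R$ be right-continuous and increasing (in the sense of non-decreasing, here and below), with $\lim_{x\to\infty}h(x)=\infty$ and $\mathbb E\bigl[\int_0^\infty e^{-rt}|h(X_t)|\,dt\bigr]<\infty$ for every $x>0$, where $dX_t=bX_t\,dt+\sqrt2\,\sigma X_t\,dW_t$, $X_0=x$, and $W$ is a standard Brownian motion. Write $h(0)=\lim_{x\downarrow0}h(x)\in[-\infty,\infty[$, $$m,n=\frac{1}{2\sigma^2}\Bigl[\sigma^2-b\mp\sqrt{(b-\sigma^2)^2+4\sigma^2r}\Bigr],\qquad m<0<n,$$ $$R_h(x)=\frac1{\sigma^2(n-m)}\Bigl[x^m\int_0^xs^{-m-1}h(s)\,ds+x^n\int_x^\infty s^{-n-1}h(s)\,ds\Bigr].$$ The HJB equation for a pair $w_1,w_0:\,]0,\infty[\,\to\mathbb R$ is $$\max\{\sigma^2x^2w_1''+bxw_1'-rw_1+h,\ w_0-w_1-K_0,\ -w_1-K\}=0,$$ $$\max\{\sigma^2x^2w_0''+bxw_0'-rw_0,\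 w_1-w_0-K_1,\ -w_0-K\}=0.$$ It is understood in the classical sense: $w_1,w_0$ are $C^1$ with locally Lipschitz derivatives and, outside a finite set, they are $C^2$ near each point near which $h$ is continuous, and they are twice differentiable and satisfy both equations at each point of continuity of $h$. For $0<\delta<\gamma<\beta<\alpha$ consider the system $$m\int_\beta^\alpha s^{-m-1}h(s)\,ds+rK_0\beta^{-m}+rK_1\alpha^{-m}=0,\qquad n\int_\beta^\alpha s^{-n-1}h(s)\,ds+rK_0\beta^{-n}+rK_1\alpha^{-n}=0,$$ $$m\int_\delta^\gamma s^{-m-1}[h(s)+rK_0]\,ds+r(K-K_0)\delta^{-m}=0,$$ $$n\int_\delta^\gamma s^{-n-1}[h(s)+rK_0]\,ds+r(K-K_0)\delta^{-n}+n\int_\beta^\infty s^{-n-1}[h(s)+rK_0]\,ds=0,\tag{S}$$ the constants $$A=-\tfrac1{\sigma^2(n-m)}\int_0^\beta s^{-m-1}[h(s)+rK_0]\,ds,\qquad B=\tfrac1{\sigma^2(n-m)}\int_\alpha^\infty s^{-n-1}[h(s)-rK_1]\,ds,$$ $$\Gamma_1=-\tfrac1{\sigma^2(n-m)}\int_0^\gamma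 s^{-m-1}[h(s)+rK_0]\,ds,\qquad \Gamma_2=-\tfrac1{\sigma^2(n-m)}\int_\gamma^\beta s^{-n-1}[h(s)+rK_0]\,ds,$$ and the functions $$w_1(x)=\begin{cases}-K,&x\le\delta\\ \Gamma_1x^m+\Gamma_2x^n+R_h(x),&\delta<x<\gamma\\ Bx^n-K_0,&\gamma\le x\le\beta\\ Ax^m+R_h(x),&x>\beta\end{cases}\qquad w_0(x)=\begin{cases}Bx^n,&x<\alpha\\ Ax^m+R_h(x)-K_1,&x\ge\alpha.\end{cases}$$ Call $k\in\mathbb R$ a *critical cost* if there are $0<\delta_\dagger<\hat x<\alpha_\dagger$ with $$\int_{\delta_\dagger}^\infty s^{-n-1}[h(s)+rK]\,ds=0,\qquad m\int_{\delta_\dagger}^{\alpha_\dagger}s^{-m-1}[h(s)-rK_1]\,ds+r(K_1+K)\delta_\dagger^{-m}=0,$$ $$m\hat x^{m-1}\int_{\hat x}^{\alpha_\dagger}s^{-m-1}[h(s)-rK_1]\,ds-n\hat x^{n-1}\int_{\hat x}^{\alpha_\dagger}s^{-n-1}[h(s)-rK_1]\,ds=0,$$ $$k=-K_1-\frac{m\hat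 x^m}{r}\int_{\hat x}^{\alpha_\dagger}s^{-m-1}[h(s)-rK_1]\,ds.$$ This notion does not involve $K_0$. **Lemma.** (a) If $K\ge0$ and $h(0)<-rK$, then there is exactly one critical cost $K_0^\star$, and $K<K_0^\star<-r^{-1}h(0)$. (b) The system (S) has a unique solution $(\delta,\gamma,\beta,\alpha)$ with $0<\delta<\gamma<\beta<\alpha$ and, for this solution, $A,B,\Gamma_1,\Gamma_2>0$ and the functions $w_1,w_0$ are increasing and satisfy the HJB equation, if and only if $$0\le K,\qquad h(0)<-rK_0\qquad\text{and}\qquad K<K_0<K_0^\star .$$ (The first two of these conditions together with $K<K_0$ imply the hypotheses of (a), so that $K_0^\star$ is then defined.) -/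

import Mathlib

open Set Filter Topology MeasureTheory ProbabilityTheory

noncomputable section

namespace SwitchAbandon

/-- All the problem data except the cost `K₀` of switching the project from "open" to "closed":
the drift `b` and the parameter `σ` of the geometric Brownian motion
`dX = b X dt + √2 σ X dW`, the discount rate `r`, the cost `K₁` of switching from "closed" to
"open", the cost `K` of abandonment and the running payoff `h`, of which only the values on
`]0, ∞[` matter. -/
structure Model where
  b : ℝ
  σ : ℝ
  r : ℝ
  K₁ : ℝ
  K : ℝ
  h : ℝ → ℝ

namespace Model

variable (M : Model)

/-- The geometric Brownian motion with initial value `x` at time `t`, as a function of the value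
`w` of the driving Brownian motion at time `t`. -/
def gbm (x t w : ℝ) : ℝ :=
  x * Real.exp ((M.b - M.σ ^ 2) * t + Real.sqrt 2 * M.σ * w)

/-- `E [∫₀^∞ e^{-rt} |h (X_t)| dt]` for `X₀ = x`; the value of the Brownian motion at
time `t` has the law `N(0, t)`. -/
def discountedAbsPayoff (x : ℝ) : ENNReal :=
  ∫⁻ t in Ioi (0 : ℝ), ENNReal.ofReal (Real.exp (-M.r * t)) *
    ∫⁻ w, ENNReal.ofReal |M.h (M.gbm x t w)| ∂(gaussianReal 0 t.toNNReal)

/-- The standing assumptions on the data. -/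
structure Admissible : Prop where
  σ_ne : M.σ ≠ 0
  r_pos : 0 < M.r
  K₁_pos : 0 < M.K₁
  h_mono : MonotoneOn M.h (Ioi 0)
  h_rightCont : ∀ x, 0 < x → ContinuousWithinAt M.h (Ici x) x
  h_tendsto : Tendsto M.h atTop atTop
  h_integrable : ∀ x, 0 < x → M.discountedAbsPayoff x < ⊤

/-- `h(0) = lim_{x ↓ 0} h(x)`, an element of `[-∞, ∞[` when `h` is increasing. -/
def hZero : EReal :=
  limUnder (𝓝[>] (0 : ℝ)) fun x => (M.h x : EReal)

/-- The negative root of `σ² k (k - 1) + b k - r = 0`. -/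
def m : ℝ :=
  (1 / (2 * M.σ ^ 2)) *
    (M.σ ^ 2 - M.b - Real.sqrt ((M.b - M.σ ^ 2) ^ 2 + 4 * M.σ ^ 2 * M.r))

/-- The positive root of `σ² k (k - 1) + b k - r = 0`. -/
def n : ℝ :=
  (1 / (2 * M.σ ^ 2)) *
    (M.σ ^ 2 - M.b + Real.sqrt ((M.b - M.σ ^ 2) ^ 2 + 4 * M.σ ^ 2 * M.r))

/-- The expected discounted payoff `R_h` of the project that is kept "open" forever. -/
def R (x : ℝ) : ℝ :=
  1 / (M.σ ^ 2 * (M.n - M.m)) *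
    (x ^ M.m * (∫ s in (0 : ℝ)..x, s ^ (-M.m - 1) * M.h s) +
      x ^ M.n * ∫ s in Ioi x, s ^ (-M.n - 1) * M.h s)

/-- The pair `(w₁, w₀)` solves the HJB equation in the classical sense: both functions are `C¹`
on `]0, ∞[` with locally Lipschitz derivatives and, outside a finite set, they are `C²` near every
point near which `h` is continuous, and they are twice differentiable and satisfy the two
quasi-variational inequalities at every point of continuity of `h`. (The second derivative of a
solution to `σ² x² w'' + b x w' - r w + h = 0` need not exist at a jump of `h`.) -/
structure SolvesHJB (K₀ : ℝ) (w₁ w₀ : ℝ → ℝ) : Prop where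
  contDiffOn_w₁ : ContDiffOn ℝ 1 w₁ (Ioi 0)
  contDiffOn_w₀ : ContDiffOn ℝ 1 w₀ (Ioi 0)
  lipschitz_w₁ : LocallyLipschitzOn (Ioi 0) (deriv w₁)
  lipschitz_w₀ : LocallyLipschitzOn (Ioi 0) (deriv w₀)
  hjb : ∃ S : Set ℝ, S.Finite ∧ ∀ x, 0 < x → x ∉ S →
    ((∀ᶠ y in 𝓝 x, ContinuousAt M.h y) → ContDiffAt ℝ 2 w₁ x ∧ ContDiffAt ℝ 2 w₀ x) ∧
    (ContinuousAt M.h x →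
      DifferentiableAt ℝ (deriv w₁) x ∧ DifferentiableAt ℝ (deriv w₀) x ∧
      max (max (M.σ ^ 2 * x ^ 2 * deriv (deriv w₁) x + M.b * x * deriv w₁ x
          - M.r * w₁ x + M.h x) (w₀ x - w₁ x - K₀)) (-w₁ x - M.K) = 0 ∧
      max (max (M.σ ^ 2 * x ^ 2 * deriv (deriv w₀) x + M.b * x * deriv w₀ x
          - M.r * w₀ x) (w₁ x - w₀ x - M.K₁)) (-w₀ x - M.K) = 0)

end Model

/-- Candidate free-boundary points. -/
structure Boundary where
  δ : ℝ
  γ : ℝ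
  β : ℝ
  α : ℝ

namespace Model

variable (M : Model) (K₀ : ℝ) (p : Boundary)

/-- `0 < δ < γ < β < α` and the system of four equations for `(δ, γ, β, α)`. -/
structure SolvesSystem : Prop where
  δ_pos : 0 < p.δ
  δ_lt_γ : p.δ < p.γ
  γ_lt_β : p.γ < p.β
  β_lt_α : p.β < p.α
  eq₁ : M.m * (∫ s in p.β..p.α, s ^ (-M.m - 1) * M.h s)
    + M.r * K₀ * p.β ^ (-M.m) + M.r * M.K₁ * p.α ^ (-M.m) = 0
  eq₂ : M.n * (∫ s in p.β..p.α, s ^ (-M.n - 1) * M.h s)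
    + M.r * K₀ * p.β ^ (-M.n) + M.r * M.K₁ * p.α ^ (-M.n) = 0
  eq₃ : M.m * (∫ s in p.δ..p.γ, s ^ (-M.m - 1) * (M.h s + M.r * K₀))
    + M.r * (M.K - K₀) * p.δ ^ (-M.m) = 0
  eq₄ : M.n * (∫ s in p.δ..p.γ, s ^ (-M.n - 1) * (M.h s + M.r * K₀))
    + M.r * (M.K - K₀) * p.δ ^ (-M.n)
    + M.n * (∫ s in Ioi p.β, s ^ (-M.n - 1) * (M.h s + M.r * K₀)) = 0

def A : ℝ :=
  -(1 / (M.σ ^ 2 * (M.n - M.m))) *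
    ∫ s in (0 : ℝ)..p.β, s ^ (-M.m - 1) * (M.h s + M.r * K₀)

def B : ℝ :=
  1 / (M.σ ^ 2 * (M.n - M.m)) *
    ∫ s in Ioi p.α, s ^ (-M.n - 1) * (M.h s - M.r * M.K₁)

def Γ₁ : ℝ :=
  -(1 / (M.σ ^ 2 * (M.n - M.m))) *
    ∫ s in (0 : ℝ)..p.γ, s ^ (-M.m - 1) * (M.h s + M.r * K₀)

def Γ₂ : ℝ :=
  -(1 / (M.σ ^ 2 * (M.n - M.m))) *
    ∫ s in p.γ..p.β, s ^ (-M.n - 1) * (M.h s + M.r * K₀)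

/-- The candidate value function in the "open" mode. -/
def w₁ (x : ℝ) : ℝ :=
  if x ≤ p.δ then -M.K
  else if x < p.γ then M.Γ₁ K₀ p * x ^ M.m + M.Γ₂ K₀ p * x ^ M.n + M.R x
  else if x ≤ p.β then M.B p * x ^ M.n - K₀
  else M.A K₀ p * x ^ M.m + M.R x

/-- The candidate value function in the "closed" mode. -/
def w₀ (x : ℝ) : ℝ :=
  if x < p.α then M.B p * x ^ M.n
  else M.A K₀ p * x ^ M.m + M.R x - M.K₁

/-- `k` is the critical value `K₀⋆` of the cost `K₀`: with the points `0 < δ < α` (written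
`δ_†` and `α` when abandonment replaces switching out) determined by the first two equations and
with the zero `x` in `]δ, α[` of the derivative
of the difference between the corresponding candidates `w₀` and `w₁`,
`k = -K₁ - (m x^m / r) ∫_x^α s^{-m-1} (h(s) - r K₁) ds`. -/
def IsCriticalCost (k : ℝ) : Prop :=
  ∃ δ α x : ℝ, 0 < δ ∧ δ < α ∧
    (∫ s in Ioi δ, s ^ (-M.n - 1) * (M.h s + M.r * M.K)) = 0 ∧
    M.m * (∫ s in δ..α, s ^ (-M.m - 1) * (M.h s - M.r * M.K₁))
      + M.r * (M.K₁ + M.K) * δ ^ (-M.m) = 0 ∧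
    δ < x ∧ x < α ∧
    M.m * x ^ (M.m - 1) / (M.σ ^ 2 * (M.n - M.m)) *
        (∫ s in x..α, s ^ (-M.m - 1) * (M.h s - M.r * M.K₁))
      - M.n * x ^ (M.n - 1) / (M.σ ^ 2 * (M.n - M.m)) *
        (∫ s in x..α, s ^ (-M.n - 1) * (M.h s - M.r * M.K₁)) = 0 ∧
    k = -M.K₁ - M.m * x ^ M.m / M.r *
        ∫ s in x..α, s ^ (-M.m - 1) * (M.h s - M.r * M.K₁)

end Model

end SwitchAbandon

end

/-! On each interval the candidates solve σ²x²u'' + bxu' − ru + f = 0. Variation of constants writes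
u = (x^m P + x^n Q)/C with P' = x^{-m-1} f and Q' = −x^{-n-1} f at continuity points of f; `Sol`
records this in integrated form, so that f may jump. Smooth fit with a constant c means that u has a
critical point with value c, and this fixes P and Q there (`Admissible.crit_iff`). In these terms
(S) says that w₁ − w₀, continued as a solution with payoff h from ]β, α[, has the critical values
−K₀ at β and K₁ at α, and that on ]δ, γ[ the function w₁ has the critical value −K at δ while w₁ −
Bxⁿ has −K₀ at γ (`Admissible.solvesSystem_iff`). The critical cost is of the same kind
(`Admissible.isCriticalCost_iff`): α_† is the upper switching point when abandonment replaces
switching out, and −K₀⋆ is the minimum on ]0, α_†] of the resulting difference w₁ − w₀.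

The qualitative tool is a maximum principle. Since h is monotone, the sign of h(a) − rc at a
critical point a with value c decides the sign of the slope on a whole side of a
(`Sol.slope_neg_of_lt`, `Sol.slope_nonpos_of_le`). Hence a solution increases between two critical
points with increasing values (`Sol.between`), and a solution with Q = `QU`, the one of minimal
growth at infinity, increases strictly after a critical point.

Existence is a tangency argument. Among the solutions with critical value −K₀ at β, the largest β
for which the level K₁ is still reached gives a solution touching that level, at α
(`Admissible.exists_switch`). Then, among the solutions meeting Bxⁿ − K₀ smoothly at γ, the largest
γ for which the level −K is still reached gives a solution touching it at δ
(`Admissible.exists_abandon`); this needs the solution for γ = β, the continuation of w₁ from beyond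
β, to stay above −K. Uniqueness follows from strictly monotone dependence on β and γ, read off from
the sign of the Green kernel.

The link with K₀⋆ is the comparison of α with α_†: α < α_† is equivalent to K₀ < K₀⋆. If α < α_†,
the continuation of w₁ exceeds −K; if α_† ≤ α, it is at most −K at δ_†, which excludes a solution to
(S). The condition 0 ≤ K comes from w₀ → 0 at zero together with w₀ ≥ −K. Conversely, w₁ and w₀ are
solutions for piecewise payoffs `f₁` and `f₀`, so their regularity is automatic and the differential
part of the HJB equation becomes h ≤ f₁ and 0 ≤ f₀. -/

namespace SwitchAbandon

/-! ### Weighted integrals -/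

/-- `∫_a^b s^{-k-1} f(s) ds`. -/
noncomputable def J (k : ℝ) (f : ℝ → ℝ) (a b : ℝ) : ℝ := ∫ s in a..b, s ^ (-k - 1) * f s

/-- Measurable and locally bounded functions on `]0, ∞[`. -/
structure Tame (f : ℝ → ℝ) : Prop where
  meas : AEStronglyMeasurable f (volume.restrict (Ioi 0))
  bdd : ∀ a b, 0 < a → ∃ c, ∀ x ∈ Icc a b, |f x| ≤ c

lemma Tame.const (c : ℝ) : Tame fun _ => c :=
  ⟨aestronglyMeasurable_const, fun _ _ _ => ⟨|c|, fun _ _ => le_rfl⟩⟩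

lemma Tame.add {f g : ℝ → ℝ} (hf : Tame f) (hg : Tame g) : Tame fun s => f s + g s := by
  refine ⟨hf.meas.add hg.meas, fun a b ha => ?_⟩
  obtain ⟨c, hc⟩ := hf.bdd a b ha
  obtain ⟨d, hd⟩ := hg.bdd a b ha
  exact ⟨c + d, fun x hx => (abs_add_le _ _).trans (add_le_add (hc x hx) (hd x hx))⟩

lemma Tame.sub_const {f : ℝ → ℝ} (hf : Tame f) (c : ℝ) : Tame fun s => f s - c := by
  simpa only [sub_eq_add_neg] using hf.add (Tame.const (-c))

/-- The value functions solve the differential equation for payoffs that are `h` on some intervals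
and constant on others. Closure under gluing lets one regularity theory serve them all. -/
lemma Tame.glue {f g : ℝ → ℝ} (hf : Tame f) (hg : Tame g) (p : ℝ) :
    Tame fun s => if s ≤ p then f s else g s := by
  refine ⟨?_, fun a b ha => ?_⟩
  · exact AEStronglyMeasurable.piecewise (s := Iic p) measurableSet_Iic hf.meas.restrict
      hg.meas.restrict
  · obtain ⟨c, hc⟩ := hf.bdd a b ha
    obtain ⟨d, hd⟩ := hg.bdd a b ha
    refine ⟨max c d, fun x hx => ?_⟩
    split_ifs
    · exact (hc x hx).trans (le_max_left _ _)
    · exact (hd x hx).trans (le_max_right _ _)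

lemma Tame.of_monotoneOn {f : ℝ → ℝ} (hf : MonotoneOn f (Ioi 0)) : Tame f := by
  refine ⟨(aemeasurable_restrict_of_monotoneOn measurableSet_Ioi hf).aestronglyMeasurable,
    fun a b ha => ⟨max |f a| |f b|, fun x hx => ?_⟩⟩
  have hx0 : 0 < x := ha.trans_le hx.1
  exact abs_le_max_abs_abs (hf ha hx0 hx.1) (hf hx0 (hx0.trans_le hx.2) hx.2)

lemma uIcc_subset_Ioi {a b : ℝ} (ha : 0 < a) (hb : 0 < b) : uIcc a b ⊆ Ioi 0 :=
  fun _ hx => (lt_min ha hb).trans_le hx.1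

lemma Tame.intervalIntegrable {f : ℝ → ℝ} (hf : Tame f) {a b : ℝ} (ha : 0 < a) (hb : 0 < b) :
    IntervalIntegrable f volume a b := by
  obtain ⟨c, hc⟩ := hf.bdd (min a b) (max a b) (lt_min ha hb)
  rw [intervalIntegrable_iff]
  refine IntegrableOn.of_bound (by simp) (hf.meas.mono_measure (Measure.restrict_mono
    (uIoc_subset_uIcc.trans (uIcc_subset_Ioi ha hb)) le_rfl)) c ?_
  filter_upwards [ae_restrict_mem measurableSet_uIoc] with x hx
  exact hc x (uIoc_subset_uIcc hx)

lemma continuousOn_weight (k : ℝ) {a b : ℝ} (ha : 0 < a) (hb : 0 < b) :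
    ContinuousOn (fun s : ℝ => s ^ (-k - 1)) (uIcc a b) := fun _ hx =>
  (Real.continuousAt_rpow_const _ _ (Or.inl (uIcc_subset_Ioi ha hb hx).ne')).continuousWithinAt

lemma Tame.intervalIntegrable_weight {f : ℝ → ℝ} (hf : Tame f) (k : ℝ) {a b : ℝ} (ha : 0 < a)
    (hb : 0 < b) : IntervalIntegrable (fun s => s ^ (-k - 1) * f s) volume a b :=
  (hf.intervalIntegrable ha hb).continuousOn_mul (continuousOn_weight k ha hb)

lemma J_add_adjacent {f : ℝ → ℝ} (hf : Tame f) (k : ℝ) {a b c : ℝ} (ha : 0 < a) (hb : 0 < b)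
    (hc : 0 < c) : J k f a b + J k f b c = J k f a c :=
  intervalIntegral.integral_add_adjacent_intervals (hf.intervalIntegrable_weight k ha hb)
    (hf.intervalIntegrable_weight k hb hc)

lemma J_symm (k : ℝ) (f : ℝ → ℝ) (a b : ℝ) : J k f b a = -J k f a b :=
  intervalIntegral.integral_symm a b

lemma J_const {k : ℝ} (hk : k ≠ 0) (c : ℝ) {a b : ℝ} (ha : 0 < a) (hb : 0 < b) :
    J k (fun _ => c) a b = c * (a ^ (-k) - b ^ (-k)) / k := by
  have h0 : (0 : ℝ) ∉ uIcc a b := fun h => lt_irrefl (0 : ℝ) (uIcc_subset_Ioi ha hb h)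
  unfold J
  rw [intervalIntegral.integral_mul_const, integral_rpow (Or.inr ⟨by contrapose! hk; linarith, h0⟩)]
  have : -k - 1 + 1 = -k := by ring
  rw [this]
  field_simp
  ring

lemma J_add_const {f : ℝ → ℝ} (hf : Tame f) {k : ℝ} (hk : k ≠ 0) (c : ℝ) {a b : ℝ} (ha : 0 < a)
    (hb : 0 < b) :
    J k (fun s => f s + c) a b = J k f a b + c * (a ^ (-k) - b ^ (-k)) / k := by
  rw [← J_const hk c ha hb]
  unfold J
  rw [← intervalIntegral.integral_add (hf.intervalIntegrable_weight k ha hb)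
    ((Tame.const c).intervalIntegrable_weight k ha hb)]
  simp only [mul_add]

lemma J_congr {f g : ℝ → ℝ} (k : ℝ) {a b : ℝ} (h : ∀ s ∈ uIoc a b, f s = g s) :
    J k f a b = J k g a b :=
  intervalIntegral.integral_congr_ae (ae_of_all _ fun s hs => by simp only [h s hs])

lemma J_nonneg {f : ℝ → ℝ} (k : ℝ) {a b : ℝ} (ha : 0 < a) (hab : a ≤ b)
    (h : ∀ s ∈ Ioo a b, 0 ≤ f s) : 0 ≤ J k f a b := by
  unfold J
  rw [intervalIntegral.integral_of_le hab, integral_Ioc_eq_integral_Ioo]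
  exact setIntegral_nonneg measurableSet_Ioo fun s hs =>
    mul_nonneg (Real.rpow_nonneg (ha.trans hs.1).le _) (h s hs)

lemma J_pos {f : ℝ → ℝ} (hf : Tame f) (k : ℝ) {a b : ℝ} (ha : 0 < a) (hab : a < b)
    (h : ∀ s ∈ Ioo a b, 0 < f s) : 0 < J k f a b :=
  intervalIntegral.intervalIntegral_pos_of_pos_on (hf.intervalIntegrable_weight k ha
    (ha.trans hab)) (fun s hs => mul_pos (Real.rpow_pos_of_pos (ha.trans hs.1) _) (h s hs)) hab

lemma J_neg_fun (k : ℝ) (f : ℝ → ℝ) (a b : ℝ) : J k (fun s => -f s) a b = -J k f a b := by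
  unfold J
  simp only [mul_neg, intervalIntegral.integral_neg]

lemma Tame.neg {f : ℝ → ℝ} (hf : Tame f) : Tame fun s => -f s :=
  ⟨hf.meas.neg, fun a b ha => by simpa only [abs_neg] using hf.bdd a b ha⟩

lemma J_nonpos {f : ℝ → ℝ} (k : ℝ) {a b : ℝ} (ha : 0 < a) (hab : a ≤ b)
    (h : ∀ s ∈ Ioo a b, f s ≤ 0) : J k f a b ≤ 0 := by
  have := J_nonneg (f := fun s => -f s) k ha hab fun s hs => neg_nonneg.2 (h s hs)
  rw [J_neg_fun] at this
  linarith

lemma J_neg {f : ℝ → ℝ} (hf : Tame f) (k : ℝ) {a b : ℝ} (ha : 0 < a) (hab : a < b)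
    (h : ∀ s ∈ Ioo a b, f s < 0) : J k f a b < 0 := by
  have := J_pos hf.neg k ha hab fun s hs => neg_pos.2 (h s hs)
  rw [J_neg_fun] at this
  linarith

lemma J_mono {f g : ℝ → ℝ} (hf : Tame f) (hg : Tame g) (k : ℝ) {a b : ℝ} (ha : 0 < a)
    (hab : a ≤ b) (h : ∀ s ∈ Icc a b, f s ≤ g s) : J k f a b ≤ J k g a b :=
  intervalIntegral.integral_mono_on hab (hf.intervalIntegrable_weight k ha (ha.trans_le hab))
    (hg.intervalIntegrable_weight k ha (ha.trans_le hab)) fun s hs =>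
      mul_le_mul_of_nonneg_left (h s hs) (Real.rpow_nonneg (ha.trans_le hs.1).le _)

/-- The primitives of a weighted tame function are locally Lipschitz. -/
lemma Tame.exists_abs_J_le {f : ℝ → ℝ} (hf : Tame f) (k : ℝ) {a b : ℝ} (ha : 0 < a) :
    ∃ c, ∀ x ∈ Icc a b, ∀ y ∈ Icc a b, |J k f x y| ≤ c * |y - x| := by
  rcases le_or_gt a b with hab | hab
  swap
  · exact ⟨0, fun x hx => absurd (hx.1.trans hx.2) (not_le.2 hab)⟩
  obtain ⟨c, hc⟩ := hf.bdd a b ha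
  have hw : ContinuousOn (fun s : ℝ => s ^ (-k - 1)) (Icc a b) := by
    rw [← uIcc_of_le hab]; exact continuousOn_weight k ha (ha.trans_le hab)
  obtain ⟨d, hd⟩ := isCompact_Icc.exists_bound_of_continuousOn hw
  refine ⟨d * c, fun x hx y hy => ?_⟩
  refine intervalIntegral.norm_integral_le_of_norm_le_const
    (f := fun s => s ^ (-k - 1) * f s) fun s hs => ?_
  have hs' : s ∈ Icc a b := by
    have := uIoc_subset_uIcc hs
    exact ⟨(le_min hx.1 hy.1).trans this.1, this.2.trans (max_le hx.2 hy.2)⟩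
  rw [norm_mul]
  exact mul_le_mul (hd s hs') (hc s hs') (norm_nonneg _) ((norm_nonneg _).trans (hd s hs'))

lemma Tame.continuousOn_J {f : ℝ → ℝ} (hf : Tame f) (k : ℝ) {p : ℝ} (hp : 0 < p) :
    ContinuousOn (fun x => J k f p x) (Ioi 0) := by
  intro x hx
  have hx : 0 < x := hx
  obtain ⟨c, hc⟩ := hf.exists_abs_J_le k (a := x / 2) (b := 2 * x) (by positivity)
  have hxm : x ∈ Icc (x / 2) (2 * x) := ⟨by linarith, by linarith⟩
  refine ContinuousAt.continuousWithinAt ?_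
  have hn : Icc (x / 2) (2 * x) ∈ 𝓝 x := Icc_mem_nhds (by linarith) (by linarith)
  rw [ContinuousAt, tendsto_iff_norm_sub_tendsto_zero]
  refine squeeze_zero' (g := fun y => c * |y - x|) (Eventually.of_forall fun _ => norm_nonneg _) ?_ ?_
  · filter_upwards [hn] with y hy
    have hy0 : 0 < y := by linarith [hy.1]
    rw [← J_add_adjacent hf k hp hx hy0, add_sub_cancel_left]
    exact hc x hxm y hy
  · have : Continuous fun y : ℝ => c * |y - x| := by fun_prop
    simpa using this.tendsto x

lemma Tame.hasDerivAt_J {f : ℝ → ℝ} (hf : Tame f) (k : ℝ) {p x : ℝ} (hp : 0 < p) (hx : 0 < x)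
    (hc : ContinuousAt f x) : HasDerivAt (fun y => J k f p y) (x ^ (-k - 1) * f x) x := by
  refine intervalIntegral.integral_hasDerivAt_right (hf.intervalIntegrable_weight k hp hx)
    ⟨Ioi 0, Ioi_mem_nhds hx, ?_⟩
    ((Real.continuousAt_rpow_const _ _ (Or.inl hx.ne')).mul hc)
  refine AEStronglyMeasurable.mul ?_ hf.meas
  exact (measurable_id.pow_const _).aestronglyMeasurable

end SwitchAbandon

/-! ### Characteristic roots, variation of constants and critical points -/

namespace SwitchAbandon

namespace Model

/-- The normalizing constant of the Green function. -/
noncomputable def C (M : Model) : ℝ := M.σ ^ 2 * (M.n - M.m)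

variable {M : Model}

lemma Admissible.σsq_pos (hM : M.Admissible) : 0 < M.σ ^ 2 := by
  have := hM.σ_ne
  positivity

lemma Admissible.discr_pos (hM : M.Admissible) :
    (M.b - M.σ ^ 2) ^ 2 < (M.b - M.σ ^ 2) ^ 2 + 4 * M.σ ^ 2 * M.r := by
  have := hM.σsq_pos
  have := hM.r_pos
  have : 0 < 4 * M.σ ^ 2 * M.r := by positivity
  linarith

lemma Admissible.abs_lt_sqrt (hM : M.Admissible) :
    |M.b - M.σ ^ 2| < √((M.b - M.σ ^ 2) ^ 2 + 4 * M.σ ^ 2 * M.r) := by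
  rw [← Real.sqrt_sq_eq_abs]
  exact Real.sqrt_lt_sqrt (sq_nonneg _) hM.discr_pos

lemma Admissible.m_neg (hM : M.Admissible) : M.m < 0 := by
  have h1 := abs_lt.1 hM.abs_lt_sqrt
  have := hM.σsq_pos
  exact mul_neg_of_pos_of_neg (by positivity) (by linarith [h1.1])

lemma Admissible.n_pos (hM : M.Admissible) : 0 < M.n := by
  have h1 := abs_lt.1 hM.abs_lt_sqrt
  have := hM.σsq_pos
  exact mul_pos (by positivity) (by linarith [h1.2])

lemma Admissible.C_pos (hM : M.Admissible) : 0 < M.C :=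
  mul_pos hM.σsq_pos (by linarith [hM.m_neg, hM.n_pos])

lemma Admissible.mn_eq (hM : M.Admissible) : M.σ ^ 2 * (M.m * M.n) = -M.r := by
  have h0 := hM.σ_ne
  have hs := Real.sq_sqrt ((sq_nonneg _).trans hM.discr_pos.le)
  unfold m n
  generalize √((M.b - M.σ ^ 2) ^ 2 + 4 * M.σ ^ 2 * M.r) = q at hs ⊢
  field_simp
  linear_combination -hs

lemma Admissible.m_add_n_eq (hM : M.Admissible) : M.σ ^ 2 * (M.m + M.n) = M.σ ^ 2 - M.b := by
  have h0 := hM.σ_ne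
  unfold m n
  field_simp
  ring

/-- `(P, Q)` are the variable coefficients of a solution `(x^m P(x) + x^n Q(x)) / C` to
`σ² x² u'' + b x u' - r u + f = 0`. -/
structure Sol (M : Model) (f P Q : ℝ → ℝ) : Prop where
  tame : Tame f
  P_eq : ∀ a b, 0 < a → 0 < b → P b = P a + J M.m f a b
  Q_eq : ∀ a b, 0 < a → 0 < b → Q b = Q a - J M.n f a b

/-- The function with the coefficients `(P, Q)`. -/
noncomputable def val (M : Model) (P Q : ℝ → ℝ) (x : ℝ) : ℝ :=
  (x ^ M.m * P x + x ^ M.n * Q x) / M.C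

/-- `x` times the derivative of the function with the coefficients `(P, Q)`. -/
noncomputable def slope (M : Model) (P Q : ℝ → ℝ) (x : ℝ) : ℝ :=
  (M.m * x ^ M.m * P x + M.n * x ^ M.n * Q x) / M.C

/-- The coefficients of the constant function `c`. -/
noncomputable def pc (M : Model) (c x : ℝ) : ℝ := -(M.r * c / M.m) * x ^ (-M.m)

/-- The coefficients of the constant function `c`. -/
noncomputable def qc (M : Model) (c x : ℝ) : ℝ := M.r * c / M.n * x ^ (-M.n)

lemma rpow_mul_rpow_neg {x : ℝ} (hx : 0 < x) (k : ℝ) : x ^ k * x ^ (-k) = 1 := by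
  rw [← Real.rpow_add hx]; simp

lemma Admissible.sol_const (hM : M.Admissible) (c : ℝ) :
    M.Sol (fun _ => M.r * c) (M.pc c) (M.qc c) := by
  have hm := hM.m_neg.ne
  have hn := hM.n_pos.ne'
  refine ⟨Tame.const _, fun a b ha hb => ?_, fun a b ha hb => ?_⟩
  · rw [J_const hm _ ha hb]; unfold pc; field_simp; ring
  · rw [J_const hn _ ha hb]; unfold qc; field_simp; ring

lemma Sol.add {f g P Q P' Q' : ℝ → ℝ} (h : M.Sol f P Q) (h' : M.Sol g P' Q') :
    M.Sol (fun s => f s + g s) (fun s => P s + P' s) (fun s => Q s + Q' s) := by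
  have key : ∀ k a b, 0 < a → 0 < b →
      J k (fun s => f s + g s) a b = J k f a b + J k g a b := fun k a b ha hb => by
    unfold J
    rw [← intervalIntegral.integral_add (h.tame.intervalIntegrable_weight k ha hb)
      (h'.tame.intervalIntegrable_weight k ha hb)]
    simp only [mul_add]
  refine ⟨h.tame.add h'.tame, fun a b ha hb => ?_, fun a b ha hb => ?_⟩
  · rw [key _ _ _ ha hb, h.P_eq a b ha hb, h'.P_eq a b ha hb]; ring
  · rw [key _ _ _ ha hb, h.Q_eq a b ha hb, h'.Q_eq a b ha hb]; ring

lemma Sol.add_hom {f P Q : ℝ → ℝ} (h : M.Sol f P Q) (p q : ℝ) :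
    M.Sol f (fun s => P s + p) (fun s => Q s + q) := by
  refine ⟨h.tame, fun a b ha hb => ?_, fun a b ha hb => ?_⟩
  · rw [h.P_eq a b ha hb]; ring
  · rw [h.Q_eq a b ha hb]; ring

lemma sol_hom (p q : ℝ) : M.Sol (fun _ => 0) (fun _ => p) (fun _ => q) := by
  refine ⟨Tame.const _, fun a b _ _ => ?_, fun a b _ _ => ?_⟩ <;> simp [J]

/-- The point `x` is a critical point of the function with the coefficients `(P, Q)`, with the
critical value `c`. -/
structure Crit (M : Model) (P Q : ℝ → ℝ) (x c : ℝ) : Prop where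
  P_eq : P x = M.pc c x
  Q_eq : Q x = M.qc c x

lemma Admissible.rm_eq (hM : M.Admissible) (c : ℝ) : M.r * c / M.m = -(M.σ ^ 2 * M.n * c) := by
  have hm := hM.m_neg.ne
  rw [div_eq_iff hm]; linear_combination c * hM.mn_eq

lemma Admissible.rn_eq (hM : M.Admissible) (c : ℝ) : M.r * c / M.n = -(M.σ ^ 2 * M.m * c) := by
  have hn := hM.n_pos.ne'
  rw [div_eq_iff hn]; linear_combination c * hM.mn_eq

/-- Value and slope at `x` are two linear forms in `(P x, Q x)`, with determinant a nonzero multiple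
of n − m. So they determine the coefficients, and those of the constant `c` are the solution for
value `c` and slope 0. -/
lemma Admissible.crit_iff (hM : M.Admissible) {P Q : ℝ → ℝ} {x c : ℝ} (hx : 0 < x) :
    M.Crit P Q x c ↔ M.slope P Q x = 0 ∧ M.val P Q x = c := by
  have hC := hM.C_pos.ne'
  have hs := hM.σsq_pos.ne'
  have hnm : M.n - M.m ≠ 0 := by linarith [hM.m_neg, hM.n_pos]
  have e1 := rpow_mul_rpow_neg hx M.m
  have e2 := rpow_mul_rpow_neg hx M.n
  have p1 := (Real.rpow_pos_of_pos hx M.m).ne'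
  have p2 := (Real.rpow_pos_of_pos hx M.n).ne'
  unfold slope val
  rw [div_eq_iff hC, div_eq_iff hC]
  constructor
  · rintro ⟨h1, h2⟩
    rw [h1, h2]
    unfold pc qc C
    rw [hM.rm_eq, hM.rn_eq]
    constructor
    · linear_combination M.m * M.n * M.σ ^ 2 * c * e1 - M.m * M.n * M.σ ^ 2 * c * e2
    · linear_combination M.n * M.σ ^ 2 * c * e1 - M.m * M.σ ^ 2 * c * e2
  · rintro ⟨h1, h2⟩
    unfold C at h2
    constructor
    · apply mul_left_cancel₀ p1
      apply mul_left_cancel₀ hnm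
      unfold pc
      rw [hM.rm_eq]
      linear_combination -h1 + M.n * h2 - (M.n - M.m) * M.σ ^ 2 * M.n * c * e1
    · apply mul_left_cancel₀ p2
      apply mul_left_cancel₀ hnm
      unfold qc
      rw [hM.rn_eq]
      linear_combination h1 - M.m * h2 + (M.n - M.m) * M.σ ^ 2 * M.m * c * e2

lemma Admissible.crit_const (hM : M.Admissible) (c : ℝ) {x : ℝ} (hx : 0 < x) :
    M.slope (M.pc c) (M.qc c) x = 0 ∧ M.val (M.pc c) (M.qc c) x = c :=
  (hM.crit_iff hx).1 ⟨rfl, rfl⟩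

/-- The slope in terms of a critical point. -/
lemma Sol.slope_eq {f P Q : ℝ → ℝ} (hM : M.Admissible) (h : M.Sol f P Q) {a c x : ℝ} (ha : 0 < a)
    (hc : M.Crit P Q a c) (hx : 0 < x) :
    M.slope P Q x = (M.m * x ^ M.m * J M.m (fun s => f s - M.r * c) a x
      - M.n * x ^ M.n * J M.n (fun s => f s - M.r * c) a x) / M.C := by
  have hm := hM.m_neg.ne
  have hn := hM.n_pos.ne'
  have e1 := rpow_mul_rpow_neg hx M.m
  have e2 := rpow_mul_rpow_neg hx M.n
  unfold slope
  simp only [sub_eq_add_neg]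
  rw [J_add_const h.tame hm _ ha hx, J_add_const h.tame hn _ ha hx, h.P_eq a x ha hx,
    h.Q_eq a x ha hx, hc.P_eq, hc.Q_eq]
  unfold pc qc
  congr 1
  field_simp
  linear_combination M.r * c * e2 - M.r * c * e1

/-- The value in terms of a critical point. -/
lemma Sol.val_eq {f P Q : ℝ → ℝ} (hM : M.Admissible) (h : M.Sol f P Q) {a c x : ℝ} (ha : 0 < a)
    (hc : M.Crit P Q a c) (hx : 0 < x) :
    M.val P Q x = c + (x ^ M.m * J M.m (fun s => f s - M.r * c) a x
      - x ^ M.n * J M.n (fun s => f s - M.r * c) a x) / M.C := by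
  have hm := hM.m_neg.ne
  have hn := hM.n_pos.ne'
  have h0 := (hM.crit_const c hx).2
  unfold val at *
  simp only [sub_eq_add_neg]
  rw [J_add_const h.tame hm _ ha hx, J_add_const h.tame hn _ ha hx, h.P_eq a x ha hx,
    h.Q_eq a x ha hx, hc.P_eq, hc.Q_eq]
  nth_rewrite 3 [← h0]
  unfold pc qc
  rw [← add_div]
  congr 1
  field_simp
  ring

/-- The payoff may jump at `x`, so `P` and `Q` need not be differentiable there. With the
coefficients frozen at `x`, the remainder is the integral over s from x to y of (y^m s^{-m-1} − y^n
s^{-n-1}) f(s). Its kernel vanishes at (x, x) and `f` is locally bounded, so it is o(y − x). -/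
lemma Sol.hasDerivAt {f P Q : ℝ → ℝ} (hM : M.Admissible) (h : M.Sol f P Q) {x : ℝ} (hx : 0 < x) :
    HasDerivAt (M.val P Q) (M.slope P Q x / x) x := by
  have hC := hM.C_pos.ne'
  -- the homogeneous part
  have h1 : HasDerivAt (fun y : ℝ => (y ^ M.m * P x + y ^ M.n * Q x) / M.C)
      (M.slope P Q x / x) x := by
    have d1 := (Real.hasDerivAt_rpow_const (x := x) (p := M.m) (Or.inl hx.ne')).mul_const (P x)
    have d2 := (Real.hasDerivAt_rpow_const (x := x) (p := M.n) (Or.inl hx.ne')).mul_const (Q x)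
    refine ((d1.add d2).div_const M.C).congr_deriv ?_
    unfold slope
    rw [Real.rpow_sub_one hx.ne', Real.rpow_sub_one hx.ne']
    field_simp
  -- the remainder
  have h2 : HasDerivAt (fun y : ℝ => (y ^ M.m * (P y - P x) + y ^ M.n * (Q y - Q x)) / M.C) 0 x := by
    have h3 : HasDerivAt (fun y : ℝ => y ^ M.m * (P y - P x) + y ^ M.n * (Q y - Q x)) 0 x := by
      rw [hasDerivAt_iff_isLittleO]
      simp only [sub_self, mul_zero, add_zero, smul_zero, sub_zero]
      obtain ⟨d, hd⟩ := h.tame.bdd (x / 2) (2 * x) (by positivity)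
      have hd0 : 0 ≤ d := (abs_nonneg _).trans (hd x ⟨by linarith, by linarith⟩)
      rw [Asymptotics.isLittleO_iff]
      intro ε hε
      have hk : ContinuousAt (fun q : ℝ × ℝ =>
          q.1 ^ M.m * q.2 ^ (-M.m - 1) - q.1 ^ M.n * q.2 ^ (-M.n - 1)) (x, x) := by
        refine ContinuousAt.sub (ContinuousAt.mul ?_ ?_) (ContinuousAt.mul ?_ ?_)
        · exact continuousAt_fst.rpow_const (Or.inl hx.ne')
        · exact continuousAt_snd.rpow_const (Or.inl hx.ne')
        · exact continuousAt_fst.rpow_const (Or.inl hx.ne')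
        · exact continuousAt_snd.rpow_const (Or.inl hx.ne')
      have hk0 : x ^ M.m * x ^ (-M.m - 1) - x ^ M.n * x ^ (-M.n - 1) = 0 := by
        rw [← Real.rpow_add hx, ← Real.rpow_add hx]; ring_nf
      -- The bound `d` of |f| may be zero, hence the `+ 1`.
      have hε' : 0 < ε / (d + 1) := by positivity
      obtain ⟨η, hη, hη'⟩ := Metric.continuousAt_iff.1 hk _ hε'
      have hball : Metric.ball x (min η (x / 2)) ∈ 𝓝 x :=
        Metric.ball_mem_nhds _ (lt_min hη (by positivity))
      filter_upwards [hball] with y hy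
      rw [Metric.mem_ball, Real.dist_eq] at hy
      have hy1 := abs_lt.1 (hy.trans_le (min_le_right _ _))
      have hy0 : 0 < y := by linarith [hy1.1]
      have e : y ^ M.m * (P y - P x) + y ^ M.n * (Q y - Q x)
          = ∫ s in x..y, (y ^ M.m * s ^ (-M.m - 1) - y ^ M.n * s ^ (-M.n - 1)) * f s := by
        rw [h.P_eq x y hx hy0, h.Q_eq x y hx hy0]
        unfold J
        simp only [sub_mul, mul_assoc]
        rw [intervalIntegral.integral_sub
          ((h.tame.intervalIntegrable_weight _ hx hy0).const_mul _)
          ((h.tame.intervalIntegrable_weight _ hx hy0).const_mul _),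
          intervalIntegral.integral_const_mul, intervalIntegral.integral_const_mul]
        ring
      rw [e, Real.norm_eq_abs (y - x)]
      refine intervalIntegral.norm_integral_le_of_norm_le_const
        (f := fun s => (y ^ M.m * s ^ (-M.m - 1) - y ^ M.n * s ^ (-M.n - 1)) * f s) fun s hs => ?_
      have hsx : |s - x| ≤ |y - x| := by
        rcases le_total x y with hxy | hxy
        · rw [uIoc_of_le hxy] at hs
          rw [abs_of_nonneg (by linarith [hs.1]), abs_of_nonneg (by linarith)]; linarith [hs.2]
        · rw [uIoc_of_ge hxy] at hs
          rw [abs_of_nonpos (by linarith [hs.2]), abs_of_nonpos (by linarith)]; linarith [hs.1]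
      have hs1 := abs_lt.1 (hsx.trans_lt (hy.trans_le (min_le_right _ _)))
      have hks := hη' (x := (y, s)) (by
        rw [Prod.dist_eq, Real.dist_eq, Real.dist_eq]
        exact max_lt (hy.trans_le (min_le_left _ _))
          (hsx.trans_lt (hy.trans_le (min_le_left _ _))))
      simp only [hk0, dist_zero_right] at hks
      rw [norm_mul]
      have hfs := hd s ⟨by linarith [hs1.1], by linarith [hs1.2]⟩
      calc _ ≤ ε / (d + 1) * d := mul_le_mul hks.le hfs (abs_nonneg _) hε'.le
        _ ≤ ε := by
          rw [div_mul_eq_mul_div, div_le_iff₀ (by positivity)]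
          nlinarith
    simpa using h3.div_const M.C
  refine ((h1.add h2).congr_deriv (add_zero _)).congr_of_eventuallyEq
    (Eventually.of_forall fun y => ?_)
  simp only [val, Pi.add_apply]
  ring

lemma Sol.differentiableAt {f P Q : ℝ → ℝ} (hM : M.Admissible) (h : M.Sol f P Q) {x : ℝ}
    (hx : 0 < x) : DifferentiableAt ℝ (M.val P Q) x := (h.hasDerivAt hM hx).differentiableAt

lemma Sol.deriv_eq {f P Q : ℝ → ℝ} (hM : M.Admissible) (h : M.Sol f P Q) {x : ℝ}
    (hx : 0 < x) : deriv (M.val P Q) x = M.slope P Q x / x := (h.hasDerivAt hM hx).deriv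

lemma Sol.continuousOn_val {f P Q : ℝ → ℝ} (hM : M.Admissible) (h : M.Sol f P Q) :
    ContinuousOn (M.val P Q) (Ioi 0) := fun _ hx =>
  (h.differentiableAt hM hx).continuousAt.continuousWithinAt

lemma Sol.continuousOn_P {f P Q : ℝ → ℝ} (h : M.Sol f P Q) : ContinuousOn P (Ioi 0) :=
  ((h.tame.continuousOn_J M.m one_pos).const_add (P 1)).congr
    fun x hx => h.P_eq 1 x one_pos hx

lemma Sol.continuousOn_Q {f P Q : ℝ → ℝ} (h : M.Sol f P Q) : ContinuousOn Q (Ioi 0) :=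
  (continuousOn_const.sub (h.tame.continuousOn_J M.n one_pos)).congr
    fun x hx => h.Q_eq 1 x one_pos hx

lemma continuousOn_rpow (k : ℝ) : ContinuousOn (fun x : ℝ => x ^ k) (Ioi 0) := fun _ hx =>
  (Real.continuousAt_rpow_const _ _ (Or.inl (ne_of_gt hx))).continuousWithinAt

lemma Sol.continuousOn_slope {f P Q : ℝ → ℝ} (h : M.Sol f P Q) :
    ContinuousOn (M.slope P Q) (Ioi 0) :=
  ((((continuousOn_rpow M.m).const_smul M.m).mul h.continuousOn_P).add
    (((continuousOn_rpow M.n).const_smul M.n).mul h.continuousOn_Q)).div_const _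

lemma Sol.monotoneOn {f P Q : ℝ → ℝ} (hM : M.Admissible) (h : M.Sol f P Q) {a b : ℝ}
    (ha : 0 < a) (hs : ∀ x ∈ Ioo a b, 0 ≤ M.slope P Q x) : MonotoneOn (M.val P Q) (Icc a b) := by
  refine monotoneOn_of_deriv_nonneg (convex_Icc a b) ((h.continuousOn_val hM).mono
    fun x hx => ha.trans_le hx.1) (fun x hx => ?_) fun x hx => ?_ <;> rw [interior_Icc] at hx
  · exact (h.differentiableAt hM (ha.trans hx.1)).differentiableWithinAt
  rw [h.deriv_eq hM (ha.trans hx.1)]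
  exact div_nonneg (hs x hx) (ha.trans hx.1).le

lemma Sol.strictAntiOn {f P Q : ℝ → ℝ} (hM : M.Admissible) (h : M.Sol f P Q) {a b : ℝ}
    (ha : 0 < a) (hs : ∀ x ∈ Ioo a b, M.slope P Q x < 0) : StrictAntiOn (M.val P Q) (Icc a b) := by
  refine strictAntiOn_of_deriv_neg (convex_Icc a b) ((h.continuousOn_val hM).mono
    fun x hx => ha.trans_le hx.1) fun x hx => ?_
  rw [interior_Icc] at hx
  rw [h.deriv_eq hM (ha.trans hx.1)]
  exact div_neg_of_neg_of_pos (hs x hx) (ha.trans hx.1)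

lemma Sol.antitoneOn {f P Q : ℝ → ℝ} (hM : M.Admissible) (h : M.Sol f P Q) {a b : ℝ}
    (ha : 0 < a) (hs : ∀ x ∈ Ioo a b, M.slope P Q x ≤ 0) : AntitoneOn (M.val P Q) (Icc a b) := by
  refine antitoneOn_of_deriv_nonpos (convex_Icc a b) ((h.continuousOn_val hM).mono
    fun x hx => ha.trans_le hx.1) (fun x hx => ?_) fun x hx => ?_ <;> rw [interior_Icc] at hx
  · exact (h.differentiableAt hM (ha.trans hx.1)).differentiableWithinAt
  rw [h.deriv_eq hM (ha.trans hx.1)]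
  exact div_nonpos_of_nonpos_of_nonneg (hs x hx) (ha.trans hx.1).le

end Model

end SwitchAbandon

namespace SwitchAbandon

namespace Model

variable {M : Model}

/-! ### Signs of the slope on either side of a critical point -/

lemma Admissible.coeff_nonpos (hM : M.Admissible) {x p q : ℝ} (hx : 0 < x) (hp : 0 ≤ p)
    (hq : q ≤ 0) : (M.m * x ^ M.m * p + M.n * x ^ M.n * q) / M.C ≤ 0 := by
  refine div_nonpos_of_nonpos_of_nonneg (add_nonpos ?_ ?_) hM.C_pos.le
  · exact mul_nonpos_of_nonpos_of_nonneg (mul_nonpos_of_nonpos_of_nonneg hM.m_neg.le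
      (Real.rpow_nonneg hx.le _)) hp
  · exact mul_nonpos_of_nonneg_of_nonpos (mul_nonneg hM.n_pos.le (Real.rpow_nonneg hx.le _)) hq

lemma Admissible.coeff_neg (hM : M.Admissible) {x p q : ℝ} (hx : 0 < x) (hp : 0 < p)
    (hq : q ≤ 0) : (M.m * x ^ M.m * p + M.n * x ^ M.n * q) / M.C < 0 := by
  refine div_neg_of_neg_of_pos (add_neg_of_neg_of_nonpos ?_ ?_) hM.C_pos
  · exact mul_neg_of_neg_of_pos (mul_neg_of_neg_of_pos hM.m_neg (Real.rpow_pos_of_pos hx _)) hp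
  · exact mul_nonpos_of_nonneg_of_nonpos (mul_nonneg hM.n_pos.le (Real.rpow_nonneg hx.le _)) hq

section

variable {f P Q : ℝ → ℝ} {a c x : ℝ}

/-- By `Sol.slope_eq` the slope is a combination of two weighted integrals of f − rc from `a` to
`x`, with the coefficients m x^m and −n x^n, both negative. So the slope has the sign opposite to f
− rc on the right of `a` and the same sign on the left. The next five lemmas are the remaining
strict and weak cases. -/
lemma Sol.slope_nonpos_right (hM : M.Admissible) (h : M.Sol f P Q) (ha : 0 < a)
    (hc : M.Crit P Q a c) (hx : a ≤ x) (hf : ∀ s ∈ Ioo a x, M.r * c ≤ f s) :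
    M.slope P Q x ≤ 0 := by
  have hx0 := ha.trans_le hx
  rw [h.slope_eq hM ha hc hx0, sub_eq_add_neg, ← mul_neg]
  exact hM.coeff_nonpos hx0 (J_nonneg _ ha hx fun s hs => sub_nonneg.2 (hf s hs))
    (neg_nonpos.2 (J_nonneg _ ha hx fun s hs => sub_nonneg.2 (hf s hs)))

lemma Sol.slope_pos_right (hM : M.Admissible) (h : M.Sol f P Q) (ha : 0 < a)
    (hc : M.Crit P Q a c) (hx : a < x) (hf : ∀ s ∈ Ioo a x, f s < M.r * c) :
    0 < M.slope P Q x := by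
  have hx0 := ha.trans hx
  rw [h.slope_eq hM ha hc hx0, ← neg_neg_iff_pos, ← neg_div, neg_sub, sub_eq_neg_add, ← mul_neg]
  exact hM.coeff_neg hx0
    (neg_pos.2 (J_neg (Tame.sub_const h.tame _) _ ha hx fun s hs => sub_neg.2 (hf s hs)))
    (J_neg (Tame.sub_const h.tame _) _ ha hx fun s hs => sub_neg.2 (hf s hs)).le

lemma Sol.slope_neg_left (hM : M.Admissible) (h : M.Sol f P Q) (hx0 : 0 < x)
    (hc : M.Crit P Q a c) (hx : x < a) (hf : ∀ s ∈ Ioo x a, f s < M.r * c) :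
    M.slope P Q x < 0 := by
  have ha := hx0.trans hx
  rw [h.slope_eq hM ha hc hx0, sub_eq_add_neg, ← mul_neg, J_symm _ _ x a, J_symm _ _ x a, neg_neg]
  exact hM.coeff_neg hx0
    (neg_pos.2 (J_neg (Tame.sub_const h.tame _) _ hx0 hx fun s hs => sub_neg.2 (hf s hs)))
    (J_neg (Tame.sub_const h.tame _) _ hx0 hx fun s hs => sub_neg.2 (hf s hs)).le

lemma Sol.slope_nonpos_left (hM : M.Admissible) (h : M.Sol f P Q) (hx0 : 0 < x)
    (hc : M.Crit P Q a c) (hx : x ≤ a) (hf : ∀ s ∈ Ioo x a, f s ≤ M.r * c) :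
    M.slope P Q x ≤ 0 := by
  have ha := hx0.trans_le hx
  rw [h.slope_eq hM ha hc hx0, sub_eq_add_neg, ← mul_neg, J_symm _ _ x a, J_symm _ _ x a, neg_neg]
  exact hM.coeff_nonpos hx0
    (neg_nonneg.2 (J_nonpos _ hx0 hx fun s hs => sub_nonpos.2 (hf s hs)))
    (J_nonpos _ hx0 hx fun s hs => sub_nonpos.2 (hf s hs))

lemma Sol.slope_nonneg_left (hM : M.Admissible) (h : M.Sol f P Q) (hx0 : 0 < x)
    (hc : M.Crit P Q a c) (hx : x ≤ a) (hf : ∀ s ∈ Ioo x a, M.r * c ≤ f s) :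
    0 ≤ M.slope P Q x := by
  have ha := hx0.trans_le hx
  rw [h.slope_eq hM ha hc hx0, ← neg_nonpos, ← neg_div, neg_sub, sub_eq_neg_add, ← mul_neg,
    J_symm _ _ x a, J_symm _ _ x a, neg_neg]
  exact hM.coeff_nonpos hx0
    (J_nonneg _ hx0 hx fun s hs => sub_nonneg.2 (hf s hs))
    (neg_nonpos.2 (J_nonneg _ hx0 hx fun s hs => sub_nonneg.2 (hf s hs)))

lemma Sol.slope_pos_left (hM : M.Admissible) (h : M.Sol f P Q) (hx0 : 0 < x)
    (hc : M.Crit P Q a c) (hx : x < a) (hf : ∀ s ∈ Ioo x a, M.r * c < f s) :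
    0 < M.slope P Q x := by
  have ha := hx0.trans hx
  rw [h.slope_eq hM ha hc hx0, ← neg_neg_iff_pos, ← neg_div, neg_sub, sub_eq_neg_add, ← mul_neg,
    J_symm _ _ x a, J_symm _ _ x a, neg_neg]
  exact hM.coeff_neg hx0
    (J_pos (Tame.sub_const h.tame _) _ hx0 hx fun s hs => sub_pos.2 (hf s hs))
    (neg_nonpos.2 (J_pos (Tame.sub_const h.tame _) _ hx0 hx fun s hs => sub_pos.2 (hf s hs)).le)

/-- Intermediate values of the slope. -/
lemma Sol.exists_slope_eq_zero (h : M.Sol f P Q) {a b : ℝ} (ha : 0 < a) (hab : a ≤ b)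
    (hs : M.slope P Q a ≤ 0 ∧ 0 ≤ M.slope P Q b ∨ 0 ≤ M.slope P Q a ∧ M.slope P Q b ≤ 0) :
    ∃ x ∈ Icc a b, M.slope P Q x = 0 := by
  have hcont : ContinuousOn (M.slope P Q) (Icc a b) :=
    h.continuousOn_slope.mono fun x hx => ha.trans_le hx.1
  rcases hs with hs | hs
  · obtain ⟨x, hx, hx'⟩ := intermediate_value_Icc hab hcont hs
    exact ⟨x, hx, hx'⟩
  · obtain ⟨x, hx, hx'⟩ := intermediate_value_Icc' hab hcont ⟨hs.2, hs.1⟩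
    exact ⟨x, hx, hx'⟩

lemma Admissible.crit_of_slope (hM : M.Admissible) (hx : 0 < x) (hs : M.slope P Q x = 0) :
    M.Crit P Q x (M.val P Q x) := (hM.crit_iff hx).2 ⟨hs, rfl⟩

end

/-! ### Solutions for the monotone payoff -/

section

variable {P Q : ℝ → ℝ} {a b c x : ℝ}

/-- Monotonicity of `h` turns the comparison at the single point `a` into one on the whole left
side; the next lemma does the same on the right. Every critical point falls under one of the two
cases. -/
lemma Sol.slope_neg_of_lt (hM : M.Admissible) (h : M.Sol M.h P Q) (hx0 : 0 < x)
    (hc : M.Crit P Q a c) (hx : x < a) (hf : M.h a < M.r * c) : M.slope P Q x < 0 :=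
  h.slope_neg_left hM hx0 hc hx fun _ hs =>
    (hM.h_mono (hx0.trans hs.1) (hx0.trans hx) hs.2.le).trans_lt hf

lemma Sol.slope_nonpos_of_le (hM : M.Admissible) (h : M.Sol M.h P Q) (ha : 0 < a)
    (hc : M.Crit P Q a c) (hx : a ≤ x) (hf : M.r * c ≤ M.h a) : M.slope P Q x ≤ 0 :=
  h.slope_nonpos_right hM ha hc hx fun _ hs =>
    hf.trans (hM.h_mono ha (ha.trans hs.1) hs.1.le)

/-- A critical point to the left of a point of increase is a strict minimum point. -/
lemma Sol.isMin_of_slope_pos (hM : M.Admissible) (h : M.Sol M.h P Q) (ha : 0 < a)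
    (hc : M.Crit P Q a c) (hab : a < b) (hb : 0 < M.slope P Q b) :
    M.h a < M.r * c ∧ (∀ x, 0 < x → x < a → M.slope P Q x < 0) ∧
      ∀ x ∈ Ioc a b, 0 < M.slope P Q x := by
  have key : ∀ a c, 0 < a → a < b → M.Crit P Q a c → M.h a < M.r * c := by
    intro a c ha hab hc
    by_contra! hcon
    exact absurd (h.slope_nonpos_of_le hM ha hc hab.le hcon) (not_le.2 hb)
  refine ⟨key a c ha hab hc, fun x hx hxa => h.slope_neg_of_lt hM hx hc hxa (key a c ha hab hc),
    fun x hx => ?_⟩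
  by_contra! hcon
  obtain ⟨y, hy, hy0⟩ := h.exists_slope_eq_zero (ha.trans hx.1) hx.2 (Or.inl ⟨hcon, hb.le⟩)
  have hay : a < y := hx.1.trans_le hy.1
  have hyb : y < b := lt_of_le_of_ne hy.2 fun e => by rw [e] at hy0; exact hb.ne' hy0
  -- A second critical point before `b` is subject to the same dichotomy: it forces a negative slope
  -- at `a`, where the slope is zero.
  have hcy := hM.crit_of_slope (ha.trans hay) hy0
  have := h.slope_neg_of_lt hM ha hcy hay (key y _ (ha.trans hay) hyb hcy)
  rw [((hM.crit_iff ha).1 hc).1] at this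
  exact lt_irrefl _ this

/-- Between two critical points with increasing critical values, a solution is increasing. -/
lemma Sol.between (hM : M.Admissible) (h : M.Sol M.h P Q) {p q cp cq : ℝ} (hp : 0 < p)
    (hpq : p < q) (hcp : M.Crit P Q p cp) (hcq : M.Crit P Q q cq) (hlt : cp < cq) :
    M.h p < M.r * cp ∧ M.r * cq < M.h q ∧ (∀ x ∈ Icc p q, 0 ≤ M.slope P Q x) := by
  have hq : 0 < q := hp.trans hpq
  obtain ⟨sp, vp⟩ := (hM.crit_iff hp).1 hcp
  obtain ⟨sq, vq⟩ := (hM.crit_iff hq).1 hcq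
  have e1 : M.h p < M.r * cp := by
    by_contra! hcon
    have := h.antitoneOn hM hp (b := q) (fun x hx => h.slope_nonpos_of_le hM hp hcp hx.1.le hcon)
      (left_mem_Icc.2 hpq.le) (right_mem_Icc.2 hpq.le) hpq.le
    linarith
  have e2 : M.r * cq < M.h q := by
    by_contra! hcon
    have := h.antitoneOn hM hp (b := q) (fun x hx => h.slope_nonpos_left hM (hp.trans hx.1) hcq
      hx.2.le fun s hs => (hM.h_mono ((hp.trans hx.1).trans hs.1) hq hs.2.le).trans hcon)
      (left_mem_Icc.2 hpq.le) (right_mem_Icc.2 hpq.le) hpq.le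
    linarith
  refine ⟨e1, e2, ?_⟩
  by_contra! hcon
  obtain ⟨x, hx, hx'⟩ := hcon
  have hx0 : 0 < x := hp.trans_le hx.1
  have hpx : p < x := lt_of_le_of_ne hx.1 fun e => by rw [← e, sp] at hx'; exact lt_irrefl _ hx'
  have hxq : x < q := lt_of_le_of_ne hx.2 fun e => by rw [e, sq] at hx'; exact lt_irrefl _ hx'
  -- the slope cannot be positive anywhere to the right of `x`
  have hright : ∀ b ∈ Ioo x q, M.slope P Q b ≤ 0 := by
    intro b hb
    by_contra! hb'
    have := (h.isMin_of_slope_pos hM hp hcp (hpx.trans hb.1) hb').2.2 x ⟨hpx, hb.1.le⟩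
    linarith
  -- there is a point of increase, necessarily before `x`
  have hinc : ∃ b ∈ Ioo p x, 0 < M.slope P Q b := by
    by_contra! hno
    have a1 := h.antitoneOn hM hp (b := x) hno (left_mem_Icc.2 hpx.le) (right_mem_Icc.2 hpx.le)
      hpx.le
    have a2 := h.antitoneOn hM hx0 (b := q) hright (left_mem_Icc.2 hxq.le)
      (right_mem_Icc.2 hxq.le) hxq.le
    linarith
  obtain ⟨b, hb, hb'⟩ := hinc
  have hb0 : 0 < b := hp.trans hb.1
  obtain ⟨y, hy, hy0⟩ := h.exists_slope_eq_zero hb0 hb.2.le (Or.inr ⟨hb'.le, hx'.le⟩)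
  have hby : b < y := lt_of_le_of_ne hy.1 fun e => by rw [← e] at hy0; linarith
  have hyx : y < x := lt_of_le_of_ne hy.2 fun e => by rw [e] at hy0; linarith
  have hypos := hb0.trans hby
  have hcy := hM.crit_of_slope hypos hy0
  -- Otherwise the slope would be negative everywhere to the left of `y`, in particular at `b`.
  have hhy : M.r * M.val P Q y ≤ M.h y := by
    by_contra! hcon
    have := h.slope_neg_of_lt hM hp hcy (hb.1.trans hby) hcon
    linarith
  have hval : cq ≤ M.val P Q y := by
    rw [← vq]
    refine h.antitoneOn hM hypos (b := q) (fun s hs => h.slope_nonpos_of_le hM hypos hcy hs.1.le hhy)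
      (left_mem_Icc.2 (hyx.trans hxq).le) (right_mem_Icc.2 (hyx.trans hxq).le) (hyx.trans hxq).le
  -- After `y` the solution does not increase, so its value at `y` is at least `cq`. Hence h ≥ r cq
  -- on ]x, q[, and the critical point `q` makes the slope at `x` nonnegative.
  have := h.slope_nonneg_left hM hx0 hcq hxq.le fun s hs =>
    calc M.r * cq ≤ M.r * M.val P Q y := mul_le_mul_of_nonneg_left hval hM.r_pos.le
      _ ≤ M.h y := hhy
      _ ≤ M.h s := hM.h_mono hypos (hx0.trans hs.1) (hyx.le.trans hs.1.le)
  linarith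

end

end Model

end SwitchAbandon

namespace SwitchAbandon

/-! ### Integrability of the payoff -/

/-- A lower bound for the resolvent density of a Brownian motion with drift. -/
lemma resolvent_density_ge {μ S r θ y : ℝ} (hS : 0 < S) (hθ : 0 < θ)
    (hθ2 : θ ^ 2 = μ ^ 2 + 4 * S * r) (hy : θ ≤ |y|) :
    ENNReal.ofReal ((√(8 * Real.pi * S))⁻¹ * Real.exp (-(θ ^ 2 / (4 * S))) *
        Real.exp ((y * μ - |y| * θ) / (2 * S))) ≤
      ∫⁻ t in Ioi (0 : ℝ), ENNReal.ofReal (Real.exp (-r * t)) *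
        gaussianPDF (μ * t) (2 * S * t).toNNReal y := by
  -- Completing the square, the exponent of e^{-rt} times the Gaussian density is (yμ − |y|θ)/(2S) −
  -- θ²(t − T)²/(4St), which is largest at t = T. On ]T, T + √T] the last term is bounded because (t
  -- − T)² ≤ t, and the length √T of the window cancels the factor 1/√T from the normalization.
  set T := |y| / θ with hT
  have hT1 : 1 ≤ T := (one_le_div hθ).2 hy
  have hT0 : 0 < T := by linarith
  have hyT : |y| = θ * T := by rw [hT]; field_simp
  have hsT : √T ^ 2 = T := Real.sq_sqrt hT0.le
  have hsT0 : 0 < √T := Real.sqrt_pos.2 hT0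
  have hsT1 : √T ≤ T := by nlinarith [Real.one_le_sqrt.2 hT1]
  have hpi := Real.pi_pos
  set E := (√(8 * Real.pi * S * T))⁻¹ * Real.exp (-(θ ^ 2 / (4 * S))) *
        Real.exp ((y * μ - |y| * θ) / (2 * S)) with hE
  have hsub : Ioc T (T + √T) ⊆ Ioi 0 := fun t ht => hT0.trans ht.1
  calc _ = ENNReal.ofReal (E * √T) := by
        congr 1
        rw [hE, Real.sqrt_mul (by positivity) T]
        field_simp
    _ = ∫⁻ _ in Ioc T (T + √T), ENNReal.ofReal E := by
        rw [setLIntegral_const, Real.volume_Ioc, ← ENNReal.ofReal_mul (by positivity)]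
        congr 2; ring
    _ ≤ ∫⁻ t in Ioc T (T + √T), ENNReal.ofReal (Real.exp (-r * t)) *
        gaussianPDF (μ * t) (2 * S * t).toNNReal y := by
        refine setLIntegral_mono' measurableSet_Ioc fun t ht => ?_
        have ht0 : 0 < t := hsub ht
        have hv : ((2 * S * t).toNNReal : ℝ) = 2 * S * t := Real.coe_toNNReal _ (by positivity)
        rw [gaussianPDF, ← ENNReal.ofReal_mul (Real.exp_nonneg _)]
        refine ENNReal.ofReal_le_ofReal ?_
        rw [gaussianPDFReal, hv]
        have key : Real.exp (-r * t) * ((√(2 * Real.pi * (2 * S * t)))⁻¹ *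
            Real.exp (-(y - μ * t) ^ 2 / (2 * (2 * S * t)))) =
            (√(2 * Real.pi * (2 * S * t)))⁻¹ * Real.exp (-(θ ^ 2 * (t - T) ^ 2 / (4 * S * t))) *
              Real.exp ((y * μ - |y| * θ) / (2 * S)) := by
          generalize (√(2 * Real.pi * (2 * S * t)))⁻¹ = d
          rw [mul_left_comm, mul_assoc d, ← Real.exp_add, ← Real.exp_add]
          congr 2
          have e2 : y ^ 2 = θ ^ 2 * T ^ 2 := by rw [← sq_abs, hyT]; ring
          rw [hyT]
          clear_value T
          field_simp
          linear_combination (4 * t ^ 2) * hθ2 - 4 * e2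
        rw [key, hE]
        refine mul_le_mul_of_nonneg_right (mul_le_mul ?_ ?_ (Real.exp_nonneg _) (by positivity))
          (Real.exp_nonneg _)
        · refine inv_anti₀ (by positivity) (Real.sqrt_le_sqrt ?_)
          have h2 : t ≤ 2 * T := by linarith [ht.2]
          have h3 : 0 < 4 * Real.pi * S := by positivity
          nlinarith
        · refine Real.exp_le_exp.2 (neg_le_neg ?_)
          rw [div_le_div_iff₀ (by positivity) (by positivity)]
          have h3 : (t - T) ^ 2 ≤ t := by nlinarith [ht.1, ht.2]
          have h4 : 0 < θ ^ 2 * (4 * S) := by positivity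
          nlinarith
    _ ≤ _ := lintegral_mono_set hsub

namespace Model

variable {M : Model}

lemma Admissible.monotone_h_exp (hM : M.Admissible) : Monotone fun y => M.h (Real.exp y) :=
  fun _ _ hxy => hM.h_mono (Real.exp_pos _) (Real.exp_pos _) (Real.exp_le_exp.2 hxy)

/-- For X₀ = 1, log X_t is an affine image of a centred normal variable with variance t, hence
normal with mean (b − σ²)t and variance 2σ²t. -/
lemma Admissible.inner_expectation_eq (hM : M.Admissible) {t : ℝ} (ht : 0 < t) :
    ∫⁻ w, ENNReal.ofReal |M.h (M.gbm 1 t w)| ∂(gaussianReal 0 t.toNNReal) =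
      ∫⁻ y, gaussianPDF ((M.b - M.σ ^ 2) * t) (2 * M.σ ^ 2 * t).toNNReal y *
        ENNReal.ofReal |M.h (Real.exp y)| := by
  have hmeas : Measurable fun y => ENNReal.ofReal |M.h (Real.exp y)| :=
    ENNReal.measurable_ofReal.comp (continuous_abs.measurable.comp hM.monotone_h_exp.measurable)
  have hσ := hM.σsq_pos
  have hv : (2 * M.σ ^ 2 * t).toNNReal ≠ 0 := by
    simp only [ne_eq, Real.toNNReal_eq_zero, not_le]; positivity
  have hlaw : (gaussianReal 0 t.toNNReal).map
      (fun w => (M.b - M.σ ^ 2) * t + √2 * M.σ * w) =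
      gaussianReal ((M.b - M.σ ^ 2) * t) (2 * M.σ ^ 2 * t).toNNReal := by
    have := Measure.map_map (μ := gaussianReal 0 t.toNNReal)
      (g := fun w => (M.b - M.σ ^ 2) * t + w) (f := fun w => √2 * M.σ * w)
      (by fun_prop) (by fun_prop)
    rw [Function.comp_def] at this
    rw [← this, gaussianReal_map_const_mul, gaussianReal_map_const_add]
    congr 1
    · ring
    · ext
      rw [NNReal.coe_mul, Real.coe_toNNReal _ ht.le, Real.coe_toNNReal _ (by positivity)]
      simp only [NNReal.coe_mk, mul_pow, Real.sq_sqrt (zero_le_two)]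
  calc _ = ∫⁻ w, ENNReal.ofReal |M.h (Real.exp ((M.b - M.σ ^ 2) * t + √2 * M.σ * w))|
        ∂(gaussianReal 0 t.toNNReal) := by simp only [gbm, one_mul]
    _ = ∫⁻ y, ENNReal.ofReal |M.h (Real.exp y)|
        ∂(gaussianReal ((M.b - M.σ ^ 2) * t) (2 * M.σ ^ 2 * t).toNNReal) := by
        rw [← hlaw, lintegral_map hmeas (by fun_prop)]
    _ = _ := by
        rw [gaussianReal_of_var_ne_zero _ hv,
          lintegral_withDensity_eq_lintegral_mul _ (measurable_gaussianPDF _ _) hmeas]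
        rfl

/-- Tonelli's theorem applied to the standing assumption at x = 1: |h(e^y)| is integrable against
the resolvent density of log X. -/
lemma Admissible.lintegral_resolvent_lt_top (hM : M.Admissible) :
    ∫⁻ y, ENNReal.ofReal |M.h (Real.exp y)| * ∫⁻ t in Ioi (0 : ℝ),
      ENNReal.ofReal (Real.exp (-M.r * t)) *
        gaussianPDF ((M.b - M.σ ^ 2) * t) (2 * M.σ ^ 2 * t).toNNReal y < ⊤ := by
  have hmeas : Measurable fun y => ENNReal.ofReal |M.h (Real.exp y)| :=
    ENNReal.measurable_ofReal.comp (continuous_abs.measurable.comp hM.monotone_h_exp.measurable)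
  have hpdf : Measurable fun q : ℝ × ℝ =>
      gaussianPDF ((M.b - M.σ ^ 2) * q.1) (2 * M.σ ^ 2 * q.1).toNNReal q.2 := by
    unfold gaussianPDF gaussianPDFReal
    fun_prop
  have h1 := hM.h_integrable 1 one_pos
  unfold discountedAbsPayoff at h1
  rw [setLIntegral_congr_fun measurableSet_Ioi
    (g := fun t => ∫⁻ y, ENNReal.ofReal (Real.exp (-M.r * t)) *
      (gaussianPDF ((M.b - M.σ ^ 2) * t) (2 * M.σ ^ 2 * t).toNNReal y *
        ENNReal.ofReal |M.h (Real.exp y)|)) ?_, lintegral_lintegral_swap ?_] at h1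
  · refine lt_of_eq_of_lt (lintegral_congr fun y => ?_) h1
    rw [← lintegral_const_mul]
    · refine lintegral_congr fun t => ?_
      ring
    · refine Measurable.mul (by fun_prop) (hpdf.comp (measurable_id.prodMk measurable_const))
  · refine Measurable.aemeasurable ?_
    exact Measurable.mul (by fun_prop) (hpdf.mul (hmeas.comp measurable_snd))
  · intro t ht
    dsimp only
    rw [hM.inner_expectation_eq ht, lintegral_const_mul]
    exact (measurable_gaussianPDF _ _).mul hmeas

/-- The weighted payoff is integrable on every set of logarithms on which the resolvent density
is bounded below by a multiple of the weight. -/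
lemma Admissible.integrableOn_exp (hM : M.Admissible) (k : ℝ) {s : Set ℝ} (hs : MeasurableSet s)
    (hsθ : ∀ y ∈ s, √((M.b - M.σ ^ 2) ^ 2 + 4 * M.σ ^ 2 * M.r) ≤ |y|)
    (hk : ∀ y ∈ s, (y * (M.b - M.σ ^ 2)
      - |y| * √((M.b - M.σ ^ 2) ^ 2 + 4 * M.σ ^ 2 * M.r)) / (2 * M.σ ^ 2) = -k * y) :
    IntegrableOn (fun x => x ^ (-k - 1) * M.h x) (Real.exp '' s) := by
  have hσ := hM.σsq_pos
  have hd := hM.discr_pos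
  set θ := √((M.b - M.σ ^ 2) ^ 2 + 4 * M.σ ^ 2 * M.r) with hθ
  have hθ2 : θ ^ 2 = (M.b - M.σ ^ 2) ^ 2 + 4 * M.σ ^ 2 * M.r :=
    Real.sq_sqrt ((sq_nonneg _).trans hd.le)
  have hθ0 : 0 < θ := (abs_nonneg _).trans_lt hM.abs_lt_sqrt
  -- The substitution x = e^y turns the weight x^{-k-1} dx into e^{-ky} dy, the exponential factor
  -- in the lower bound for the resolvent density.
  rw [integrableOn_image_iff_integrableOn_abs_deriv_smul hs
    (fun y _ => (Real.hasDerivAt_exp y).hasDerivWithinAt) Real.exp_injective.injOn]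
  have e : (fun y => |Real.exp y| • (Real.exp y ^ (-k - 1) * M.h (Real.exp y))) =
      fun y => Real.exp (-k * y) * M.h (Real.exp y) := by
    funext y
    rw [abs_of_pos (Real.exp_pos y), smul_eq_mul, ← mul_assoc, ← Real.exp_mul, ← Real.exp_add]
    congr 2; ring
  rw [e]
  set c := (√(8 * Real.pi * M.σ ^ 2))⁻¹ * Real.exp (-(θ ^ 2 / (4 * M.σ ^ 2))) with hc
  have hc0 : 0 < c := by have := Real.pi_pos; positivity
  have hmeas : Measurable fun y => Real.exp (-k * y) * M.h (Real.exp y) :=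
    Measurable.mul (by fun_prop) hM.monotone_h_exp.measurable
  refine ⟨hmeas.aestronglyMeasurable, ?_⟩
  have hbound : ENNReal.ofReal c * ∫⁻ y in s, ‖Real.exp (-k * y) * M.h (Real.exp y)‖ₑ < ⊤ := by
    rw [← lintegral_const_mul _ (by fun_prop)]
    refine lt_of_le_of_lt ?_ hM.lintegral_resolvent_lt_top
    refine le_trans (setLIntegral_mono' hs fun y hy => ?_) (setLIntegral_le_lintegral s _)
    refine le_trans (le_of_eq ?_) (mul_le_mul_right
      (resolvent_density_ge hσ hθ0 hθ2 (hsθ y hy)) _)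
    rw [hk y hy, Real.enorm_eq_ofReal_abs, abs_mul, abs_of_pos (Real.exp_pos _),
      ← ENNReal.ofReal_mul hc0.le, ← ENNReal.ofReal_mul (abs_nonneg _)]
    congr 1
    ring
  have hne : ENNReal.ofReal c ≠ 0 := by simpa using hc0
  rw [hasFiniteIntegral_def]
  by_contra! htop
  rw [top_le_iff.1 htop, ENNReal.mul_top hne] at hbound
  exact lt_irrefl _ hbound

lemma Admissible.tame_h (hM : M.Admissible) : Tame M.h := Tame.of_monotoneOn hM.h_mono

/-- For y < 0 the exponent in the resolvent bound is y(b − σ² + θ)/(2σ²) = −my, which gives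
integrability near zero; the rest of the interval is covered by local boundedness. For y > 0 the
exponent is −ny, whence the companion statement at infinity. -/
lemma Admissible.integrableOn_Ioc (hM : M.Admissible) {x : ℝ} (hx : 0 < x) :
    IntegrableOn (fun s => s ^ (-M.m - 1) * M.h s) (Ioc 0 x) := by
  have hσ := hM.σ_ne
  set θ := √((M.b - M.σ ^ 2) ^ 2 + 4 * M.σ ^ 2 * M.r) with hθ
  have hθ0 : 0 < θ := (abs_nonneg _).trans_lt hM.abs_lt_sqrt
  have h1 := hM.integrableOn_exp M.m (s := Iic (-θ)) measurableSet_Iic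
    (fun y hy => by
      have : y ≤ -θ := hy
      rw [abs_of_neg (by linarith)]; linarith)
    (fun y hy => by
      have : y ≤ -θ := hy
      rw [abs_of_neg (by linarith), m, ← hθ]; field_simp; ring)
  have h2 : Ioc 0 (Real.exp (-θ)) ⊆ Real.exp '' Iic (-θ) := fun s hs =>
    ⟨Real.log s, (Real.log_le_iff_le_exp hs.1).2 hs.2, Real.exp_log hs.1⟩
  have h3 : IntegrableOn (fun s => s ^ (-M.m - 1) * M.h s) (Icc (Real.exp (-θ)) (max x (Real.exp (-θ)))) := by
    rw [integrableOn_Icc_iff_integrableOn_Ioc, ← intervalIntegrable_iff_integrableOn_Ioc_of_le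
      (le_max_right _ _)]
    exact hM.tame_h.intervalIntegrable_weight _ (Real.exp_pos _) (lt_max_of_lt_left hx)
  refine ((h1.mono_set h2).union h3).mono_set fun s hs => ?_
  rcases le_total s (Real.exp (-θ)) with h | h
  · exact Or.inl ⟨hs.1, h⟩
  · exact Or.inr ⟨h, hs.2.trans (le_max_left _ _)⟩

lemma Admissible.integrableOn_Ioi (hM : M.Admissible) {x : ℝ} (hx : 0 < x) :
    IntegrableOn (fun s => s ^ (-M.n - 1) * M.h s) (Ioi x) := by
  have hσ := hM.σ_ne
  set θ := √((M.b - M.σ ^ 2) ^ 2 + 4 * M.σ ^ 2 * M.r) with hθ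
  have hθ0 : 0 < θ := (abs_nonneg _).trans_lt hM.abs_lt_sqrt
  have h1 := hM.integrableOn_exp M.n (s := Ici θ) measurableSet_Ici
    (fun y hy => by
      have : θ ≤ y := hy
      rw [abs_of_pos (by linarith)]; linarith)
    (fun y hy => by
      have : θ ≤ y := hy
      rw [abs_of_pos (by linarith), n, ← hθ]; field_simp; ring)
  have h2 : Ici (Real.exp θ) ⊆ Real.exp '' Ici θ := fun s hs =>
    ⟨Real.log s, (Real.le_log_iff_exp_le ((Real.exp_pos _).trans_le hs)).2 hs,
      Real.exp_log ((Real.exp_pos _).trans_le hs)⟩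
  have h3 : IntegrableOn (fun s => s ^ (-M.n - 1) * M.h s) (Icc (min x (Real.exp θ)) (Real.exp θ)) := by
    rw [integrableOn_Icc_iff_integrableOn_Ioc, ← intervalIntegrable_iff_integrableOn_Ioc_of_le
      (min_le_right _ _)]
    exact hM.tame_h.intervalIntegrable_weight _ (lt_min hx (Real.exp_pos _)) (Real.exp_pos _)
  refine ((h1.mono_set h2).union h3).mono_set fun s hs => ?_
  have hs : x < s := hs
  rcases le_total s (Real.exp θ) with h | h
  · exact Or.inr ⟨(min_le_left _ _).trans hs.le, h⟩
  · exact Or.inl h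

end Model

end SwitchAbandon

/-! ### The coefficients of `R_h` and weighted integrals of the payoff -/

namespace SwitchAbandon

namespace Model

/-- The first coefficient of `R_h`. -/
noncomputable def PU (M : Model) (x : ℝ) : ℝ := ∫ s in (0 : ℝ)..x, s ^ (-M.m - 1) * M.h s

/-- The second coefficient of `R_h`. -/
noncomputable def QU (M : Model) (x : ℝ) : ℝ := ∫ s in Ioi x, s ^ (-M.n - 1) * M.h s

variable {M : Model}

lemma Admissible.intervalIntegrable_zero (hM : M.Admissible) {x : ℝ} (hx : 0 < x) :
    IntervalIntegrable (fun s => s ^ (-M.m - 1) * M.h s) volume 0 x :=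
  (intervalIntegrable_iff_integrableOn_Ioc_of_le hx.le).2 (hM.integrableOn_Ioc hx)

lemma Admissible.sol_U (hM : M.Admissible) : M.Sol M.h M.PU M.QU := by
  refine ⟨hM.tame_h, fun a b ha hb => ?_, fun a b ha hb => ?_⟩
  · exact (intervalIntegral.integral_add_adjacent_intervals (hM.intervalIntegrable_zero ha)
      (hM.tame_h.intervalIntegrable_weight _ ha hb)).symm
  · unfold QU J
    linarith [intervalIntegral.integral_interval_add_Ioi (hM.integrableOn_Ioi ha)
      (hM.integrableOn_Ioi hb)]

lemma R_eq_val (x : ℝ) : M.R x = M.val M.PU M.QU x := by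
  unfold R val PU QU C
  ring

lemma Admissible.integral_zero_sub (hM : M.Admissible) (k : ℝ) {x : ℝ} (hx : 0 < x) :
    ∫ s in (0 : ℝ)..x, s ^ (-M.m - 1) * (M.h s - M.r * k) = M.PU x - M.pc k x := by
  have hm := hM.m_neg
  simp only [mul_sub]
  rw [intervalIntegral.integral_sub (hM.intervalIntegrable_zero hx)
    ((intervalIntegral.intervalIntegrable_rpow' (by linarith)).mul_const _),
    intervalIntegral.integral_mul_const, integral_rpow (Or.inl (by linarith))]
  have e : -M.m - 1 + 1 = -M.m := by ring
  rw [e, Real.zero_rpow (by linarith)]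
  unfold PU pc
  field_simp
  ring

lemma Admissible.integral_Ioi_sub (hM : M.Admissible) (k : ℝ) {x : ℝ} (hx : 0 < x) :
    ∫ s in Ioi x, s ^ (-M.n - 1) * (M.h s - M.r * k) = M.QU x - M.qc k x := by
  have hn := hM.n_pos
  simp only [mul_sub]
  rw [integral_sub (hM.integrableOn_Ioi hx)
    ((integrableOn_Ioi_rpow_of_lt (by linarith) hx).mul_const _),
    integral_mul_const, integral_Ioi_rpow_of_lt (by linarith) hx]
  have e : -M.n - 1 + 1 = -M.n := by ring
  rw [e]
  unfold QU qc
  field_simp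

lemma Admissible.J_m_sub (hM : M.Admissible) (k : ℝ) {a b : ℝ} (ha : 0 < a) (hb : 0 < b) :
    J M.m (fun s => M.h s - M.r * k) a b = J M.m M.h a b - (M.pc k b - M.pc k a) := by
  simp only [sub_eq_add_neg (M.h _)]
  rw [J_add_const hM.tame_h hM.m_neg.ne _ ha hb]
  unfold pc
  ring

lemma Admissible.J_n_sub (hM : M.Admissible) (k : ℝ) {a b : ℝ} (ha : 0 < a) (hb : 0 < b) :
    J M.n (fun s => M.h s - M.r * k) a b = J M.n M.h a b + (M.qc k b - M.qc k a) := by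
  simp only [sub_eq_add_neg (M.h _)]
  rw [J_add_const hM.tame_h hM.n_pos.ne' _ ha hb]
  unfold qc
  ring

lemma Admissible.qc_lt_qc (hM : M.Admissible) {c d x : ℝ} (hx : 0 < x) (h : c < d) :
    M.qc c x < M.qc d x :=
  mul_lt_mul_of_pos_right (div_lt_div_of_pos_right (mul_lt_mul_of_pos_left h hM.r_pos) hM.n_pos)
    (Real.rpow_pos_of_pos hx _)

/-! ### Monotonicity and limits of the payoff -/

/-- By monotonicity the limit at zero is an infimum. The conditions on h(0) are used only in this
real-valued form. -/
lemma Admissible.hZero_lt_iff (hM : M.Admissible) (c : ℝ) :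
    M.hZero < (c : EReal) ↔ ∃ x, 0 < x ∧ M.h x < c := by
  have hmono : MonotoneOn (fun x => (M.h x : EReal)) (Ioi 0) := fun x hx y hy hxy =>
    EReal.coe_le_coe_iff.2 (hM.h_mono hx hy hxy)
  have hlim : M.hZero = sInf ((fun x => (M.h x : EReal)) '' Ioi 0) :=
    (hmono.tendsto_nhdsGT (OrderBot.bddBelow _)).limUnder_eq
  rw [hlim, sInf_lt_iff]
  constructor
  · rintro ⟨_, ⟨x, hx, rfl⟩, h⟩
    exact ⟨x, hx, EReal.coe_lt_coe_iff.1 h⟩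
  · rintro ⟨x, hx, h⟩
    exact ⟨_, ⟨x, hx, rfl⟩, EReal.coe_lt_coe_iff.2 h⟩

lemma Admissible.exists_le_h (hM : M.Admissible) (c : ℝ) : ∃ X, 0 < X ∧ ∀ x, X ≤ x → c ≤ M.h x := by
  obtain ⟨X, hX⟩ := (hM.h_tendsto.eventually_ge_atTop c).exists_forall_of_atTop
  exact ⟨max X 1, by positivity, fun x hx => hX x ((le_max_left _ _).trans hx)⟩

lemma Admissible.exists_sign_change (hM : M.Admissible) {c : ℝ} (hc : ∃ x, 0 < x ∧ M.h x < c) :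
    ∃ z, 0 < z ∧ (∀ x, 0 < x → x < z → M.h x < c) ∧ ∀ x, z < x → c ≤ M.h x := by
  obtain ⟨y, hy, hyc⟩ := hc
  obtain ⟨X, hX0, hX⟩ := hM.exists_le_h c
  set s := {x | 0 < x ∧ c ≤ M.h x} with hs
  have hne : s.Nonempty := ⟨X, hX0, hX X le_rfl⟩
  have hlb : y ∈ lowerBounds s := fun x hx => by
    by_contra! hxy
    exact absurd ((hM.h_mono hx.1 hy hxy.le).trans_lt hyc) (not_lt.2 hx.2)
  refine ⟨sInf s, hy.trans_le (le_csInf hne hlb), fun x hx hxz => ?_, fun x hx => ?_⟩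
  · by_contra! hcon
    exact absurd (csInf_le ⟨y, hlb⟩ ⟨hx, hcon⟩) (not_le.2 hxz)
  · obtain ⟨w, hw, hwx⟩ := exists_lt_of_csInf_lt hne hx
    exact hw.2.trans (hM.h_mono hw.1 (hw.1.trans hwx) hwx.le)

/-- The difference is the weighted tail integral of h − rk. Its strict positivity comes from the
divergence of `h`: far out, h ≥ r(k + 1). -/
lemma Admissible.QU_sub_pos (hM : M.Admissible) {k x : ℝ} (hx : 0 < x)
    (h : ∀ s, x < s → M.r * k ≤ M.h s) : 0 < M.QU x - M.qc k x := by
  obtain ⟨X, hX0, hX⟩ := hM.exists_le_h (M.r * (k + 1))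
  have hz : x < max X (x + 1) := lt_of_lt_of_le (by linarith) (le_max_right _ _)
  set z := max X (x + 1)
  have hz0 := hx.trans hz
  have h1 : 0 ≤ M.QU z - M.qc (k + 1) z := by
    rw [← hM.integral_Ioi_sub _ hz0]
    refine setIntegral_nonneg measurableSet_Ioi fun s hs => mul_nonneg
      (Real.rpow_nonneg (hz0.trans hs).le _) (sub_nonneg.2 (hX s ?_))
    exact (le_max_left X (x + 1)).trans (le_of_lt hs)
  have h2 := hM.qc_lt_qc hz0 (show k < k + 1 by linarith)
  have h3 : 0 ≤ J M.n (fun s => M.h s - M.r * k) x z :=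
    J_nonneg _ hx hz.le fun s hs => sub_nonneg.2 (h s hs.1)
  rw [hM.J_n_sub _ hx hz0] at h3
  have h4 := hM.sol_U.Q_eq x z hx hz0
  linarith

/-- Far out the integrand is at least s^{-m-1}, whose integral diverges because −m > 0. -/
lemma Admissible.exists_J_m_ge (hM : M.Admissible) (k L : ℝ) {a : ℝ} (ha : 0 < a) :
    ∃ X, a < X ∧ ∀ x, X ≤ x → L ≤ J M.m (fun s => M.h s - M.r * k) a x := by
  have hm := hM.m_neg
  obtain ⟨Y, hY0, hY⟩ := hM.exists_le_h (M.r * k + 1)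
  have hcont := tendsto_rpow_atTop (show 0 < -M.m by linarith)
  obtain ⟨X, hX⟩ := (hcont.eventually_ge_atTop
    ((L - J M.m (fun s => M.h s - M.r * k) a Y) * (-M.m) + Y ^ (-M.m))).exists_forall_of_atTop
  refine ⟨max X (max Y (a + 1)), by
    have := le_max_right X (max Y (a + 1)); have := le_max_right Y (a + 1); linarith, fun x hx => ?_⟩
  have hxX : X ≤ x := (le_max_left _ _).trans hx
  have hxY : Y ≤ x := (le_max_left _ _).trans ((le_max_right _ _).trans hx)
  have hx0 : 0 < x := hY0.trans_le hxY
  have ht : Tame fun s => M.h s - M.r * k := hM.tame_h.sub_const _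
  have h1 : J M.m (fun _ => 1) Y x ≤ J M.m (fun s => M.h s - M.r * k) Y x :=
    J_mono (Tame.const 1) ht _ hY0 hxY fun s hs => by linarith [hY s hs.1]
  rw [J_const hm.ne _ hY0 hx0] at h1
  rw [← J_add_adjacent ht _ ha hY0 hx0]
  have h2 := hX x hxX
  have h3 : L - J M.m (fun s => M.h s - M.r * k) a Y ≤ 1 * (Y ^ (-M.m) - x ^ (-M.m)) / M.m := by
    rw [le_div_iff_of_neg hm]
    linarith
  linarith

/-- On ]0, z] the integrand is at most a negative multiple of s^{-n-1}, which is not integrable at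
zero. -/
lemma Admissible.exists_J_n_le (hM : M.Admissible) {k : ℝ} (L : ℝ) {z : ℝ} (hz : 0 < z)
    (hk : M.h z < M.r * k) :
    ∃ y, 0 < y ∧ y < z ∧ ∀ x, 0 < x → x ≤ y → J M.n (fun s => M.h s - M.r * k) x z ≤ L := by
  have hn := hM.n_pos
  have hlim := tendsto_rpow_neg_nhdsGT_zero (neg_lt_zero.2 hn)
  have hev := hlim.eventually_ge_atTop (L * M.n / (M.h z - M.r * k) + z ^ (-M.n))
  obtain ⟨u, hu, hu'⟩ := mem_nhdsGT_iff_exists_Ioc_subset.1 hev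
  have hu : 0 < u := hu
  refine ⟨min u (z / 2), by positivity, (min_le_right _ _).trans_lt (by linarith),
    fun x hx hxy => ?_⟩
  have hxz : x ≤ z := hxy.trans ((min_le_right _ _).trans (by linarith))
  have h1 : J M.n (fun s => M.h s - M.r * k) x z ≤ J M.n (fun _ => M.h z - M.r * k) x z :=
    J_mono (hM.tame_h.sub_const _) (Tame.const _) _ hx hxz fun s hs =>
      sub_le_sub_right (hM.h_mono (hx.trans_le hs.1) hz hs.2) _
  rw [J_const hn.ne' _ hx hz] at h1
  refine h1.trans ?_
  have h2 : L * M.n / (M.h z - M.r * k) + z ^ (-M.n) ≤ x ^ (-M.n) :=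
    hu' ⟨hx, hxy.trans (min_le_left _ _)⟩
  have h3 : L * M.n / (M.h z - M.r * k) ≤ x ^ (-M.n) - z ^ (-M.n) := by linarith
  rw [div_le_iff_of_neg (by linarith)] at h3
  rw [div_le_iff₀ hn]
  linarith

/-! ### Solutions of minimal growth at infinity -/

section

variable {P : ℝ → ℝ} {a b c x : ℝ}

/-- Criticality makes the weighted tail integral of h − rc from `a` vanish, which is impossible if h
≥ rc from `a` on. -/
lemma Sol.lt_of_crit_QU (hM : M.Admissible) (ha : 0 < a)
    (hc : M.Crit P M.QU a c) : M.h a < M.r * c := by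
  by_contra! hcon
  have := hM.QU_sub_pos ha fun s hs => hcon.trans (hM.h_mono ha (ha.trans hs) (le_of_lt hs))
  rw [hc.Q_eq, sub_self] at this
  exact lt_irrefl _ this

lemma Sol.slope_pos_QU (hM : M.Admissible) (h : M.Sol M.h P M.QU) (hb : 0 < b)
    (hs : 0 < M.slope P M.QU b) (hx : b ≤ x) : 0 < M.slope P M.QU x := by
  by_contra! hcon
  obtain ⟨y, hy, hy0⟩ := h.exists_slope_eq_zero hb hx (Or.inr ⟨hs.le, hcon⟩)
  have hby : b < y := lt_of_le_of_ne hy.1 fun e => by rw [← e] at hy0; linarith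
  have hc := hM.crit_of_slope (hb.trans hby) hy0
  have := h.slope_neg_of_lt hM hb hc hby (Sol.lt_of_crit_QU hM (hb.trans hby) hc)
  linarith

/-- Right continuity extends h(a) < rc to an interval on the right of `a`. The slope is positive
there, and `Sol.slope_pos_QU` propagates this to all larger points. -/
lemma Sol.slope_pos_of_crit_QU (hM : M.Admissible) (h : M.Sol M.h P M.QU) (ha : 0 < a)
    (hc : M.Crit P M.QU a c) (hx : a < x) : 0 < M.slope P M.QU x := by
  have hlt := Sol.lt_of_crit_QU hM ha hc
  have hev : ∀ᶠ s in 𝓝[≥] a, M.h s < M.r * c :=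
    (hM.h_rightCont a ha).eventually (gt_mem_nhds hlt)
  obtain ⟨u, hu, hu'⟩ := mem_nhdsGE_iff_exists_Icc_subset.1 hev
  have hu : a < u := hu
  have hy : a < min u x := lt_min hu hx
  refine h.slope_pos_QU hM (b := min u x) (ha.trans hy) ?_ (min_le_right _ _)
  exact h.slope_pos_right hM ha hc hy fun s hs =>
    hu' ⟨hs.1.le, hs.2.le.trans (min_le_left _ _)⟩

lemma Sol.le_val_of_crit_QU (hM : M.Admissible) (h : M.Sol M.h P M.QU) (ha : 0 < a)
    (hc : M.Crit P M.QU a c) (hx : 0 < x) : c ≤ M.val P M.QU x := by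
  rw [← ((hM.crit_iff ha).1 hc).2]
  rcases le_total x a with hxa | hax
  · exact (h.antitoneOn hM hx (b := a) fun s hs => (h.slope_neg_of_lt hM (hx.trans hs.1) hc hs.2
      (Sol.lt_of_crit_QU hM ha hc)).le) (left_mem_Icc.2 hxa) (right_mem_Icc.2 hxa) hxa
  · exact (h.monotoneOn hM ha (b := x) fun s hs => (h.slope_pos_of_crit_QU hM ha hc hs.1).le)
      (left_mem_Icc.2 hax) (right_mem_Icc.2 hax) hax

end

end Model

end SwitchAbandon

namespace SwitchAbandon

namespace Model

variable {M : Model}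

/-! ### The Green kernel -/

/-- The kernel equals s⁻¹((x/s)^m − (x/s)^n) with m < n, so its sign depends only on whether x/s is
below or above 1. -/
lemma Admissible.kernel_pos (hM : M.Admissible) {x s : ℝ} (hx : 0 < x) (hs : x < s) :
    0 < x ^ M.m * s ^ (-M.m - 1) - x ^ M.n * s ^ (-M.n - 1) := by
  have hs0 := hx.trans hs
  have e : ∀ k : ℝ, x ^ k * s ^ (-k - 1) = s⁻¹ * (x / s) ^ k := fun k => by
    rw [Real.div_rpow hx.le hs0.le, Real.rpow_sub_one hs0.ne', Real.rpow_neg hs0.le]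
    field_simp
  rw [e, e, ← mul_sub]
  refine mul_pos (inv_pos.2 hs0) (sub_pos.2 (Real.rpow_lt_rpow_of_exponent_gt (by positivity)
    ((div_lt_one hs0).2 hs) ?_))
  linarith [hM.m_neg, hM.n_pos]

lemma Admissible.kernel_neg (hM : M.Admissible) {x s : ℝ} (hs0 : 0 < s) (hs : s < x) :
    x ^ M.m * s ^ (-M.m - 1) - x ^ M.n * s ^ (-M.n - 1) < 0 := by
  have hx := hs0.trans hs
  have e : ∀ k : ℝ, x ^ k * s ^ (-k - 1) = s⁻¹ * (x / s) ^ k := fun k => by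
    rw [Real.div_rpow hx.le hs0.le, Real.rpow_sub_one hs0.ne', Real.rpow_neg hs0.le]
    field_simp
  rw [e, e, ← mul_sub]
  refine mul_neg_of_pos_of_neg (inv_pos.2 hs0) (sub_neg.2 (Real.rpow_lt_rpow_of_exponent_lt
    ((one_lt_div hs0).2 hs) ?_))
  linarith [hM.m_neg, hM.n_pos]

lemma kernel_eq {f : ℝ → ℝ} (hf : Tame f) (x : ℝ) {a b : ℝ} (ha : 0 < a) (hb : 0 < b) :
    x ^ M.m * J M.m f a b - x ^ M.n * J M.n f a b =
      ∫ s in a..b, (x ^ M.m * s ^ (-M.m - 1) - x ^ M.n * s ^ (-M.n - 1)) * f s := by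
  unfold J
  simp only [sub_mul, mul_assoc]
  rw [intervalIntegral.integral_sub ((hf.intervalIntegrable_weight _ ha hb).const_mul _)
    ((hf.intervalIntegrable_weight _ ha hb).const_mul _),
    intervalIntegral.integral_const_mul, intervalIntegral.integral_const_mul]

lemma kernel_integrable {f : ℝ → ℝ} (hf : Tame f) (x : ℝ) {a b : ℝ} (ha : 0 < a) (hb : 0 < b) :
    IntervalIntegrable (fun s => (x ^ M.m * s ^ (-M.m - 1) - x ^ M.n * s ^ (-M.n - 1)) * f s)
      volume a b := by
  simp only [sub_mul, mul_assoc]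
  exact ((hf.intervalIntegrable_weight _ ha hb).const_mul _).sub
    ((hf.intervalIntegrable_weight _ ha hb).const_mul _)

lemma Admissible.kernel_left_nonneg (hM : M.Admissible) {f : ℝ → ℝ} (hf : Tame f) {x a b : ℝ}
    (hx : 0 < x) (hxa : x ≤ a) (hab : a ≤ b) (h : ∀ s ∈ Ioo a b, 0 ≤ f s) :
    0 ≤ x ^ M.m * J M.m f a b - x ^ M.n * J M.n f a b := by
  have ha := hx.trans_le hxa
  rw [kernel_eq hf x ha (ha.trans_le hab), intervalIntegral.integral_of_le hab,
    integral_Ioc_eq_integral_Ioo]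
  exact setIntegral_nonneg measurableSet_Ioo fun s hs =>
    mul_nonneg (hM.kernel_pos hx (hxa.trans_lt hs.1)).le (h s hs)

lemma Admissible.kernel_left_pos (hM : M.Admissible) {f : ℝ → ℝ} (hf : Tame f) {x a b : ℝ}
    (hx : 0 < x) (hxa : x ≤ a) (hab : a < b) (h : ∀ s ∈ Ioo a b, 0 < f s) :
    0 < x ^ M.m * J M.m f a b - x ^ M.n * J M.n f a b := by
  have ha := hx.trans_le hxa
  rw [kernel_eq hf x ha (ha.trans hab)]
  exact intervalIntegral.intervalIntegral_pos_of_pos_on (kernel_integrable hf x ha (ha.trans hab))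
    (fun s hs => mul_pos (hM.kernel_pos hx (hxa.trans_lt hs.1)) (h s hs)) hab

lemma Admissible.kernel_left_neg (hM : M.Admissible) {f : ℝ → ℝ} (hf : Tame f) {x a b : ℝ}
    (hx : 0 < x) (hxa : x ≤ a) (hab : a < b) (h : ∀ s ∈ Ioo a b, f s < 0) :
    x ^ M.m * J M.m f a b - x ^ M.n * J M.n f a b < 0 := by
  have := hM.kernel_left_pos hf.neg hx hxa hab fun s hs => neg_pos.2 (h s hs)
  rw [J_neg_fun, J_neg_fun] at this
  linarith

lemma Admissible.kernel_right_pos (hM : M.Admissible) {f : ℝ → ℝ} (hf : Tame f) {x a b : ℝ}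
    (ha : 0 < a) (hbx : b ≤ x) (hab : a < b) (h : ∀ s ∈ Ioo a b, f s < 0) :
    0 < x ^ M.m * J M.m f a b - x ^ M.n * J M.n f a b := by
  rw [kernel_eq hf x ha (ha.trans hab)]
  exact intervalIntegral.intervalIntegral_pos_of_pos_on (kernel_integrable hf x ha (ha.trans hab))
    (fun s hs => mul_pos_of_neg_of_neg (hM.kernel_neg (ha.trans hs.1) (hs.2.trans_le hbx))
      (h s hs)) hab

/-! ### The solution with a prescribed critical point -/

/-- First coefficient of the solution with the critical value `c` at `a`. -/
noncomputable def Pa (M : Model) (c a x : ℝ) : ℝ := M.PU x + (M.pc c a - M.PU a)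

/-- Second coefficient of the solution with the critical value `c` at `a`. -/
noncomputable def Qa (M : Model) (c a x : ℝ) : ℝ := M.QU x + (M.qc c a - M.QU a)

lemma Admissible.sol_a (hM : M.Admissible) (c a : ℝ) : M.Sol M.h (M.Pa c a) (M.Qa c a) :=
  hM.sol_U.add_hom _ _

lemma crit_a (M : Model) (c a : ℝ) : M.Crit (M.Pa c a) (M.Qa c a) a c :=
  ⟨by unfold Pa; ring, by unfold Qa; ring⟩

/-- With `Qa` the function models the difference w₁ − w₀ around the switching points, with `QU` it
models w₁ itself. The two differ by a multiple of xⁿ, the form of w₀ below the upper switching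
point. -/
lemma Admissible.sol_U_a (hM : M.Admissible) (c a : ℝ) : M.Sol M.h (M.Pa c a) M.QU := by
  have := hM.sol_U.add_hom (M.pc c a - M.PU a) 0
  simp only [add_zero] at this
  exact this

lemma Admissible.Pa_sub (hM : M.Admissible) (c : ℝ) {a a' : ℝ} (x : ℝ) (ha : 0 < a)
    (ha' : 0 < a') :
    M.Pa c a x - M.Pa c a' x = J M.m (fun s => M.h s - M.r * c) a a' := by
  rw [hM.J_m_sub _ ha ha']
  unfold Pa
  rw [hM.sol_U.P_eq a a' ha ha']
  ring

lemma Admissible.Qa_sub (hM : M.Admissible) (c : ℝ) {a a' : ℝ} (x : ℝ) (ha : 0 < a)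
    (ha' : 0 < a') :
    M.Qa c a x - M.Qa c a' x = -J M.n (fun s => M.h s - M.r * c) a a' := by
  rw [hM.J_n_sub _ ha ha']
  unfold Qa
  rw [hM.sol_U.Q_eq a a' ha ha']
  ring

/-- Moving the prescribed critical point from `a` to `a'` changes the value at `x` by a Green kernel
integral of h − rc between them. The comparison lemmas below combine the sign of h − rc with the
position of `x`. -/
lemma Admissible.val_a_sub (hM : M.Admissible) (c : ℝ) {a a' x : ℝ} (ha : 0 < a)
    (ha' : 0 < a') :
    M.val (M.Pa c a) (M.Qa c a) x - M.val (M.Pa c a') (M.Qa c a') x =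
      (x ^ M.m * J M.m (fun s => M.h s - M.r * c) a a'
        - x ^ M.n * J M.n (fun s => M.h s - M.r * c) a a') / M.C := by
  unfold val
  rw [← hM.Pa_sub c x ha ha', ← neg_neg (J M.n _ _ _), ← hM.Qa_sub c x ha ha']
  ring

lemma Admissible.val_a_anti (hM : M.Admissible) {c a a' x : ℝ} (hx : 0 < x) (hxa : x ≤ a)
    (haa' : a ≤ a') (h : M.r * c ≤ M.h a) :
    M.val (M.Pa c a') (M.Qa c a') x ≤ M.val (M.Pa c a) (M.Qa c a) x := by
  have ha := hx.trans_le hxa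
  have := hM.kernel_left_nonneg (hM.tame_h.sub_const (M.r * c)) hx hxa haa' fun s hs =>
    sub_nonneg.2 (h.trans (hM.h_mono ha (ha.trans hs.1) hs.1.le))
  rw [← sub_nonneg, hM.val_a_sub c ha (ha.trans_le haa')]
  exact div_nonneg this hM.C_pos.le

lemma Admissible.val_a_lt_of_h_gt (hM : M.Admissible) {c a a' x : ℝ} (hx : 0 < x) (hxa : x ≤ a)
    (haa' : a < a') (h : M.r * c < M.h a) :
    M.val (M.Pa c a') (M.Qa c a') x < M.val (M.Pa c a) (M.Qa c a) x := by
  have ha := hx.trans_le hxa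
  have := hM.kernel_left_pos (hM.tame_h.sub_const (M.r * c)) hx hxa haa' fun s hs =>
    sub_pos.2 (h.trans_le (hM.h_mono ha (ha.trans hs.1) hs.1.le))
  rw [← sub_pos, hM.val_a_sub c ha (ha.trans haa')]
  exact div_pos this hM.C_pos

lemma Admissible.val_a_lt_of_h_lt (hM : M.Admissible) {c a a' x : ℝ} (hx : 0 < x) (hxa : x ≤ a)
    (haa' : a < a') (h : ∀ s, 0 < s → s < a' → M.h s < M.r * c) :
    M.val (M.Pa c a) (M.Qa c a) x < M.val (M.Pa c a') (M.Qa c a') x := by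
  have ha := hx.trans_le hxa
  have := hM.kernel_left_neg (hM.tame_h.sub_const (M.r * c)) hx hxa haa' fun s hs =>
    sub_neg.2 (h s (ha.trans hs.1) hs.2)
  rw [← sub_neg, hM.val_a_sub c ha (ha.trans haa')]
  exact div_neg_of_neg_of_pos this hM.C_pos

lemma Admissible.val_a_gt_of_h_lt (hM : M.Admissible) {c a a' x : ℝ} (ha : 0 < a) (hax : a' ≤ x)
    (haa' : a < a') (h : ∀ s, 0 < s → s < a' → M.h s < M.r * c) :
    M.val (M.Pa c a') (M.Qa c a') x < M.val (M.Pa c a) (M.Qa c a) x := by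
  have := hM.kernel_right_pos (hM.tame_h.sub_const (M.r * c)) ha hax haa' fun s hs =>
    sub_neg.2 (h s (ha.trans hs.1) hs.2)
  rw [← sub_pos, hM.val_a_sub c ha (ha.trans haa')]
  exact div_pos this hM.C_pos

/-! ### The critical cost -/

lemma Admissible.pc_sub_pos (hM : M.Admissible) {c d x : ℝ} (hx : 0 < x) (h : c < d) :
    M.pc c x < M.pc d x := by
  have h1 := mul_lt_mul_of_pos_left h hM.r_pos
  have h2 := div_lt_div_of_neg_of_lt hM.m_neg h1
  exact mul_lt_mul_of_pos_right (by linarith) (Real.rpow_pos_of_pos hx _)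

/-- The two conditions are triangular: the first involves only `δ`, and the second then determines
`α`. -/
lemma Admissible.crit_U_iff (hM : M.Admissible) {c d δ α : ℝ} (hδ : 0 < δ) (hα : 0 < α) :
    M.Crit (M.Pa c α) M.QU δ d ↔ M.QU δ = M.qc d δ ∧
      J M.m (fun s => M.h s - M.r * c) δ α = M.pc c δ - M.pc d δ := by
  rw [hM.J_m_sub _ hδ hα]
  have := hM.sol_U.P_eq δ α hδ hα
  constructor
  · rintro ⟨h1, h2⟩
    unfold Pa at h1
    exact ⟨h2, by linarith⟩
  · rintro ⟨h1, h2⟩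
    exact ⟨by unfold Pa; linarith, h1⟩

/-- The integral equations are smooth fit conditions for two functions sharing the first coefficient
`Pa K₁ α`: the candidate w₁, with Q = `QU`, fits −K at `δ`, and the difference w₁ − w₀ has critical
value −k at `x`. -/
lemma Admissible.isCriticalCost_iff (hM : M.Admissible) (k : ℝ) :
    M.IsCriticalCost k ↔ ∃ δ α x, 0 < δ ∧ δ < x ∧ x < α ∧
      M.Crit (M.Pa M.K₁ α) M.QU δ (-M.K) ∧ M.Crit (M.Pa M.K₁ α) (M.Qa M.K₁ α) x (-k) := by
  have hm := hM.m_neg.ne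
  have hn := hM.n_pos.ne'
  have hr := hM.r_pos.ne'
  have hC := hM.C_pos.ne'
  have main : ∀ δ α x, 0 < δ → δ < x → x < α →
      (((∫ s in Ioi δ, s ^ (-M.n - 1) * (M.h s + M.r * M.K)) = 0 ∧
        M.m * (∫ s in δ..α, s ^ (-M.m - 1) * (M.h s - M.r * M.K₁))
          + M.r * (M.K₁ + M.K) * δ ^ (-M.m) = 0) ↔ M.Crit (M.Pa M.K₁ α) M.QU δ (-M.K)) ∧
      ((M.m * x ^ (M.m - 1) / (M.σ ^ 2 * (M.n - M.m)) *
          (∫ s in x..α, s ^ (-M.m - 1) * (M.h s - M.r * M.K₁))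
        - M.n * x ^ (M.n - 1) / (M.σ ^ 2 * (M.n - M.m)) *
          (∫ s in x..α, s ^ (-M.n - 1) * (M.h s - M.r * M.K₁)) = 0 ∧
        k = -M.K₁ - M.m * x ^ M.m / M.r *
          ∫ s in x..α, s ^ (-M.m - 1) * (M.h s - M.r * M.K₁)) ↔
        M.Crit (M.Pa M.K₁ α) (M.Qa M.K₁ α) x (-k)) := by
    intro δ α x hδ hδx hxα
    have hx := hδ.trans hδx
    have hα := hx.trans hxα
    constructor
    · rw [hM.crit_U_iff hδ hα]
      have e1 : ∫ s in Ioi δ, s ^ (-M.n - 1) * (M.h s + M.r * M.K)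
          = M.QU δ - M.qc (-M.K) δ := by
        rw [← hM.integral_Ioi_sub _ hδ]
        simp only [mul_neg, sub_neg_eq_add]
      rw [e1, sub_eq_zero]
      refine and_congr_right fun _ => ?_
      change M.m * J M.m (fun s => M.h s - M.r * M.K₁) δ α + _ = 0 ↔ _
      have e2 : M.pc M.K₁ δ - M.pc (-M.K) δ = -(M.r * (M.K₁ + M.K) * δ ^ (-M.m)) / M.m := by
        unfold pc; field_simp; ring
      rw [e2, eq_div_iff hm, mul_comm M.m]
      exact add_eq_zero_iff_eq_neg
    · rw [hM.crit_iff hx]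
      have s1 := (hM.sol_a M.K₁ α).slope_eq hM hα (crit_a M M.K₁ α) hx
      have v1 := (hM.sol_a M.K₁ α).val_eq hM hα (crit_a M M.K₁ α) hx
      rw [J_symm _ _ x α, J_symm _ _ x α] at s1 v1
      rw [Real.rpow_sub_one hx.ne', Real.rpow_sub_one hx.ne']
      change (M.m * (x ^ M.m / x) / M.C * J M.m (fun s => M.h s - M.r * M.K₁) x α
        - M.n * (x ^ M.n / x) / M.C * J M.n (fun s => M.h s - M.r * M.K₁) x α = 0 ∧
        k = -M.K₁ - M.m * x ^ M.m / M.r * J M.m (fun s => M.h s - M.r * M.K₁) x α) ↔ _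
      generalize J M.m (fun s => M.h s - M.r * M.K₁) x α = u at *
      generalize J M.n (fun s => M.h s - M.r * M.K₁) x α = w at *
      have es : M.m * (x ^ M.m / x) / M.C * u - M.n * (x ^ M.n / x) / M.C * w
          = -(M.slope (M.Pa M.K₁ α) (M.Qa M.K₁ α) x / x) := by
        rw [s1]; ring
      rw [es, neg_eq_zero, div_eq_zero_iff, or_iff_left hx.ne']
      refine and_congr_right fun h0 => ?_
      rw [s1, div_eq_zero_iff, or_iff_left hC] at h0
      -- Vanishing slope eliminates the integral with the exponent n from the value, and σ²mn = −r
      -- simplifies the remaining coefficient.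
      have ev : M.val (M.Pa M.K₁ α) (M.Qa M.K₁ α) x = M.K₁ + M.m * x ^ M.m / M.r * u := by
        rw [v1, add_right_inj, div_eq_iff hC]
        have h1 : M.n * (x ^ M.m * -u - x ^ M.n * -w) = (M.m - M.n) * (x ^ M.m * u) := by
          linear_combination h0
        apply mul_left_cancel₀ hn
        rw [h1]
        unfold C
        field_simp
        linear_combination u * (M.m - M.n) * hM.mn_eq
      rw [ev]
      constructor <;> intro h <;> linarith
  constructor
  · rintro ⟨δ, α, x, hδ, _, h1, h2, hδx, hxα, h3, h4⟩
    exact ⟨δ, α, x, hδ, hδx, hxα, (main δ α x hδ hδx hxα).1.1 ⟨h1, h2⟩,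
      (main δ α x hδ hδx hxα).2.1 ⟨h3, h4⟩⟩
  · rintro ⟨δ, α, x, hδ, hδx, hxα, h1, h2⟩
    have a1 := (main δ α x hδ hδx hxα).1.2 h1
    have a2 := (main δ α x hδ hδx hxα).2.2 h2
    exact ⟨δ, α, x, hδ, hδx.trans hxα, a1.1, a1.2, hδx, hxα, a2.1, a2.2⟩

end Model

end SwitchAbandon

/-! ### Abandonment in place of switching out: existence and uniqueness of the critical cost -/

namespace SwitchAbandon

namespace Model

variable {M : Model}

lemma slope_add_Q (M : Model) (P Q : ℝ → ℝ) (q x : ℝ) :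
    M.slope P (fun s => Q s + q) x = M.slope P Q x + M.n * x ^ M.n * q / M.C := by
  unfold slope; ring

lemma val_add_Q (M : Model) (P Q : ℝ → ℝ) (q x : ℝ) :
    M.val P (fun s => Q s + q) x = M.val P Q x + x ^ M.n * q / M.C := by
  unfold val; ring

section

variable {c d δ α : ℝ}

/-- If the option to abandon is exercised at `δ`, then the payoff exceeds `r c` before `α`. -/
lemma Admissible.exists_h_gt (hM : M.Admissible) (hδ : 0 < δ) (hδα : δ < α) (hdc : d < c)
    (hU : M.Crit (M.Pa c α) M.QU δ d) : ∃ s ∈ Ioo δ α, M.r * c < M.h s := by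
  by_contra! hcon
  have h1 := ((hM.crit_U_iff hδ (hδ.trans hδα)).1 hU).2
  have h2 := J_nonpos M.m hδ hδα.le fun s hs => sub_nonpos.2 (hcon s hs)
  have := hM.pc_sub_pos hδ hdc
  linarith

lemma Admissible.h_gt_of_crit_U (hM : M.Admissible) (hδ : 0 < δ) (hδα : δ < α) (hdc : d < c)
    (hU : M.Crit (M.Pa c α) M.QU δ d) : M.r * c < M.h α := by
  obtain ⟨s, hs, h⟩ := hM.exists_h_gt hδ hδα hdc hU
  exact h.trans_le (hM.h_mono (hδ.trans hs.1) (hδ.trans hδα) hs.2.le)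

/-- Any critical point of the difference of the value functions is its minimum point. -/
lemma Admissible.isMin_of_crit_U (hM : M.Admissible) (hδ : 0 < δ) (hδα : δ < α) (hdc : d < c)
    (hU : M.Crit (M.Pa c α) M.QU δ d) {x e : ℝ} (hx : 0 < x) (hxα : x < α)
    (hD : M.Crit (M.Pa c α) (M.Qa c α) x e) :
    M.h x < M.r * e ∧ (∀ y, 0 < y → y < x → M.slope (M.Pa c α) (M.Qa c α) y < 0) ∧
      ∀ y ∈ Ioo x α, 0 < M.slope (M.Pa c α) (M.Qa c α) y := by
  obtain ⟨s, hs, h⟩ := hM.exists_h_gt hδ hδα hdc hU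
  have hsol := hM.sol_a c α
  have hpos : ∀ y, s < y → y < α → 0 < M.slope (M.Pa c α) (M.Qa c α) y := fun y hy hyα =>
    hsol.slope_pos_left hM ((hδ.trans hs.1).trans hy) (crit_a M c α) hyα fun t ht =>
      h.trans_le (hM.h_mono (hδ.trans hs.1) (((hδ.trans hs.1).trans hy).trans ht.1)
        (hy.trans ht.1).le)
  have key : ∀ y, y < α → ∃ b, y < b ∧ x < b ∧ b < α ∧ 0 < M.slope (M.Pa c α) (M.Qa c α) b := by
    intro y hy
    obtain ⟨b, hb1, hb2⟩ := exists_between (max_lt hy (max_lt hxα hs.2))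
    have hb3 := max_lt_iff.1 hb1
    have hb4 := max_lt_iff.1 hb3.2
    exact ⟨b, hb3.1, hb4.1, hb2, hpos b hb4.2 hb2⟩
  obtain ⟨b, hb1, hb2, hb3, hb4⟩ := key x hxα
  have h1 := hsol.isMin_of_slope_pos hM hx hD hb2 hb4
  refine ⟨h1.1, h1.2.1, fun y hy => ?_⟩
  obtain ⟨b, hb1, hb2, hb3, hb4⟩ := key y hy.2
  exact (hsol.isMin_of_slope_pos hM hx hD hb2 hb4).2.2 y ⟨hy.1, hb1.le⟩

lemma Admissible.le_val_of_crit_U (hM : M.Admissible) (hδ : 0 < δ) (hδα : δ < α) (hdc : d < c)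
    (hU : M.Crit (M.Pa c α) M.QU δ d) {x e : ℝ} (hx : 0 < x) (hxα : x < α)
    (hD : M.Crit (M.Pa c α) (M.Qa c α) x e) {y : ℝ} (hy : 0 < y) (hyα : y ≤ α) :
    e ≤ M.val (M.Pa c α) (M.Qa c α) y := by
  obtain ⟨_, h2, h3⟩ := hM.isMin_of_crit_U hδ hδα hdc hU hx hxα hD
  rw [← ((hM.crit_iff hx).1 hD).2]
  have hsol := hM.sol_a c α
  rcases le_total y x with hyx | hxy
  · exact (hsol.antitoneOn hM hy (b := x) fun s hs => (h2 s (hy.trans hs.1) hs.2).le)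
      (left_mem_Icc.2 hyx) (right_mem_Icc.2 hyx) hyx
  · exact (hsol.monotoneOn hM hx (b := y) fun s hs => (h3 s ⟨hs.1, hs.2.trans_le hyα⟩).le)
      (left_mem_Icc.2 hxy) (right_mem_Icc.2 hxy) hxy

/-- At `δ` the solution with `QU` has slope zero; passing to `Qa` subtracts a positive multiple of
xⁿ, so the slope becomes negative. Shortly before `α` it is positive because h > rc there. The
intermediate value theorem applies. -/
lemma Admissible.exists_crit_of_crit_U (hM : M.Admissible) (hδ : 0 < δ) (hδα : δ < α)
    (hdc : d < c) (hU : M.Crit (M.Pa c α) M.QU δ d) :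
    ∃ x e, δ < x ∧ x < α ∧ M.Crit (M.Pa c α) (M.Qa c α) x e := by
  have hα := hδ.trans hδα
  obtain ⟨s, hs, h⟩ := hM.exists_h_gt hδ hδα hdc hU
  have hsol := hM.sol_a c α
  obtain ⟨b, hb1, hb2⟩ := exists_between hs.2
  have hpos : 0 < M.slope (M.Pa c α) (M.Qa c α) b :=
    hsol.slope_pos_left hM ((hδ.trans hs.1).trans hb1) (crit_a M c α) hb2 fun t ht =>
      h.trans_le (hM.h_mono (hδ.trans hs.1) (((hδ.trans hs.1).trans hb1).trans ht.1)
        (hb1.trans ht.1).le)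
  have hneg : M.slope (M.Pa c α) (M.Qa c α) δ < 0 := by
    have e1 := slope_add_Q M (M.Pa c α) M.QU (M.qc c α - M.QU α) δ
    have e2 := hM.QU_sub_pos hα fun t ht =>
      (hM.h_gt_of_crit_U hδ hδα hdc hU).le.trans (hM.h_mono hα (hα.trans ht) (le_of_lt ht))
    rw [((hM.crit_iff hδ).1 hU).1, zero_add] at e1
    change M.slope (M.Pa c α) (fun s => M.QU s + (M.qc c α - M.QU α)) δ < 0
    rw [e1]
    exact div_neg_of_neg_of_pos (mul_neg_of_pos_of_neg (mul_pos hM.n_pos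
      (Real.rpow_pos_of_pos hδ _)) (by linarith)) hM.C_pos
  obtain ⟨x, hx, hx0⟩ := hsol.exists_slope_eq_zero hδ (hs.1.trans hb1).le
    (Or.inl ⟨hneg.le, hpos.le⟩)
  have hδx : δ < x := lt_of_le_of_ne hx.1 fun e => by rw [← e] at hx0; linarith
  exact ⟨x, _, hδx, hx.2.trans_lt hb2, hM.crit_of_slope (hδ.trans hδx) hx0⟩

/-- The abandonment point and the switching point are unique. -/
lemma Admissible.crit_U_unique (hM : M.Admissible) {δ' α' : ℝ} (hδ : 0 < δ) (hδα : δ < α)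
    (hδ' : 0 < δ') (hδα' : δ' < α') (hdc : d < c) (hU : M.Crit (M.Pa c α) M.QU δ d)
    (hU' : M.Crit (M.Pa c α') M.QU δ' d) : δ = δ' ∧ α = α' := by
  -- Between two candidates for the abandonment point the weighted integral of h − rd would vanish,
  -- although h < rd up to the right one. Below, `key2` is the analogue for `α`, with h > rc from
  -- the left one on.
  have key1 : ∀ x y, 0 < x → x < y → M.QU x = M.qc d x → M.QU y = M.qc d y →
      M.h y < M.r * d → False := by
    intro x y hx hxy ex ey hy
    have hy0 := hx.trans hxy
    have h1 := J_neg (hM.tame_h.sub_const (M.r * d)) M.n hx hxy fun s hs =>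
      sub_neg.2 ((hM.h_mono (hx.trans hs.1) hy0 hs.2.le).trans_lt hy)
    rw [hM.J_n_sub _ hx hy0] at h1
    have h2 := hM.sol_U.Q_eq x y hx hy0
    linarith
  have hδδ : δ = δ' := by
    rcases lt_trichotomy δ δ' with h | h | h
    · exact (key1 _ _ hδ h hU.Q_eq hU'.Q_eq (Sol.lt_of_crit_QU hM hδ' hU')).elim
    · exact h
    · exact (key1 _ _ hδ' h hU'.Q_eq hU.Q_eq (Sol.lt_of_crit_QU hM hδ hU)).elim
  subst hδδ
  have key2 : ∀ x y, 0 < x → x < y → M.r * c < M.h x → M.Pa c x δ = M.Pa c y δ → False := by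
    intro x y hx hxy hh e
    have h1 := J_pos (hM.tame_h.sub_const (M.r * c)) M.m hx hxy fun s hs =>
      sub_pos.2 (hh.trans_le (hM.h_mono hx (hx.trans hs.1) hs.1.le))
    rw [← hM.Pa_sub c δ hx (hx.trans hxy), e, sub_self] at h1
    exact lt_irrefl _ h1
  have hP := hU.P_eq.trans hU'.P_eq.symm
  refine ⟨rfl, ?_⟩
  rcases lt_trichotomy α α' with h | h | h
  · exact (key2 _ _ (hδ.trans hδα) h (hM.h_gt_of_crit_U hδ hδα hdc hU) hP).elim
  · exact h
  · exact (key2 _ _ (hδ.trans hδα') h (hM.h_gt_of_crit_U hδ hδα' hdc hU') hP.symm).elim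

/-- The weighted tail integral of h − rd is positive at the sign change of h − rd and takes
nonpositive values near zero, where the weight is not integrable. -/
lemma Admissible.exists_QU_eq (hM : M.Admissible) (hd : ∃ x, 0 < x ∧ M.h x < M.r * d) :
    ∃ δ, 0 < δ ∧ M.QU δ = M.qc d δ := by
  obtain ⟨z, hz, hz1, hz2⟩ := hM.exists_sign_change hd
  have hz' : 0 < z / 2 := by positivity
  obtain ⟨y, hy, hyz, hy'⟩ := hM.exists_J_n_le (k := d)
    (-(M.QU (z / 2) - M.qc d (z / 2))) hz' (hz1 _ hz' (by linarith))
  have h1 := hy' y hy le_rfl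
  rw [hM.J_n_sub _ hy hz'] at h1
  have h2 := hM.sol_U.Q_eq y (z / 2) hy hz'
  have h3 := hM.QU_sub_pos hz hz2
  have hcont : ContinuousOn (fun x => M.QU x - M.qc d x) (Icc y z) :=
    (hM.sol_U.continuousOn_Q.sub (hM.sol_const d).continuousOn_Q).mono
      fun x hx => hy.trans_le hx.1
  obtain ⟨δ, hδ, hδ0⟩ := intermediate_value_Icc (by linarith : y ≤ z) hcont
    (show (0 : ℝ) ∈ Icc _ _ from ⟨by linarith, h3.le⟩)
  exact ⟨δ, hy.trans_le hδ.1, sub_eq_zero.1 hδ0⟩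

lemma Admissible.exists_crit_U (hM : M.Admissible) (hd : ∃ x, 0 < x ∧ M.h x < M.r * d)
    (hdc : d < c) : ∃ δ α, 0 < δ ∧ δ < α ∧ M.Crit (M.Pa c α) M.QU δ d := by
  obtain ⟨δ, hδ, hQ⟩ := hM.exists_QU_eq hd
  obtain ⟨X, hX, hX'⟩ := hM.exists_J_m_ge c (M.pc c δ - M.pc d δ) hδ
  have hpos := hM.pc_sub_pos hδ hdc
  have hcont : ContinuousOn (fun x => J M.m (fun s => M.h s - M.r * c) δ x) (Icc δ X) :=
    ((hM.tame_h.sub_const _).continuousOn_J M.m hδ).mono fun x hx => hδ.trans_le hx.1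
  obtain ⟨α, hα, hα0⟩ := intermediate_value_Icc hX.le hcont
    (show M.pc c δ - M.pc d δ ∈ Icc _ _ from ⟨by simp [J]; linarith, hX' X le_rfl⟩)
  have hne : δ < α := lt_of_le_of_ne hα.1 fun e => by
    subst e
    simp only [J, intervalIntegral.integral_same] at hα0
    linarith
  exact ⟨δ, α, hδ, hne, (hM.crit_U_iff hδ (hδ.trans hne)).2 ⟨hQ, hα0⟩⟩

end

/-- Existence, uniqueness and bounds of the critical cost. -/
theorem Admissible.criticalCost (hM : M.Admissible) (hK : 0 ≤ M.K)
    (h0 : ∃ x, 0 < x ∧ M.h x < -(M.r * M.K)) :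
    (∃! k : ℝ, M.IsCriticalCost k) ∧
      ∀ k : ℝ, M.IsCriticalCost k → M.K < k ∧ ∃ x, 0 < x ∧ M.h x < -(M.r * k) := by
  have hK1 := hM.K₁_pos
  have hdc : -M.K < M.K₁ := by linarith
  have h0' : ∃ x, 0 < x ∧ M.h x < M.r * (-M.K) := by simpa only [mul_neg] using h0
  obtain ⟨δ, α, hδ, hδα, hU⟩ := hM.exists_crit_U h0' hdc
  obtain ⟨x, e, hδx, hxα, hD⟩ := hM.exists_crit_of_crit_U hδ hδα hdc hU
  refine ⟨⟨-e, (hM.isCriticalCost_iff _).2 ⟨δ, α, x, hδ, hδx, hxα, hU, by rwa [neg_neg]⟩, ?_⟩, ?_⟩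
  · intro k hk
    obtain ⟨δ', α', x', hδ', hδx', hxα', hU', hD'⟩ := (hM.isCriticalCost_iff _).1 hk
    obtain ⟨rfl, rfl⟩ := hM.crit_U_unique hδ hδα hδ' (hδx'.trans hxα') hdc hU hU'
    -- Each of the two critical values is the minimum of the same function on ]0, α], so they
    -- coincide.
    have a1 := hM.le_val_of_crit_U hδ hδα hdc hU (hδ.trans hδx) hxα hD (hδ.trans hδx') hxα'.le
    have a2 := hM.le_val_of_crit_U hδ hδα hdc hU (hδ.trans hδx') hxα' hD' (hδ.trans hδx) hxα.le
    rw [((hM.crit_iff (hδ.trans hδx')).1 hD').2] at a1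
    rw [((hM.crit_iff (hδ.trans hδx)).1 hD).2] at a2
    linarith
  · intro k hk
    obtain ⟨δ', α', x', hδ', hδx', hxα', hU', hD'⟩ := (hM.isCriticalCost_iff _).1 hk
    have hδα' := hδx'.trans hxα'
    have hα' := hδ'.trans hδα'
    have hx' := hδ'.trans hδx'
    refine ⟨?_, x', hx', ?_⟩
    · have a1 := hM.le_val_of_crit_U hδ' hδα' hdc hU' hx' hxα' hD' hδ' hδα'.le
      have e1 := val_add_Q M (M.Pa M.K₁ α') M.QU (M.qc M.K₁ α' - M.QU α') δ'
      have e2 := hM.QU_sub_pos hα' fun t ht => (hM.h_gt_of_crit_U hδ' hδα' hdc hU').le.trans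
        (hM.h_mono hα' (hα'.trans ht) (le_of_lt ht))
      rw [((hM.crit_iff hδ').1 hU').2] at e1
      change -k ≤ M.val (M.Pa M.K₁ α') (fun s => M.QU s + (M.qc M.K₁ α' - M.QU α')) δ' at a1
      rw [e1] at a1
      have e3 : δ' ^ M.n * (M.qc M.K₁ α' - M.QU α') / M.C < 0 :=
        div_neg_of_neg_of_pos (mul_neg_of_pos_of_neg (Real.rpow_pos_of_pos hδ' _)
          (by linarith)) hM.C_pos
      linarith
    · have := (hM.isMin_of_crit_U hδ' hδα' hdc hU' hx' hxα' hD').1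
      rwa [mul_neg] at this

end Model

end SwitchAbandon

namespace SwitchAbandon

namespace Model

variable {M : Model}

/-! ### The two switching points -/

section

variable {c d : ℝ}

lemma Admissible.val_sub_const (hM : M.Admissible) (P Q : ℝ → ℝ) (d : ℝ) {x : ℝ} (hx : 0 < x) :
    M.val P Q x - d = (x ^ M.m * (P x - M.pc d x) + x ^ M.n * (Q x - M.qc d x)) / M.C := by
  nth_rewrite 1 [← (hM.crit_const d hx).2]
  unfold val
  ring

lemma Admissible.slope_a_anti (hM : M.Admissible) {a a' x : ℝ} (ha : 0 < a) (haa' : a ≤ a')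
    (hx : 0 < x) (h : ∀ s ∈ Ioo a a', M.h s < M.r * c) :
    M.slope (M.Pa c a') (M.Qa c a') x ≤ M.slope (M.Pa c a) (M.Qa c a) x := by
  have e : M.slope (M.Pa c a') (M.Qa c a') x - M.slope (M.Pa c a) (M.Qa c a) x =
      (M.m * x ^ M.m * -J M.m (fun s => M.h s - M.r * c) a a' +
        M.n * x ^ M.n * J M.n (fun s => M.h s - M.r * c) a a') / M.C := by
    unfold slope
    rw [← hM.Pa_sub c x ha (ha.trans_le haa'), ← neg_neg (J M.n _ _ _),
      ← hM.Qa_sub c x ha (ha.trans_le haa')]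
    ring
  rw [← sub_nonpos, e]
  exact hM.coeff_nonpos hx
    (neg_nonneg.2 (J_nonpos _ ha haa' fun s hs => (sub_neg.2 (h s hs)).le))
    (J_nonpos _ ha haa' fun s hs => (sub_neg.2 (h s hs)).le)

lemma Admissible.continuousOn_val_a (hM : M.Admissible) (c : ℝ) :
    ContinuousOn (fun q : ℝ × ℝ => M.val (M.Pa c q.1) (M.Qa c q.1) q.2)
      (Ioi 0 ×ˢ Ioi 0) := by
  have h1 : MapsTo Prod.fst (Ioi (0 : ℝ) ×ˢ Ioi (0 : ℝ)) (Ioi 0) := fun q hq => hq.1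
  have h2 : MapsTo Prod.snd (Ioi (0 : ℝ) ×ˢ Ioi (0 : ℝ)) (Ioi 0) := fun q hq => hq.2
  have f1 := continuousOn_fst (s := Ioi (0 : ℝ) ×ˢ Ioi (0 : ℝ))
  have f2 := continuousOn_snd (s := Ioi (0 : ℝ) ×ˢ Ioi (0 : ℝ))
  have cP := hM.sol_U.continuousOn_P
  have cQ := hM.sol_U.continuousOn_Q
  have kP := (hM.sol_const c).continuousOn_P
  have kQ := (hM.sol_const c).continuousOn_Q
  unfold val Pa Qa
  exact ((((continuousOn_rpow M.m).comp f2 h2).mul ((cP.comp f2 h2).add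
    ((kP.comp f1 h1).sub (cP.comp f1 h1)))).add (((continuousOn_rpow M.n).comp f2 h2).mul
    ((cQ.comp f2 h2).add ((kQ.comp f1 h1).sub (cQ.comp f1 h1))))).div_const _

lemma Admissible.continuousAt_val_a (hM : M.Admissible) (c : ℝ) {a x : ℝ} (ha : 0 < a)
    (hx : 0 < x) : ContinuousAt (fun a => M.val (M.Pa c a) (M.Qa c a) x) a := by
  have h := (hM.continuousOn_val_a c).continuousAt (x := (a, x))
    ((isOpen_Ioi.prod isOpen_Ioi).mem_nhds ⟨ha, hx⟩)
  exact ContinuousAt.comp (f := fun a : ℝ => (a, x)) h (by fun_prop)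

lemma Admissible.slope_eq_zero_of_isLocalExtr (hM : M.Admissible) {f P Q : ℝ → ℝ}
    (h : M.Sol f P Q) {x : ℝ} (hx : 0 < x) (he : IsLocalExtr (M.val P Q) x) :
    M.slope P Q x = 0 := by
  have := he.hasDerivAt_eq_zero (h.hasDerivAt hM hx)
  rwa [div_eq_zero_iff, or_iff_left hx.ne'] at this

/-- The solution with the abandonment point as starting point is unbounded. -/
lemma Admissible.exists_val_gt (hM : M.Admissible) {β : ℝ} (hβ : 0 < β) (hQ : M.QU β = M.qc c β)
    (d : ℝ) : ∃ X, β < X ∧ ∀ x, X ≤ x → d < M.val (M.Pa c β) (M.Qa c β) x := by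
  obtain ⟨X, hX, hX'⟩ := hM.exists_J_m_ge d (M.pc d β - M.pc c β) hβ
  obtain ⟨Y, hY, hY'⟩ := hM.exists_le_h (M.r * d)
  refine ⟨max X Y, hX.trans_le (le_max_left _ _), fun x hx => ?_⟩
  have hxX := (le_max_left _ _).trans hx
  have hxY := (le_max_right _ _).trans hx
  have hx0 : 0 < x := hY.trans_le hxY
  rw [← sub_pos, hM.val_sub_const _ _ _ hx0]
  have h1 := hX' x hxX
  rw [hM.J_m_sub _ hβ hx0] at h1
  have h2 := hM.sol_U.P_eq β x hβ hx0
  have h3 := hM.QU_sub_pos hx0 fun s hs => hY' s (hxY.trans (le_of_lt hs))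
  refine div_pos (add_pos_of_nonneg_of_pos (mul_nonneg (Real.rpow_nonneg hx0.le _) ?_)
    (mul_pos (Real.rpow_pos_of_pos hx0 _) ?_)) hM.C_pos
  · unfold Pa; linarith
  · unfold Qa; rw [hQ]; linarith

/-- Eventually decreasing solutions. -/
lemma Admissible.exists_slope_nonpos (hM : M.Admissible) {β : ℝ} (hβ : 0 < β)
    (hQ : M.qc c β < M.QU β) :
    ∃ X, β < X ∧ ∀ x, X ≤ x → M.slope (M.Pa c β) (M.Qa c β) x ≤ 0 := by
  obtain ⟨X, hX, hX'⟩ := hM.exists_J_m_ge c 0 hβ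
  have hint : IntegrableOn (fun s => s ^ (-M.n - 1) * (M.h s - M.r * c)) (Ioi β) := by
    simp only [mul_sub]
    exact (hM.integrableOn_Ioi hβ).sub ((integrableOn_Ioi_rpow_of_lt
      (by linarith [hM.n_pos]) hβ).mul_const _)
  have hlim := intervalIntegral_tendsto_integral_Ioi β hint tendsto_id
  rw [hM.integral_Ioi_sub _ hβ] at hlim
  obtain ⟨Y, hY⟩ := (hlim.eventually (lt_mem_nhds (sub_pos.2 hQ))).exists_forall_of_atTop
  refine ⟨max X Y, hX.trans_le (le_max_left _ _), fun x hx => ?_⟩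
  have hxX := (le_max_left _ _).trans hx
  have hxY := (le_max_right _ _).trans hx
  have hx0 : 0 < x := (hβ.trans hX).trans_le hxX
  rw [(hM.sol_a c β).slope_eq hM hβ (crit_a M c β) hx0, sub_eq_add_neg, ← mul_neg]
  exact hM.coeff_nonpos hx0 (hX' x hxX) (neg_nonpos.2 (hY x hxY).le)

/-- Existence of the switching points. -/
lemma Admissible.exists_switch (hM : M.Admissible) (hc : ∃ x, 0 < x ∧ M.h x < M.r * c)
    (hcd : c < d) :
    ∃ β α, 0 < β ∧ β < α ∧ M.Crit (M.Pa c β) (M.Qa c β) α d := by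
  obtain ⟨z, hz, hz1, hz2⟩ := hM.exists_sign_change hc
  obtain ⟨β₀, hβ₀, hQ₀⟩ := hM.exists_QU_eq hc
  -- `V β` has the critical value `c` at `β`. It is unbounded for `β₀`, but for `z` it never exceeds
  -- `c` to the right of `z`. The pair sought is the largest β for which the level `d` is reached,
  -- with the point of contact.
  set V : ℝ → ℝ → ℝ := fun β => M.val (M.Pa c β) (M.Qa c β) with hV
  have hβ₀z : β₀ < z := by
    by_contra! hcon
    have := hM.QU_sub_pos hβ₀ fun s hs => hz2 s (hcon.trans_lt hs)
    linarith
  obtain ⟨X, hX, hX'⟩ := hM.exists_val_gt hβ₀ hQ₀ d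
  have hXpos : 0 < max X z := lt_max_of_lt_right hz
  -- By continuity the level is still exceeded slightly beyond `β₀`. There the weighted tail
  -- integral of h − rc is positive, so `V β₁` eventually decreases; this provides the compactness
  -- lacking at `β₀`.
  obtain ⟨β₁, hβ₁, hβ₁V⟩ : ∃ β₁ ∈ Ioo β₀ z, d < V β₁ (max X z) := by
    have h1 := (hM.continuousAt_val_a c hβ₀ hXpos).eventually
      (lt_mem_nhds (hX' (max X z) (le_max_left _ _)))
    have h2 : ∀ᶠ β in 𝓝[>] β₀, β ∈ Ioo β₀ z := Ioo_mem_nhdsGT hβ₀z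
    obtain ⟨b, hb1, hb2⟩ := ((h1.filter_mono nhdsWithin_le_nhds).and h2).exists
    exact ⟨b, hb2, hb1⟩
  have hβ₁0 : 0 < β₁ := hβ₀.trans hβ₁.1
  have hQ₁ : M.qc c β₁ < M.QU β₁ := by
    have h1 := J_neg (hM.tame_h.sub_const (M.r * c)) M.n hβ₀ hβ₁.1 fun s hs =>
      sub_neg.2 (hz1 s (hβ₀.trans hs.1) (hs.2.trans hβ₁.2))
    rw [hM.J_n_sub _ hβ₀ hβ₁0] at h1
    have h2 := hM.sol_U.Q_eq β₀ β₁ hβ₀ hβ₁0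
    linarith
  obtain ⟨X₀, hX₀, hX₀'⟩ := hM.exists_slope_nonpos hβ₁0 hQ₁
  -- Slopes decrease in the critical point up to `z`, so the eventual decrease of `V β₁` beyond `X₀`
  -- is shared by every `V b` with β₁ ≤ b < z. Restricting x to x ≤ Y therefore loses nothing.
  set Y := max X₀ (max X z) with hY
  have hYX₀ : X₀ ≤ Y := le_max_left _ _
  have hYX : max X z ≤ Y := le_max_right _ _
  have hYz : z ≤ Y := (le_max_right _ _).trans hYX
  have hY0 : 0 < Y := hz.trans_le hYz
  have hβ₁X : β₁ ≤ max X z := hβ₁.2.le.trans (le_max_right _ _)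
  set T : Set (ℝ × ℝ) := {q | q ∈ Icc β₁ z ×ˢ Icc β₁ Y ∧ (q.1 ≤ q.2 ∧ d ≤ V q.1 q.2)} with hT
  have hTc : IsCompact T := by
    have hcont : ContinuousOn (fun q : ℝ × ℝ => V q.1 q.2) (Icc β₁ z ×ˢ Icc β₁ Y) :=
      (hM.continuousOn_val_a c).mono
        (prod_mono (fun x hx => hβ₁0.trans_le hx.1) (fun x hx => hβ₁0.trans_le hx.1))
    have hcl : IsClosed (Icc β₁ z ×ˢ Icc β₁ Y) := isClosed_Icc.prod isClosed_Icc
    have e : T = {q ∈ Icc β₁ z ×ˢ Icc β₁ Y | q.1 ≤ q.2} ∩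
        {q ∈ Icc β₁ z ×ˢ Icc β₁ Y | d ≤ V q.1 q.2} := by
      ext q; simp only [hT, mem_ofPred_eq, mem_inter_iff]; tauto
    rw [e]
    refine ((isCompact_Icc.prod isCompact_Icc).of_isClosed_subset ?_ (fun q hq => hq.1.1))
    exact (hcl.isClosed_le continuousOn_fst continuousOn_snd).inter
      (hcl.isClosed_le continuousOn_const hcont)
  have hTne : T.Nonempty := ⟨(β₁, max X z),
    ⟨⟨left_mem_Icc.2 hβ₁.2.le, ⟨hβ₁X, hYX⟩⟩, hβ₁X, hβ₁V.le⟩⟩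
  obtain ⟨⟨β, α⟩, hmem, hmax⟩ := hTc.exists_isMaxOn hTne continuousOn_fst
  obtain ⟨⟨hβ, hα⟩, hβα, hVd⟩ := hmem
  simp only at hβ hα hβα hVd
  have hβ0 : 0 < β := hβ₁0.trans_le hβ.1
  have hα0 : 0 < α := hβ0.trans_le hβα
  have hsol := fun b => hM.sol_a c b
  have hself : ∀ b, 0 < b → V b b = c := fun b hb => ((hM.crit_iff hb).1 (crit_a M c b)).2
  have hlt : β < α := lt_of_le_of_ne hβα fun e => by
    rw [← e, hself β hβ0] at hVd; linarith
  have hβz : β < z := lt_of_le_of_ne hβ.2 fun e => by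
    subst e
    have := (hsol β).antitoneOn hM hβ0 (b := α) (fun s hs => (hsol β).slope_nonpos_right hM hβ0
      (crit_a M c β) hs.1.le fun t ht => hz2 t ht.1) (left_mem_Icc.2 hβα) (right_mem_Icc.2 hβα) hβα
    have h2 := hself β hβ0
    simp only [hV] at h2 hVd
    linarith
  have habove : ∀ b ∈ Ioo β z, ∀ x, b ≤ x → V b x < d := by
    intro b hb
    have hb1 : b ∈ Icc β₁ z := ⟨hβ.1.trans hb.1.le, hb.2.le⟩
    have hb0 : 0 < b := hβ0.trans hb.1
    have hle : ∀ x, b ≤ x → x ≤ Y → V b x < d := by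
      intro x hx hxY
      by_contra! hcon
      have := hmax (show (b, x) ∈ T from ⟨⟨hb1, ⟨hb1.1.trans hx, hxY⟩⟩, hx, hcon⟩)
      simp only [mem_ofPred_eq] at this
      linarith [hb.1]
    intro x hx
    rcases le_total x Y with hxY | hYx
    · exact hle x hx hxY
    · refine lt_of_le_of_lt ?_ (hle Y (hb.2.le.trans hYz) le_rfl)
      refine (hsol b).antitoneOn hM hY0 (b := x) (fun s hs => ?_) (left_mem_Icc.2 hYx)
        (right_mem_Icc.2 hYx) hYx
      exact (hM.slope_a_anti hβ₁0 hb1.1 (hY0.trans hs.1) fun t ht =>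
        hz1 t (hβ₁0.trans ht.1) (ht.2.trans hb.2)).trans (hX₀' s (hYX₀.trans hs.1.le))
  -- By maximality `V b` stays below `d` for b slightly larger than `β`; let b decrease to `β`. Thus
  -- contact at `α` is a local maximum.
  have hle : ∀ x, β < x → V β x ≤ d := by
    intro x hx
    have h1 : Tendsto (fun b => V b x) (𝓝[>] β) (𝓝 (V β x)) :=
      (hM.continuousAt_val_a c hβ0 (hβ0.trans hx)).tendsto.mono_left nhdsWithin_le_nhds
    refine le_of_tendsto h1 ?_
    filter_upwards [Ioo_mem_nhdsGT (lt_min hβz hx)] with b hb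
    have hb2 := lt_min_iff.1 hb.2
    exact (habove b ⟨hb.1, hb2.1⟩ x hb2.2.le).le
  have heq : V β α = d := le_antisymm (hle α hlt) hVd
  refine ⟨β, α, hβ0, hlt, (hM.crit_iff hα0).2 ⟨?_, heq⟩⟩
  refine hM.slope_eq_zero_of_isLocalExtr (hsol β) hα0 (Or.inr ?_)
  filter_upwards [Ioi_mem_nhds hlt] with x hx
  exact (hle x hx).trans heq.ge

/-- Uniqueness of the switching points. -/
lemma Admissible.switch_unique (hM : M.Admissible) {β α β' α' : ℝ} (hβ : 0 < β) (hβα : β < α)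
    (hβ' : 0 < β') (hβα' : β' < α') (hcd : c < d) (h : M.Crit (M.Pa c β) (M.Qa c β) α d)
    (h' : M.Crit (M.Pa c β') (M.Qa c β') α' d) : β = β' ∧ α = α' := by
  -- To the right of β' the solution for β < β' lies strictly above the one for β', hence above `d`
  -- at α'. But to the right of β it never exceeds `d`: it increases up to α and does not increase
  -- afterwards.
  have key1 : ∀ β α β' α', 0 < β → β < α → β' < α' → M.Crit (M.Pa c β) (M.Qa c β) α d →
      M.Crit (M.Pa c β') (M.Qa c β') α' d → ¬β < β' := by
    intro β α β' α' hβ hβα hβα' h h' hlt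
    have hβ' := hβ.trans hlt
    obtain ⟨_, b2, b3⟩ := (hM.sol_a c β).between hM hβ hβα (crit_a M c β) h hcd
    obtain ⟨b1, -, -⟩ := (hM.sol_a c β').between hM hβ' hβα' (crit_a M c β') h' hcd
    have h1 := hM.val_a_gt_of_h_lt hβ hβα'.le hlt fun s hs hsβ =>
      (hM.h_mono hs hβ' hsβ.le).trans_lt b1
    rw [((hM.crit_iff (hβ'.trans hβα')).1 h').2] at h1
    have hα := hβ.trans hβα
    have hval := ((hM.crit_iff hα).1 h).2
    rcases le_total α' α with hle | hle
    · have := (hM.sol_a c β).monotoneOn hM hβ (b := α) (fun s hs => b3 s ⟨hs.1.le, hs.2.le⟩)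
        ⟨(hlt.trans hβα').le, hle⟩ (right_mem_Icc.2 hβα.le) hle
      linarith
    · have := (hM.sol_a c β).antitoneOn hM hα (b := α')
        (fun s hs => (hM.sol_a c β).slope_nonpos_of_le hM hα h hs.1.le b2.le)
        (left_mem_Icc.2 hle) (right_mem_Icc.2 hle) hle
      linarith
  have hββ : β = β' := le_antisymm (not_lt.1 (key1 β' α' β α hβ' hβα' hβα h' h))
    (not_lt.1 (key1 β α β' α' hβ hβα hβα' h h'))
  subst hββ
  have key2 : ∀ α α', β < α → M.Crit (M.Pa c β) (M.Qa c β) α d →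
      M.Crit (M.Pa c β) (M.Qa c β) α' d → ¬α < α' := by
    intro α α' hβα h h' hlt
    have hα := hβ.trans hβα
    obtain ⟨_, b2, _⟩ := (hM.sol_a c β).between hM hβ hβα (crit_a M c β) h hcd
    have h1 := J_pos (hM.tame_h.sub_const (M.r * d)) M.m hα hlt fun s hs =>
      sub_pos.2 (b2.trans_le (hM.h_mono hα (hα.trans hs.1) hs.1.le))
    rw [hM.J_m_sub _ hα (hα.trans hlt)] at h1
    have h2 := (hM.sol_a c β).P_eq α α' hα (hα.trans hlt)
    rw [h.P_eq, h'.P_eq] at h2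
    linarith
  exact ⟨rfl, le_antisymm (not_lt.1 (key2 α' α hβα' h' h)) (not_lt.1 (key2 α α' hβα h h'))⟩

end

end Model

end SwitchAbandon

namespace SwitchAbandon

namespace Model

variable {M : Model}

/-! ### The abandonment point and the lower switching point -/

/-- Second coefficient of the solution that meets `c + B xⁿ / C` smoothly at `γ`. -/
noncomputable def Qb (M : Model) (c B γ x : ℝ) : ℝ := M.Qa c γ x + B

section

variable {c e B β : ℝ}

lemma Admissible.sol_b (hM : M.Admissible) (c B γ : ℝ) : M.Sol M.h (M.Pa c γ) (M.Qb c B γ) := by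
  have := (hM.sol_a c γ).add_hom 0 B
  simp only [add_zero] at this
  exact this

lemma val_b (M : Model) (c B γ x : ℝ) : M.val (M.Pa c γ) (M.Qb c B γ) x =
    M.val (M.Pa c γ) (M.Qa c γ) x + x ^ M.n * B / M.C := val_add_Q _ _ _ _ _

lemma slope_b (M : Model) (c B γ x : ℝ) : M.slope (M.Pa c γ) (M.Qb c B γ) x =
    M.slope (M.Pa c γ) (M.Qa c γ) x + M.n * x ^ M.n * B / M.C := slope_add_Q _ _ _ _ _

lemma Admissible.val_b_self (hM : M.Admissible) (c B : ℝ) {γ : ℝ} (hγ : 0 < γ) :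
    M.val (M.Pa c γ) (M.Qb c B γ) γ = c + γ ^ M.n * B / M.C := by
  rw [val_b, ((hM.crit_iff hγ).1 (crit_a M c γ)).2]

lemma Admissible.slope_b_self (hM : M.Admissible) (c B : ℝ) {γ : ℝ} (hγ : 0 < γ) :
    M.slope (M.Pa c γ) (M.Qb c B γ) γ = M.n * γ ^ M.n * B / M.C := by
  rw [slope_b, ((hM.crit_iff hγ).1 (crit_a M c γ)).1, zero_add]

lemma Admissible.slope_b_self_pos (hM : M.Admissible) (c : ℝ) {γ : ℝ} (hB : 0 < B) (hγ : 0 < γ) :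
    0 < M.slope (M.Pa c γ) (M.Qb c B γ) γ := by
  rw [hM.slope_b_self c B hγ]
  exact div_pos (mul_pos (mul_pos hM.n_pos (Real.rpow_pos_of_pos hγ _)) hB) hM.C_pos

/-- The solution lies above `c` to the left of `γ`. -/
lemma Admissible.val_a_gt (hM : M.Admissible) {γ x : ℝ} (hx : 0 < x) (hxγ : x < γ)
    (h : ∀ s, 0 < s → s < γ → M.h s < M.r * c) : c < M.val (M.Pa c γ) (M.Qa c γ) x := by
  have := (hM.sol_a c γ).strictAntiOn hM hx (b := γ) (fun s hs => (hM.sol_a c γ).slope_neg_left hM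
    (hx.trans hs.1) (crit_a M c γ) hs.2 fun t ht => h t ((hx.trans hs.1).trans ht.1) ht.2)
    (left_mem_Icc.2 hxγ.le) (right_mem_Icc.2 hxγ.le) hxγ
  rwa [((hM.crit_iff (hx.trans hxγ)).1 (crit_a M c γ)).2] at this

lemma Admissible.rpow_n_mono (hM : M.Admissible) (hB : 0 < B) {x y : ℝ} (hx : 0 < x)
    (hxy : x ≤ y) : x ^ M.n * B / M.C ≤ y ^ M.n * B / M.C :=
  div_le_div_of_nonneg_right (mul_le_mul_of_nonneg_right
    (Real.rpow_le_rpow hx.le hxy hM.n_pos.le) hB.le) hM.C_pos.le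

/-- Existence of the abandonment point and the lower switching point. -/
lemma Admissible.exists_abandon (hM : M.Admissible) (hβ : 0 < β) (hB : 0 < B)
    (hh : ∀ s, 0 < s → s < β → M.h s < M.r * c) (hce : c < e)
    (hβe : ∀ x, 0 < x → x ≤ β → e < M.val (M.Pa c β) (M.Qb c B β) x) :
    ∃ δ γ, 0 < δ ∧ δ < γ ∧ γ < β ∧ M.Crit (M.Pa c γ) (M.Qb c B γ) δ e := by
  -- The tangency argument again: for γ = β the solution exceeds `e`, for small γ it does not
  -- everywhere. The largest γ for which the level `e` is reached on ]0, γ] is chosen.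
  set W : ℝ → ℝ → ℝ := fun γ => M.val (M.Pa c γ) (M.Qb c B γ) with hW
  have hsol := fun γ => hM.sol_b c B γ
  -- a small lower switching point
  obtain ⟨γ₀, hγ₀, hγ₀β, hγ₀e⟩ : ∃ γ₀, 0 < γ₀ ∧ γ₀ < β ∧ W γ₀ γ₀ ≤ e := by
    have hlim : Tendsto (fun x : ℝ => c + x ^ M.n * B / M.C) (𝓝[>] 0) (𝓝 c) := by
      have h1 : ContinuousAt (fun x : ℝ => c + x ^ M.n * B / M.C) 0 := by
        refine continuousAt_const.add (((Real.continuousAt_rpow_const _ _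
          (Or.inr hM.n_pos.le)).mul continuousAt_const).div_const _)
      have h2 := h1.tendsto.mono_left (nhdsWithin_le_nhds (s := Ioi 0))
      rwa [Real.zero_rpow hM.n_pos.ne', zero_mul, zero_div, add_zero] at h2
    obtain ⟨g, hg1, hg2⟩ := ((hlim.eventually (gt_mem_nhds hce)).and
      (Ioo_mem_nhdsGT hβ)).exists
    exact ⟨g, hg2.1, hg2.2, by simp only [hW]; rw [hM.val_b_self c B hg2.1]; exact hg1.le⟩
  -- the solutions decrease near zero
  obtain ⟨ε, hε, hεγ, hε'⟩ : ∃ ε, 0 < ε ∧ ε < γ₀ ∧ ∀ γ ∈ Icc γ₀ β, ∀ x, 0 < x → x ≤ ε →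
      M.slope (M.Pa c γ) (M.Qb c B γ) x ≤ 0 := by
    obtain ⟨y, hy, hyγ, hy'⟩ := hM.exists_J_n_le (k := c) (-B) hγ₀ (hh γ₀ hγ₀ hγ₀β)
    refine ⟨y, hy, hyγ, fun γ hγ x hx hxy => ?_⟩
    have h1 := hM.slope_a_anti hγ₀ hγ.1 hx fun s hs => hh s (hγ₀.trans hs.1) (hs.2.trans_le hγ.2)
    rw [slope_b]
    refine (add_le_add_left h1 _).trans ?_
    rw [(hM.sol_a c γ₀).slope_eq hM hγ₀ (crit_a M c γ₀) hx, J_symm _ _ x γ₀, J_symm _ _ x γ₀,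
      ← add_div]
    have h2 := hM.coeff_nonpos hx (p := -J M.m (fun s => M.h s - M.r * c) x γ₀)
      (q := J M.n (fun s => M.h s - M.r * c) x γ₀ + B)
      (neg_nonneg.2 (J_nonpos _ hx (hxy.trans hyγ.le) fun s hs =>
        (sub_neg.2 (hh s (hx.trans hs.1) (hs.2.trans hγ₀β))).le)) (by linarith [hy' x hx hxy])
    refine le_of_eq_of_le ?_ h2
    ring
  set T : Set (ℝ × ℝ) := {q | q ∈ Icc γ₀ β ×ˢ Icc ε β ∧ (q.2 ≤ q.1 ∧ W q.1 q.2 ≤ e)} with hT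
  have hTc : IsCompact T := by
    have hcont : ContinuousOn (fun q : ℝ × ℝ => W q.1 q.2) (Icc γ₀ β ×ˢ Icc ε β) := by
      have h1 : ContinuousOn (fun q : ℝ × ℝ => M.val (M.Pa c q.1) (M.Qa c q.1) q.2 +
          q.2 ^ M.n * B / M.C) (Icc γ₀ β ×ˢ Icc ε β) := by
        refine ((hM.continuousOn_val_a c).mono (prod_mono (fun x hx => hγ₀.trans_le hx.1)
          (fun x hx => hε.trans_le hx.1))).add (ContinuousOn.div_const (ContinuousOn.mul
          ((continuousOn_rpow M.n).comp continuousOn_snd fun q hq => hε.trans_le hq.2.1)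
          continuousOn_const) _)
      exact h1.congr fun q _ => val_b M c B q.1 q.2
    have hcl : IsClosed (Icc γ₀ β ×ˢ Icc ε β) := isClosed_Icc.prod isClosed_Icc
    have e : T = {q ∈ Icc γ₀ β ×ˢ Icc ε β | q.2 ≤ q.1} ∩
        {q ∈ Icc γ₀ β ×ˢ Icc ε β | W q.1 q.2 ≤ e} := by
      ext q; simp only [hT, mem_ofPred_eq, mem_inter_iff]; tauto
    rw [e]
    refine ((isCompact_Icc.prod isCompact_Icc).of_isClosed_subset ?_ (fun q hq => hq.1.1))
    exact (hcl.isClosed_le continuousOn_snd continuousOn_fst).inter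
      (hcl.isClosed_le hcont continuousOn_const)
  have hTne : T.Nonempty := ⟨(γ₀, γ₀),
    ⟨⟨left_mem_Icc.2 hγ₀β.le, ⟨hεγ.le, hγ₀β.le⟩⟩, le_rfl, hγ₀e⟩⟩
  obtain ⟨⟨γ, δ⟩, hmem, hmax⟩ := hTc.exists_isMaxOn hTne continuousOn_fst
  obtain ⟨⟨hγ, hδ⟩, hδγ, hWe⟩ := hmem
  simp only at hγ hδ hδγ hWe
  have hγ0 : 0 < γ := hγ₀.trans_le hγ.1
  have hδ0 : 0 < δ := hε.trans_le hδ.1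
  have hγβ : γ < β := lt_of_le_of_ne hγ.2 fun h => by
    subst h
    exact absurd (hβe δ hδ0 hδγ) (not_lt.2 hWe)
  have habove : ∀ g ∈ Ioo γ β, ∀ x, 0 < x → x ≤ g → e < W g x := by
    intro g hg
    have hg1 : g ∈ Icc γ₀ β := ⟨hγ.1.trans hg.1.le, hg.2.le⟩
    have hge : ∀ x, ε ≤ x → x ≤ g → e < W g x := by
      intro x hx hxg
      by_contra! hcon
      have := hmax (show (g, x) ∈ T from ⟨⟨hg1, ⟨hx, hxg.trans hg.2.le⟩⟩, hxg, hcon⟩)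
      simp only [mem_ofPred_eq] at this
      linarith [hg.1]
    intro x hx hxg
    rcases le_total ε x with hεx | hxε
    · exact hge x hεx hxg
    · refine lt_of_lt_of_le (hge ε le_rfl (hεγ.le.trans hg1.1)) ?_
      exact (hsol g).antitoneOn hM hx (b := ε) (fun s hs => hε' g hg1 s (hx.trans hs.1) hs.2.le)
        (left_mem_Icc.2 hxε) (right_mem_Icc.2 hxε) hxε
  have hge : ∀ x, 0 < x → x ≤ γ → e ≤ W γ x := by
    intro x hx hxγ
    have h1 : ContinuousAt (fun g => W g x) γ := by
      refine ContinuousAt.congr ((hM.continuousAt_val_a c hγ0 hx).add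
        (continuousAt_const (y := x ^ M.n * B / M.C))) ?_
      exact Eventually.of_forall fun g => (val_b M c B g x).symm
    refine ge_of_tendsto (h1.tendsto.mono_left (nhdsWithin_le_nhds (s := Ioi γ))) ?_
    filter_upwards [Ioo_mem_nhdsGT hγβ] with g hg
    exact (habove g hg x hx (hxγ.trans hg.1.le)).le
  -- A priori the contact point could be γ itself. With the bound extended beyond γ it is a local
  -- minimum in any case, so the slope vanishes; this excludes γ, where the slope is positive.
  have hge' : ∀ x, 0 < x → x < β → e ≤ W γ x := by
    intro x hx hxβ
    rcases le_total x γ with hxγ | hγx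
    · exact hge x hx hxγ
    · have h1 := hge γ hγ0 le_rfl
      have h2 := (hM.sol_a c γ).monotoneOn hM hγ0 (b := x) (fun s hs =>
        ((hM.sol_a c γ).slope_pos_right hM hγ0 (crit_a M c γ) hs.1 fun t ht =>
          hh t (hγ0.trans ht.1) (ht.2.trans (hs.2.trans hxβ))).le) (left_mem_Icc.2 hγx)
        (right_mem_Icc.2 hγx) hγx
      simp only [hW] at h1 ⊢
      rw [val_b] at h1 ⊢
      linarith [hM.rpow_n_mono hB hγ0 hγx]
  have heq : W γ δ = e := le_antisymm hWe (hge δ hδ0 hδγ)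
  have hslope : M.slope (M.Pa c γ) (M.Qb c B γ) δ = 0 := by
    refine hM.slope_eq_zero_of_isLocalExtr (hsol γ) hδ0 (Or.inl ?_)
    filter_upwards [Ioo_mem_nhds hδ0 (hδγ.trans_lt hγβ)] with x hx
    exact heq.le.trans (hge' x hx.1 hx.2)
  refine ⟨δ, γ, hδ0, lt_of_le_of_ne hδγ fun h => ?_, hγβ, (hM.crit_iff hδ0).2 ⟨hslope, heq⟩⟩
  rw [h] at hslope
  exact (hM.slope_b_self_pos c hB hγ0).ne' hslope

/-- Properties of the abandonment point. -/
lemma Admissible.abandon_facts (hM : M.Admissible) {δ γ : ℝ} (hδ : 0 < δ) (hδγ : δ < γ)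
    (hB : 0 < B) (h : M.Crit (M.Pa c γ) (M.Qb c B γ) δ e) :
    M.h δ < M.r * e ∧ (∀ x, 0 < x → x < δ → M.slope (M.Pa c γ) (M.Qb c B γ) x < 0) ∧
      ∀ x ∈ Ioc δ γ, 0 < M.slope (M.Pa c γ) (M.Qb c B γ) x :=
  (hM.sol_b c B γ).isMin_of_slope_pos hM hδ h hδγ (hM.slope_b_self_pos c hB (hδ.trans hδγ))

lemma Admissible.abandon_le (hM : M.Admissible) {δ γ x : ℝ} (hδ : 0 < δ) (hδγ : δ < γ)
    (hB : 0 < B) (h : M.Crit (M.Pa c γ) (M.Qb c B γ) δ e) (hx : 0 < x) (hxγ : x ≤ γ) :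
    e ≤ M.val (M.Pa c γ) (M.Qb c B γ) x := by
  obtain ⟨_, h2, h3⟩ := hM.abandon_facts hδ hδγ hB h
  rw [← ((hM.crit_iff hδ).1 h).2]
  have hsol := hM.sol_b c B γ
  rcases le_total x δ with hxδ | hδx
  · exact (hsol.antitoneOn hM hx (b := δ) fun s hs => (h2 s (hx.trans hs.1) hs.2).le)
      (left_mem_Icc.2 hxδ) (right_mem_Icc.2 hxδ) hxδ
  · exact (hsol.monotoneOn hM hδ (b := x) fun s hs => (h3 s ⟨hs.1, hs.2.le.trans hxγ⟩).le)
      (left_mem_Icc.2 hδx) (right_mem_Icc.2 hδx) hδx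

/-- The solution for a larger switching point stays above the abandonment value. -/
lemma Admissible.lt_val_b (hM : M.Admissible) {δ γ γ' x : ℝ} (hδ : 0 < δ) (hδγ : δ < γ)
    (hB : 0 < B) (h : M.Crit (M.Pa c γ) (M.Qb c B γ) δ e) (hγγ' : γ < γ')
    (hh : ∀ s, 0 < s → s < γ' → M.h s < M.r * c) (hx : 0 < x) (hxγ' : x < γ') :
    e < M.val (M.Pa c γ') (M.Qb c B γ') x := by
  have hγ := hδ.trans hδγ
  rw [val_b]
  rcases le_total x γ with hxγ | hγx
  · have h1 := hM.val_a_lt_of_h_lt hx hxγ hγγ' hh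
    have h2 := hM.abandon_le hδ hδγ hB h hx hxγ
    rw [val_b] at h2
    linarith
  · have h1 := hM.val_a_gt hx hxγ' hh
    have h2 := hM.abandon_le hδ hδγ hB h hγ le_rfl
    rw [hM.val_b_self c B hγ] at h2
    linarith [hM.rpow_n_mono hB hγ hγx]

/-- Uniqueness of the abandonment point and the lower switching point. -/
lemma Admissible.abandon_unique (hM : M.Admissible) {δ γ δ' γ' : ℝ} (hδ : 0 < δ) (hδγ : δ < γ)
    (hγβ : γ < β) (hδ' : 0 < δ') (hδγ' : δ' < γ') (hγβ' : γ' < β) (hB : 0 < B)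
    (hh : ∀ s, 0 < s → s < β → M.h s < M.r * c)
    (h : M.Crit (M.Pa c γ) (M.Qb c B γ) δ e) (h' : M.Crit (M.Pa c γ') (M.Qb c B γ') δ' e) :
    δ = δ' ∧ γ = γ' := by
  have key1 : ∀ δ γ δ' γ', 0 < δ → δ < γ → 0 < δ' → δ' < γ' → γ' < β →
      M.Crit (M.Pa c γ) (M.Qb c B γ) δ e → M.Crit (M.Pa c γ') (M.Qb c B γ') δ' e → ¬γ < γ' := by
    intro δ γ δ' γ' hδ hδγ hδ' hδγ' hγβ' h h' hlt
    have := hM.lt_val_b hδ hδγ hB h hlt (fun s hs hsγ => hh s hs (hsγ.trans hγβ')) hδ' hδγ'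
    rw [((hM.crit_iff hδ').1 h').2] at this
    exact lt_irrefl _ this
  have hγγ : γ = γ' := le_antisymm (not_lt.1 (key1 δ' γ' δ γ hδ' hδγ' hδ hδγ hγβ h' h))
    (not_lt.1 (key1 δ γ δ' γ' hδ hδγ hδ' hδγ' hγβ' h h'))
  subst hγγ
  refine ⟨?_, rfl⟩
  have key2 : ∀ δ δ', 0 < δ → δ < δ' → δ' < γ → M.Crit (M.Pa c γ) (M.Qb c B γ) δ e →
      M.Crit (M.Pa c γ) (M.Qb c B γ) δ' e → False := by
    intro δ δ' hδ hlt hδγ' h h'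
    have h1 := (hM.abandon_facts hδ (hlt.trans hδγ') hB h).2.2 δ' ⟨hlt, hδγ'.le⟩
    rw [((hM.crit_iff (hδ.trans hlt)).1 h').1] at h1
    exact lt_irrefl _ h1
  rcases lt_trichotomy δ δ' with hlt | heq | hlt
  · exact (key2 δ δ' hδ hlt hδγ' h h').elim
  · exact heq
  · exact (key2 δ' δ hδ' hlt hδγ h' h).elim

end

end Model

end SwitchAbandon

namespace SwitchAbandon

namespace Model

variable {M : Model}

/-! ### The system of equations -/

/-- The constant `C B` for the upper switching point `α`. -/
noncomputable def Bc (M : Model) (α : ℝ) : ℝ := M.QU α - M.qc M.K₁ α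

section

variable {c d β α : ℝ}

/-- A solution is determined by any one of its critical points and the value there, so the switching
pair can be described from either end. -/
lemma Pa_eq_of_crit (h : M.Crit (M.Pa c β) (M.Qa c β) α d) : M.Pa c β = M.Pa d α := by
  funext x
  have := h.P_eq
  unfold Pa at *
  linarith

lemma Qa_eq_of_crit (h : M.Crit (M.Pa c β) (M.Qa c β) α d) : M.Qa c β = M.Qa d α := by
  funext x
  have := h.Q_eq
  unfold Qa at *
  linarith

/-- At γ = β, adding back w₀ = Bxⁿ leaves the coefficient of minimal growth: the family used for
abandonment ends at the continuation of w₁ from beyond `β`. -/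
lemma Qb_eq_of_crit (h : M.Crit (M.Pa c β) (M.Qa c β) α M.K₁) :
    M.Qb c (M.Bc α) β = M.QU := by
  funext x
  have := h.Q_eq
  unfold Qb Bc
  unfold Qa at *
  linarith

lemma Admissible.Bc_pos (hM : M.Admissible) (hα : 0 < α) (h : M.r * M.K₁ < M.h α) :
    0 < M.Bc α :=
  hM.QU_sub_pos hα fun _ hs => h.le.trans (hM.h_mono hα (hα.trans hs) (le_of_lt hs))

lemma Admissible.switch_ge (hM : M.Admissible) (hβ : 0 < β) (hβα : β < α) (hcd : c < d)
    (h : M.Crit (M.Pa c β) (M.Qa c β) α d) {x : ℝ} (hx : 0 < x) (hxα : x ≤ α) :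
    c ≤ M.val (M.Pa c β) (M.Qa c β) x := by
  obtain ⟨b1, _, b3⟩ := (hM.sol_a c β).between hM hβ hβα (crit_a M c β) h hcd
  rcases lt_or_ge x β with hxβ | hβx
  · exact (hM.val_a_gt hx hxβ fun s hs hsβ => (hM.h_mono hs hβ hsβ.le).trans_lt b1).le
  · have := (hM.sol_a c β).monotoneOn hM hβ (b := α) (fun s hs => b3 s ⟨hs.1.le, hs.2.le⟩)
      (left_mem_Icc.2 hβα.le) ⟨hβx, hxα⟩ hβx
    rwa [((hM.crit_iff hβ).1 (crit_a M c β)).2] at this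

lemma Admissible.switch_le (hM : M.Admissible) (hβ : 0 < β) (hβα : β < α) (hcd : c < d)
    (h : M.Crit (M.Pa c β) (M.Qa c β) α d) {x : ℝ} (hβx : β ≤ x) (hxα : x ≤ α) :
    M.val (M.Pa c β) (M.Qa c β) x ≤ d := by
  obtain ⟨_, _, b3⟩ := (hM.sol_a c β).between hM hβ hβα (crit_a M c β) h hcd
  have := (hM.sol_a c β).monotoneOn hM hβ (b := α) (fun s hs => b3 s ⟨hs.1.le, hs.2.le⟩)
      ⟨hβx, hxα⟩ (right_mem_Icc.2 hβα.le) hxα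
  rwa [((hM.crit_iff (hβ.trans hβα)).1 h).2] at this

end

/-- The first two equations are smooth fit of w₁ − w₀ at both switching points, the last two smooth
fit of w₁ at abandonment. The fourth involves the tail from β, whereas `Bc` uses the tail from α;
the second equation exchanges them. -/
lemma Admissible.solvesSystem_iff (hM : M.Admissible) (K₀ : ℝ) (p : Boundary) :
    M.SolvesSystem K₀ p ↔ 0 < p.δ ∧ p.δ < p.γ ∧ p.γ < p.β ∧ p.β < p.α ∧
      M.Crit (M.Pa (-K₀) p.β) (M.Qa (-K₀) p.β) p.α M.K₁ ∧
      M.Crit (M.Pa (-K₀) p.γ) (M.Qb (-K₀) (M.Bc p.α) p.γ) p.δ (-M.K) := by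
  obtain ⟨δ, γ, β, α⟩ := p
  have hm := hM.m_neg.ne
  have hn := hM.n_pos.ne'
  suffices main : 0 < δ → δ < γ → γ < β → β < α →
      ((M.m * J M.m M.h β α + M.r * K₀ * β ^ (-M.m) + M.r * M.K₁ * α ^ (-M.m) = 0 ∧
        M.n * J M.n M.h β α + M.r * K₀ * β ^ (-M.n) + M.r * M.K₁ * α ^ (-M.n) = 0 ∧
        M.m * J M.m (fun s => M.h s + M.r * K₀) δ γ + M.r * (M.K - K₀) * δ ^ (-M.m) = 0 ∧
        M.n * J M.n (fun s => M.h s + M.r * K₀) δ γ + M.r * (M.K - K₀) * δ ^ (-M.n)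
          + M.n * (∫ s in Ioi β, s ^ (-M.n - 1) * (M.h s + M.r * K₀)) = 0) ↔
      M.Crit (M.Pa (-K₀) β) (M.Qa (-K₀) β) α M.K₁ ∧
      M.Crit (M.Pa (-K₀) γ) (M.Qb (-K₀) (M.Bc α) γ) δ (-M.K)) by
    constructor
    · rintro ⟨h1, h2, h3, h4, h5, h6, h7, h8⟩
      exact ⟨h1, h2, h3, h4, (main h1 h2 h3 h4).1 ⟨h5, h6, h7, h8⟩⟩
    · rintro ⟨h1, h2, h3, h4, h5⟩
      obtain ⟨h6, h7, h8, h9⟩ := (main h1 h2 h3 h4).2 h5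
      exact ⟨h1, h2, h3, h4, h6, h7, h8, h9⟩
  intro hδ hδγ hγβ hβα
  have hγ := hδ.trans hδγ
  have hβ := hγ.trans hγβ
  have hα := hβ.trans hβα
  have ef : (fun s => M.h s + M.r * K₀) = fun s => M.h s - M.r * (-K₀) := by
    funext s; ring
  have e1 : ∫ s in Ioi β, s ^ (-M.n - 1) * (M.h s + M.r * K₀) = M.QU β - M.qc (-K₀) β := by
    rw [← hM.integral_Ioi_sub _ hβ]
    simp only [mul_neg, sub_neg_eq_add]
  rw [e1, ef, hM.J_m_sub _ hδ hγ, hM.J_n_sub _ hδ hγ]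
  have p1 := hM.sol_U.P_eq β α hβ hα
  have q1 := hM.sol_U.Q_eq β α hβ hα
  have p2 := hM.sol_U.P_eq δ γ hδ hγ
  have q2 := hM.sol_U.Q_eq δ γ hδ hγ
  have m1 : ∀ k x, M.m * M.pc k x = -(M.r * k * x ^ (-M.m)) := fun k x => by
    unfold pc; field_simp
  have n1 : ∀ k x, M.n * M.qc k x = M.r * k * x ^ (-M.n) := fun k x => by
    unfold qc; field_simp
  have a1 := m1 M.K₁ α
  have a2 := m1 (-K₀) β
  have a3 := m1 (-K₀) δ
  have a4 := m1 (-M.K) δ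
  have b1 := n1 M.K₁ α
  have b2 := n1 (-K₀) β
  have b3 := n1 (-K₀) δ
  have b4 := n1 (-M.K) δ
  constructor
  · rintro ⟨h1, h2, h3, h4⟩
    refine ⟨⟨?_, ?_⟩, ⟨?_, ?_⟩⟩
    · apply mul_left_cancel₀ hm
      unfold Pa
      linear_combination h1 + M.m * p1 + a2 - a1
    · apply mul_left_cancel₀ hn
      unfold Qa
      linear_combination -h2 + M.n * q1 - b1 + b2
    · apply mul_left_cancel₀ hm
      unfold Pa
      linear_combination -h3 - M.m * p2 - a4 + a3
    · apply mul_left_cancel₀ hn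
      unfold Qb Qa Bc
      linear_combination h4 - h2 - M.n * q2 + M.n * q1 - b4 - b1 + b2 + b3
  · rintro ⟨⟨h1, h2⟩, ⟨h3, h4⟩⟩
    unfold Pa at h1 h3
    unfold Qb Bc at h4
    unfold Qa at h2 h4
    refine ⟨?_, ?_, ?_, ?_⟩
    · linear_combination M.m * h1 - M.m * p1 - a2 + a1
    · linear_combination -M.n * h2 + M.n * q1 - b1 + b2
    · linear_combination -M.m * h3 - M.m * p2 - a4 + a3
    · linear_combination M.n * h4 - M.n * h2 + M.n * q2 + b4 - b3

/-! ### Comparison with the critical cost -/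

section

variable {K₀ k β α δ' α' x' : ℝ}

/-- Since h > rK₁ from α on, moving the critical point with value K₁ from α to α' strictly lowers
the solution at β, where it was −K₀. Its minimum −k is therefore below −K₀. -/
lemma Admissible.lt_criticalCost_of_lt (hM : M.Admissible) (hK₀ : 0 < K₀) (hK : 0 ≤ M.K)
    (hβ : 0 < β) (hβα : β < α) (h : M.Crit (M.Pa (-K₀) β) (M.Qa (-K₀) β) α M.K₁)
    (hδ' : 0 < δ') (hδx : δ' < x') (hxα : x' < α')
    (hU : M.Crit (M.Pa M.K₁ α') M.QU δ' (-M.K))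
    (hD : M.Crit (M.Pa M.K₁ α') (M.Qa M.K₁ α') x' (-k)) (hlt : α < α') : K₀ < k := by
  have hK1 := hM.K₁_pos
  obtain ⟨_, b2, _⟩ := (hM.sol_a (-K₀) β).between hM hβ hβα (crit_a M (-K₀) β) h (by linarith)
  have h1 := hM.val_a_lt_of_h_gt hβ hβα.le hlt b2
  have h2 := hM.le_val_of_crit_U hδ' (hδx.trans hxα) (by linarith) hU (hδ'.trans hδx) hxα hD hβ
    (hβα.trans hlt).le
  rw [← Pa_eq_of_crit h, ← Qa_eq_of_crit h, ((hM.crit_iff hβ).1 (crit_a M (-K₀) β)).2] at h1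
  linarith

/-- The same comparison at the minimum point x': the solution for α ≥ α' lies below the one for α',
whose value there is −k, but it is at least −K₀ on ]0, α]. -/
lemma Admissible.criticalCost_le_of_le (hM : M.Admissible) (hK₀ : 0 < K₀) (hK : 0 ≤ M.K)
    (hβ : 0 < β) (hβα : β < α) (h : M.Crit (M.Pa (-K₀) β) (M.Qa (-K₀) β) α M.K₁)
    (hδ' : 0 < δ') (hδx : δ' < x') (hxα : x' < α')
    (hU : M.Crit (M.Pa M.K₁ α') M.QU δ' (-M.K))
    (hD : M.Crit (M.Pa M.K₁ α') (M.Qa M.K₁ α') x' (-k)) (hle : α' ≤ α) : k ≤ K₀ := by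
  have hK1 := hM.K₁_pos
  have hx' := hδ'.trans hδx
  have h1 := hM.val_a_anti hx' hxα.le hle
    (hM.h_gt_of_crit_U hδ' (hδx.trans hxα) (by linarith) hU).le
  have h2 := hM.switch_ge hβ hβα (by linarith) h hx' (hxα.le.trans hle)
  rw [← Pa_eq_of_crit h, ← Qa_eq_of_crit h, ((hM.crit_iff hx').1 hD).2] at h1
  linarith

lemma Admissible.val_U_sub (hM : M.Admissible) (c x : ℝ) {a a' : ℝ} (ha : 0 < a) (ha' : 0 < a') :
    M.val (M.Pa c a) M.QU x - M.val (M.Pa c a') M.QU x =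
      x ^ M.m * J M.m (fun s => M.h s - M.r * c) a a' / M.C := by
  rw [← hM.Pa_sub c x ha ha']
  unfold val
  ring

/-- Existence of a solution to the system. -/
lemma Admissible.exists_solvesSystem (hM : M.Admissible) (hK₀ : 0 < K₀) (hK : 0 ≤ M.K)
    (h0 : ∃ x, 0 < x ∧ M.h x < -(M.r * K₀)) (hKK : M.K < K₀) (hk : M.IsCriticalCost k)
    (hlt : K₀ < k) : ∃ p, M.SolvesSystem K₀ p := by
  have hK1 := hM.K₁_pos
  have h0' : ∃ x, 0 < x ∧ M.h x < M.r * (-K₀) := by simpa only [mul_neg] using h0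
  obtain ⟨β, α, hβ, hβα, h⟩ := hM.exists_switch h0' (show -K₀ < M.K₁ by linarith)
  obtain ⟨b1, b2, _⟩ := (hM.sol_a (-K₀) β).between hM hβ hβα (crit_a M (-K₀) β) h (by linarith)
  obtain ⟨δ', α', x', hδ', hδx, hxα, hU, hD⟩ := (hM.isCriticalCost_iff k).1 hk
  have hα := hβ.trans hβα
  have hαα : α < α' := by
    by_contra! hle
    have := hM.criticalCost_le_of_le hK₀ hK hβ hβα h hδ' hδx hxα hU hD hle
    linarith
  -- Lowering the upper switching point from α' to α adds a positive multiple of x^m to a function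
  -- whose minimum is −K.
  have hval : ∀ x, 0 < x → x ≤ β →
      -M.K < M.val (M.Pa (-K₀) β) (M.Qb (-K₀) (M.Bc α) β) x := by
    intro x hx _
    rw [Qb_eq_of_crit h, Pa_eq_of_crit h]
    have h1 := (hM.sol_U_a M.K₁ α').le_val_of_crit_QU hM hδ' hU hx
    have h2 := hM.val_U_sub M.K₁ x hα (hα.trans hαα)
    have h3 := J_pos (hM.tame_h.sub_const (M.r * M.K₁)) M.m hα hαα fun s hs =>
      sub_pos.2 (b2.trans_le (hM.h_mono hα (hα.trans hs.1) hs.1.le))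
    have h4 := div_pos (mul_pos (Real.rpow_pos_of_pos hx M.m) h3) hM.C_pos
    linarith
  obtain ⟨δ, γ, hδ, hδγ, hγβ, h'⟩ := hM.exists_abandon hβ (hM.Bc_pos hα b2)
    (fun s hs hsβ => (hM.h_mono hs hβ hsβ.le).trans_lt b1) (show -K₀ < -M.K by linarith) hval
  exact ⟨⟨δ, γ, β, α⟩, (hM.solvesSystem_iff _ _).2 ⟨hδ, hδγ, hγβ, hβα, h, h'⟩⟩

/-- Uniqueness of the solution to the system. -/
lemma Admissible.solvesSystem_unique (hM : M.Admissible) (hK₀ : 0 < K₀) {p q : Boundary}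
    (hp : M.SolvesSystem K₀ p) (hq : M.SolvesSystem K₀ q) : p = q := by
  have hK1 := hM.K₁_pos
  obtain ⟨δ, γ, β, α⟩ := p
  obtain ⟨δ₂, γ₂, β₂, α₂⟩ := q
  obtain ⟨hδ, hδγ, hγβ, hβα, h, h'⟩ := (hM.solvesSystem_iff _ _).1 hp
  obtain ⟨hδ₂, hδγ₂, hγβ₂, hβα₂, h₂, h₂'⟩ := (hM.solvesSystem_iff _ _).1 hq
  simp only at *
  have hcd : -K₀ < M.K₁ := by linarith
  have hβ := (hδ.trans hδγ).trans hγβ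
  obtain ⟨rfl, rfl⟩ := hM.switch_unique hβ hβα ((hδ₂.trans hδγ₂).trans hγβ₂) hβα₂ hcd h h₂
  obtain ⟨b1, b2, _⟩ := (hM.sol_a (-K₀) β).between hM hβ hβα (crit_a M (-K₀) β) h hcd
  obtain ⟨rfl, rfl⟩ := hM.abandon_unique hδ hδγ hγβ hδ₂ hδγ₂ hγβ₂ (hM.Bc_pos (hβ.trans hβα) b2)
    (fun s hs hsβ => (hM.h_mono hs hβ hsβ.le).trans_lt b1) h' h₂'
  rfl

/-- Necessary conditions for the solvability of the system. -/
lemma Admissible.necessary (hM : M.Admissible) (hK₀ : 0 < K₀) {p : Boundary}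
    (hp : M.SolvesSystem K₀ p) (hK : 0 ≤ M.K) :
    (∃ x, 0 < x ∧ M.h x < -(M.r * K₀)) ∧ M.K < K₀ ∧ ∃ k, M.IsCriticalCost k ∧ K₀ < k := by
  have hK1 := hM.K₁_pos
  obtain ⟨δ, γ, β, α⟩ := p
  obtain ⟨hδ, hδγ, hγβ, hβα, h, h'⟩ := (hM.solvesSystem_iff _ _).1 hp
  simp only at *
  have hcd : -K₀ < M.K₁ := by linarith
  have hγ := hδ.trans hδγ
  have hβ := hγ.trans hγβ
  have hα := hβ.trans hβα
  obtain ⟨b1, b2, _⟩ := (hM.sol_a (-K₀) β).between hM hβ hβα (crit_a M (-K₀) β) h hcd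
  have hB := hM.Bc_pos hα b2
  have hh : ∀ s, 0 < s → s < β → M.h s < M.r * (-K₀) := fun s hs hsβ =>
    (hM.h_mono hs hβ hsβ.le).trans_lt b1
  have hh0 : ∃ x, 0 < x ∧ M.h x < -(M.r * K₀) := ⟨β, hβ, by rwa [mul_neg] at b1⟩
  have hKK : M.K < K₀ := by
    have h1 := ((hM.crit_iff hδ).1 h').2
    rw [val_b] at h1
    have h2 := hM.val_a_gt hδ hδγ fun s hs hsγ => hh s hs (hsγ.trans hγβ)
    have h3 := div_pos (mul_pos (Real.rpow_pos_of_pos hδ M.n) hB) hM.C_pos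
    linarith
  refine ⟨hh0, hKK, ?_⟩
  obtain ⟨x, hx, hx0⟩ := hh0
  obtain ⟨⟨k, hk, -⟩, -⟩ := hM.criticalCost hK ⟨x, hx, by nlinarith [hM.r_pos]⟩
  refine ⟨k, hk, ?_⟩
  obtain ⟨δ', α', x', hδ', hδx, hxα, hU, hD⟩ := (hM.isCriticalCost_iff k).1 hk
  refine hM.lt_criticalCost_of_lt hK₀ hK hβ hβα h hδ' hδx hxα hU hD ?_
  by_contra! hle
  have hα' := hδ'.trans (hδx.trans hxα)
  have hδα : δ' ≤ α := (hδx.trans hxα).le.trans hle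
  -- compare the two candidates at the abandonment point
  have h1 : M.val (M.Pa (-K₀) β) M.QU δ' ≤ -M.K := by
    rw [Pa_eq_of_crit h]
    have e1 := hM.val_U_sub M.K₁ δ' hα' hα
    have e2 := J_nonneg (f := fun s => M.h s - M.r * M.K₁) M.m hα' hle fun s hs =>
      sub_nonneg.2 ((hM.h_gt_of_crit_U hδ' (hδx.trans hxα) (by linarith) hU).le.trans
        (hM.h_mono hα' (hα'.trans hs.1) hs.1.le))
    have e3 := div_nonneg (mul_nonneg (Real.rpow_nonneg hδ'.le M.m) e2) hM.C_pos.le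
    rw [((hM.crit_iff hδ').1 hU).2] at e1
    linarith
  rw [← Qb_eq_of_crit h] at h1
  -- Left of β the continuation of w₁ is the member γ = β of the abandonment family, which exceeds
  -- −K. From β on, w₁ − w₀ ≥ −K₀ and the growth of Bxⁿ put it strictly above the value at γ, which
  -- is at least −K.
  rcases lt_or_ge δ' β with hlt | hge
  · exact absurd (hM.lt_val_b hδ hδγ hB h' hγβ hh hδ' hlt) (not_lt.2 h1)
  · have e1 := hM.switch_ge hβ hβα hcd h hδ' hδα
    have e2 := hM.abandon_le hδ hδγ hB h' hγ le_rfl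
    rw [hM.val_b_self _ _ hγ] at e2
    rw [val_b] at h1
    have e3 : γ ^ M.n * M.Bc α / M.C < δ' ^ M.n * M.Bc α / M.C :=
      div_lt_div_of_pos_right (mul_lt_mul_of_pos_right
        (Real.rpow_lt_rpow hγ.le (hγβ.trans_le hge) hM.n_pos) hB) hM.C_pos
    linarith

end

end Model

end SwitchAbandon

namespace SwitchAbandon

/-! ### Regularity -/

/-- The function `f` up to `p` and `g` beyond. -/
noncomputable def glue (p : ℝ) (f g : ℝ → ℝ) (s : ℝ) : ℝ := if s ≤ p then f s else g s

lemma glue_of_le {p s : ℝ} (f g : ℝ → ℝ) (h : s ≤ p) : glue p f g s = f s := if_pos h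

lemma glue_of_gt {p s : ℝ} (f g : ℝ → ℝ) (h : p < s) : glue p f g s = g s := if_neg (not_le.2 h)

lemma continuousAt_glue {p x : ℝ} {f g : ℝ → ℝ} (hx : x ≠ p) (hf : ContinuousAt f x)
    (hg : ContinuousAt g x) : ContinuousAt (glue p f g) x := by
  rcases lt_or_gt_of_ne hx with h | h
  · refine hf.congr ?_
    filter_upwards [Iio_mem_nhds h] with y hy
    exact (glue_of_le f g (le_of_lt hy)).symm
  · refine hg.congr ?_
    filter_upwards [Ioi_mem_nhds h] with y hy
    exact (glue_of_gt f g hy).symm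

lemma exists_lipschitzOnWith_mul {f g : ℝ → ℝ} {K L : NNReal} {a b : ℝ}
    (hf : LipschitzOnWith K f (Icc a b)) (hg : LipschitzOnWith L g (Icc a b)) :
    ∃ N, LipschitzOnWith N (fun x => f x * g x) (Icc a b) := by
  obtain ⟨F, hF⟩ := isCompact_Icc.exists_bound_of_continuousOn hf.continuousOn
  obtain ⟨G, hG⟩ := isCompact_Icc.exists_bound_of_continuousOn hg.continuousOn
  refine ⟨Real.toNNReal (|F| * L + |G| * K), LipschitzOnWith.of_dist_le_mul fun x hx y hy => ?_⟩
  rw [Real.coe_toNNReal _ (by positivity), Real.dist_eq]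
  have h1 := hf.dist_le_mul x hx y hy
  have h2 := hg.dist_le_mul x hx y hy
  rw [Real.dist_eq] at h1 h2
  have e : f x * g x - f y * g y = f x * (g x - g y) + g y * (f x - f y) := by ring
  rw [e]
  refine (abs_add_le _ _).trans ?_
  rw [abs_mul, abs_mul, add_mul, mul_assoc, mul_assoc]
  exact add_le_add
    (mul_le_mul ((hF x hx).trans (le_abs_self F)) h2 (abs_nonneg _) (abs_nonneg _))
    (mul_le_mul ((hG y hy).trans (le_abs_self G)) h1 (abs_nonneg _) (abs_nonneg _))

lemma exists_lipschitzOnWith_rpow (k : ℝ) {a b : ℝ} (ha : 0 < a) :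
    ∃ N, LipschitzOnWith N (fun x : ℝ => x ^ k) (Icc a b) := by
  refine ContDiffOn.exists_lipschitzOnWith (n := 1) (fun x hx => ?_) one_ne_zero
    (convex_Icc a b) isCompact_Icc
  exact (Real.contDiffAt_rpow_const_of_ne (ha.trans_le hx.1).ne').contDiffWithinAt

lemma Tame.exists_lipschitzOnWith_J {f : ℝ → ℝ} (hf : Tame f) (k : ℝ) {a b : ℝ} (ha : 0 < a)
    {p : ℝ} (hp : 0 < p) : ∃ N, LipschitzOnWith N (fun x => J k f p x) (Icc a b) := by
  obtain ⟨c, hc⟩ := hf.exists_abs_J_le k (b := b) ha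
  refine ⟨Real.toNNReal |c|, LipschitzOnWith.of_dist_le_mul fun x hx y hy => ?_⟩
  rw [Real.coe_toNNReal _ (abs_nonneg c), Real.dist_eq, Real.dist_eq,
    ← J_add_adjacent hf k hp (ha.trans_le hy.1) (ha.trans_le hx.1), add_sub_cancel_left]
  exact (hc y hy x hx).trans (mul_le_mul_of_nonneg_right (le_abs_self c) (abs_nonneg _))

namespace Model

variable {M : Model}

/-- Equality of both coefficients at `p` is smooth fit. The glued function is again a solution for a
tame payoff, so no separate regularity argument at `p` is needed. -/
lemma Sol.glue {f g P Q P' Q' : ℝ → ℝ} (h : M.Sol f P Q) (h' : M.Sol g P' Q') {p : ℝ}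
    (hp : 0 < p) (hP : P p = P' p) (hQ : Q p = Q' p) :
    M.Sol (glue p f g) (glue p P P') (glue p Q Q') := by
  have ht : Tame (SwitchAbandon.glue p f g) := h.tame.glue h'.tame p
  have key1 : ∀ k b, b ≤ p → J k (SwitchAbandon.glue p f g) p b = J k f p b := fun k b hb =>
    J_congr k fun s hs => glue_of_le f g (by rw [uIoc_of_ge hb] at hs; exact hs.2)
  have key2 : ∀ k b, p < b → J k (SwitchAbandon.glue p f g) p b = J k g p b := fun k b hb =>
    J_congr k fun s hs => glue_of_gt f g (by rw [uIoc_of_le hb.le] at hs; exact hs.1)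
  have hPb : ∀ b, 0 < b → SwitchAbandon.glue p P P' b =
      P p + J M.m (SwitchAbandon.glue p f g) p b := by
    intro b hb
    rcases le_or_gt b p with hbp | hbp
    · rw [glue_of_le _ _ hbp, key1 _ _ hbp, h.P_eq p b hp hb]
    · rw [glue_of_gt _ _ hbp, key2 _ _ hbp, h'.P_eq p b hp hb, hP]
  have hQb : ∀ b, 0 < b → SwitchAbandon.glue p Q Q' b =
      Q p - J M.n (SwitchAbandon.glue p f g) p b := by
    intro b hb
    rcases le_or_gt b p with hbp | hbp
    · rw [glue_of_le _ _ hbp, key1 _ _ hbp, h.Q_eq p b hp hb]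
    · rw [glue_of_gt _ _ hbp, key2 _ _ hbp, h'.Q_eq p b hp hb, hQ]
  refine ⟨ht, fun a b ha hb => ?_, fun a b ha hb => ?_⟩
  · rw [hPb a ha, hPb b hb, ← J_add_adjacent ht _ hp ha hb]; ring
  · rw [hQb a ha, hQb b hb, ← J_add_adjacent ht _ hp ha hb]; ring

lemma val_glue_of_le {p x : ℝ} (P Q P' Q' : ℝ → ℝ) (h : x ≤ p) :
    M.val (glue p P P') (glue p Q Q') x = M.val P Q x := by
  simp only [val, glue_of_le _ _ h]

lemma val_glue_of_gt {p x : ℝ} (P Q P' Q' : ℝ → ℝ) (h : p < x) :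
    M.val (glue p P P') (glue p Q Q') x = M.val P' Q' x := by
  simp only [val, glue_of_gt _ _ h]

lemma slope_glue_of_le {p x : ℝ} (P Q P' Q' : ℝ → ℝ) (h : x ≤ p) :
    M.slope (glue p P P') (glue p Q Q') x = M.slope P Q x := by
  simp only [slope, glue_of_le _ _ h]

lemma slope_glue_of_gt {p x : ℝ} (P Q P' Q' : ℝ → ℝ) (h : p < x) :
    M.slope (glue p P P') (glue p Q Q') x = M.slope P' Q' x := by
  simp only [slope, glue_of_gt _ _ h]

section

variable {f P Q : ℝ → ℝ}

lemma Sol.eqOn_deriv (hM : M.Admissible) (h : M.Sol f P Q) :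
    EqOn (deriv (M.val P Q)) (fun x => M.slope P Q x / x) (Ioi 0) :=
  fun _ hx => h.deriv_eq hM hx

lemma Sol.contDiffOn (hM : M.Admissible) (h : M.Sol f P Q) :
    ContDiffOn ℝ 1 (M.val P Q) (Ioi 0) := by
  rw [show (1 : WithTop ℕ∞) = 0 + 1 from (zero_add 1).symm,
    contDiffOn_succ_iff_deriv_of_isOpen isOpen_Ioi]
  refine ⟨fun x hx => (h.differentiableAt hM hx).differentiableWithinAt, by simp, ?_⟩
  rw [contDiffOn_zero]
  exact (h.continuousOn_slope.div continuousOn_id fun x hx => ne_of_gt hx).congr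
    (h.eqOn_deriv hM)

lemma Sol.locallyLipschitzOn_deriv (hM : M.Admissible) (h : M.Sol f P Q) :
    LocallyLipschitzOn (Ioi 0) (deriv (M.val P Q)) := by
  intro x hx
  have hx : 0 < x := hx
  have ha : 0 < x / 2 := by positivity
  have hP : ∃ N, LipschitzOnWith N P (Icc (x / 2) (2 * x)) := by
    obtain ⟨N, hN⟩ := h.tame.exists_lipschitzOnWith_J M.m (b := 2 * x) ha one_pos
    refine ⟨N, LipschitzOnWith.of_dist_le_mul fun y hy z hz => ?_⟩
    have := hN.dist_le_mul y hy z hz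
    rw [h.P_eq 1 y one_pos (ha.trans_le hy.1), h.P_eq 1 z one_pos (ha.trans_le hz.1)]
    rwa [dist_add_left]
  have hQ : ∃ N, LipschitzOnWith N Q (Icc (x / 2) (2 * x)) := by
    obtain ⟨N, hN⟩ := h.tame.exists_lipschitzOnWith_J M.n (b := 2 * x) ha one_pos
    refine ⟨N, LipschitzOnWith.of_dist_le_mul fun y hy z hz => ?_⟩
    have := hN.dist_le_mul y hy z hz
    rw [h.Q_eq 1 y one_pos (ha.trans_le hy.1), h.Q_eq 1 z one_pos (ha.trans_le hz.1)]
    rwa [dist_sub_left]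
  obtain ⟨_, hP⟩ := hP
  obtain ⟨_, hQ⟩ := hQ
  obtain ⟨_, r1⟩ := exists_lipschitzOnWith_rpow (M.m - 1) (b := 2 * x) ha
  obtain ⟨_, r2⟩ := exists_lipschitzOnWith_rpow (M.n - 1) (b := 2 * x) ha
  obtain ⟨_, t1⟩ := exists_lipschitzOnWith_mul r1 hP
  obtain ⟨_, t2⟩ := exists_lipschitzOnWith_mul r2 hQ
  obtain ⟨N₁, u1⟩ := exists_lipschitzOnWith_mul
    ((LipschitzWith.const (M.m / M.C)).lipschitzOnWith (s := Icc (x / 2) (2 * x))) t1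
  obtain ⟨N₂, u2⟩ := exists_lipschitzOnWith_mul
    ((LipschitzWith.const (M.n / M.C)).lipschitzOnWith (s := Icc (x / 2) (2 * x))) t2
  refine ⟨N₁ + N₂, Icc (x / 2) (2 * x),
    mem_nhdsWithin_of_mem_nhds (Icc_mem_nhds (by linarith) (by linarith)), ?_⟩
  have e : EqOn (deriv (M.val P Q)) (fun y => M.m / M.C * (y ^ (M.m - 1) * P y) +
      M.n / M.C * (y ^ (M.n - 1) * Q y)) (Icc (x / 2) (2 * x)) := fun y hy => by
    have hy0 : 0 < y := ha.trans_le hy.1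
    rw [h.deriv_eq hM hy0]
    dsimp only
    rw [Real.rpow_sub_one hy0.ne', Real.rpow_sub_one hy0.ne']
    unfold slope
    have := hM.C_pos.ne'
    field_simp
  intro y hy z hz
  rw [e hy, e hz]
  exact (u1.add u2) hy hz

/-- The differential equation at the points of continuity of the payoff. -/
lemma Sol.ode (hM : M.Admissible) (h : M.Sol f P Q) {x : ℝ} (hx : 0 < x) (hf : ContinuousAt f x) :
    DifferentiableAt ℝ (deriv (M.val P Q)) x ∧
      M.σ ^ 2 * x ^ 2 * deriv (deriv (M.val P Q)) x + M.b * x * deriv (M.val P Q) x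
        - M.r * M.val P Q x + f x = 0 := by
  have hC := hM.C_pos.ne'
  have hP : HasDerivAt P (x ^ (-M.m - 1) * f x) x := by
    refine ((h.tame.hasDerivAt_J M.m one_pos hx hf).const_add (P 1)).congr_of_eventuallyEq ?_
    filter_upwards [Ioi_mem_nhds hx] with y hy
    exact h.P_eq 1 y one_pos hy
  have hQ : HasDerivAt Q (-(x ^ (-M.n - 1) * f x)) x := by
    refine ((h.tame.hasDerivAt_J M.n one_pos hx hf).const_sub (Q 1)).congr_of_eventuallyEq ?_
    filter_upwards [Ioi_mem_nhds hx] with y hy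
    exact h.Q_eq 1 y one_pos hy
  have d1 := (Real.hasDerivAt_rpow_const (x := x) (p := M.m - 1) (Or.inl hx.ne')).const_mul M.m
  have d2 := (Real.hasDerivAt_rpow_const (x := x) (p := M.n - 1) (Or.inl hx.ne')).const_mul M.n
  have d3 := ((d1.mul hP).add (d2.mul hQ)).div_const M.C
  have d4 := d3.congr_of_eventuallyEq (f₁ := deriv (M.val P Q)) (by
    filter_upwards [Ioi_mem_nhds hx] with y hy
    have hy : 0 < y := hy
    rw [h.deriv_eq hM hy]
    simp only [Pi.add_apply, Pi.mul_apply]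
    rw [Real.rpow_sub_one hy.ne', Real.rpow_sub_one hy.ne']
    unfold slope
    field_simp)
  refine ⟨d4.differentiableAt, ?_⟩
  rw [d4.deriv, h.deriv_eq hM hx]
  have e1 := rpow_mul_rpow_neg hx M.m
  have e2 := rpow_mul_rpow_neg hx M.n
  unfold slope val
  simp only [Real.rpow_sub_one hx.ne']
  have hs := hM.σ_ne
  have hnm : M.n - M.m ≠ 0 := by linarith [hM.m_neg, hM.n_pos]
  have g1 := hM.mn_eq
  have g2 := hM.m_add_n_eq
  unfold C
  generalize x ^ M.m = X at *
  generalize x ^ M.n = Y at *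
  generalize x ^ (-M.m) = X' at *
  generalize x ^ (-M.n) = Y' at *
  have hb : M.b = M.σ ^ 2 - M.σ ^ 2 * (M.m + M.n) := by linarith
  have hr : M.r = -(M.σ ^ 2 * (M.m * M.n)) := by linarith
  rw [hb, hr]
  field_simp
  linear_combination f x * M.m * e1 - f x * M.n * e2

/-- The differential equation expresses the second derivative through functions that are continuous
near `x`. -/
lemma Sol.contDiffAt_two (hM : M.Admissible) (h : M.Sol f P Q) {x : ℝ} (hx : 0 < x)
    (hf : ∀ᶠ y in 𝓝 x, ContinuousAt f y) : ContDiffAt ℝ 2 (M.val P Q) x := by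
  obtain ⟨u, hu, huo, hxu⟩ := eventually_nhds_iff.1 (hf.and (Ioi_mem_nhds hx))
  have hu0 : ∀ y ∈ u, 0 < y := fun y hy => (hu y hy).2
  have hσ := hM.σ_ne
  suffices ContDiffOn ℝ 2 (M.val P Q) u from this.contDiffAt (huo.mem_nhds hxu)
  rw [show (2 : WithTop ℕ∞) = 1 + 1 from one_add_one_eq_two.symm,
    contDiffOn_succ_iff_deriv_of_isOpen huo]
  refine ⟨fun y hy => (h.differentiableAt hM (hu0 y hy)).differentiableWithinAt, by simp, ?_⟩
  rw [show (1 : WithTop ℕ∞) = 0 + 1 from (zero_add 1).symm,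
    contDiffOn_succ_iff_deriv_of_isOpen huo]
  refine ⟨fun y hy => (h.ode hM (hu0 y hy) (hu y hy).1).1.differentiableWithinAt, by simp, ?_⟩
  rw [contDiffOn_zero]
  have hc1 : ContinuousOn (deriv (M.val P Q)) u :=
    fun y hy => (h.ode hM (hu0 y hy) (hu y hy).1).1.continuousAt.continuousWithinAt
  have hc2 : ContinuousOn (M.val P Q) u := (h.continuousOn_val hM).mono hu0
  have hc3 : ContinuousOn f u := fun y hy => (hu y hy).1.continuousWithinAt
  have hc4 : ContinuousOn (fun y => (M.r * M.val P Q y - M.b * y * deriv (M.val P Q) y - f y) /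
      (M.σ ^ 2 * y ^ 2)) u := by
    refine ((((continuousOn_const.mul hc2).sub ((continuousOn_const.mul continuousOn_id).mul
      hc1)).sub hc3).div (continuousOn_const.mul (continuousOn_id.pow 2)) fun y hy => ?_)
    have := hu0 y hy
    positivity
  refine hc4.congr fun y hy => ?_
  have hy0 := hu0 y hy
  rw [eq_div_iff (by positivity)]
  linarith [(h.ode hM hy0 (hu y hy).1).2]

end

end Model

end SwitchAbandon

namespace SwitchAbandon

namespace Model

variable {M : Model}

/-! ### The candidate value functions -/

section

variable {K₀ : ℝ} {p : Boundary}

lemma Admissible.A_eq (hM : M.Admissible) (hβ : 0 < p.β) :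
    M.A K₀ p = (M.pc (-K₀) p.β - M.PU p.β) / M.C := by
  have h := hM.integral_zero_sub (-K₀) hβ
  simp only [mul_neg, sub_neg_eq_add] at h
  unfold A C
  rw [h]
  ring

lemma Admissible.Γ₁_eq (hM : M.Admissible) (hγ : 0 < p.γ) :
    M.Γ₁ K₀ p = (M.pc (-K₀) p.γ - M.PU p.γ) / M.C := by
  have h := hM.integral_zero_sub (-K₀) hγ
  simp only [mul_neg, sub_neg_eq_add] at h
  unfold Γ₁ C
  rw [h]
  ring

lemma Admissible.B_eq (hM : M.Admissible) (hα : 0 < p.α) : M.B p = M.Bc p.α / M.C := by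
  unfold B Bc C
  rw [hM.integral_Ioi_sub _ hα]
  ring

lemma Γ₂_eq_J :
    M.Γ₂ K₀ p = -J M.n (fun s => M.h s - M.r * (-K₀)) p.γ p.β / M.C := by
  unfold Γ₂ C J
  simp only [mul_neg, sub_neg_eq_add]
  ring

/-- The data of a solution to the system. -/
structure Facts (M : Model) (K₀ : ℝ) (p : Boundary) : Prop where
  δ_pos : 0 < p.δ
  δγ : p.δ < p.γ
  γβ : p.γ < p.β
  βα : p.β < p.α
  crit_α : M.Crit (M.Pa (-K₀) p.β) (M.Qa (-K₀) p.β) p.α M.K₁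
  crit_δ : M.Crit (M.Pa (-K₀) p.γ) (M.Qb (-K₀) (M.Bc p.α) p.γ) p.δ (-M.K)
  h_β : M.h p.β < M.r * (-K₀)
  h_α : M.r * M.K₁ < M.h p.α
  Bc_pos : 0 < M.Bc p.α

lemma Admissible.facts (hM : M.Admissible) (hK₀ : 0 < K₀) (hp : M.SolvesSystem K₀ p) :
    M.Facts K₀ p := by
  have hK1 := hM.K₁_pos
  obtain ⟨hδ, hδγ, hγβ, hβα, h, h'⟩ := (hM.solvesSystem_iff _ _).1 hp
  have hβ := (hδ.trans hδγ).trans hγβ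
  obtain ⟨b1, b2, _⟩ := (hM.sol_a (-K₀) p.β).between hM hβ hβα (crit_a M (-K₀) p.β) h
    (by linarith)
  exact ⟨hδ, hδγ, hγβ, hβα, h, h', b1, b2, hM.Bc_pos (hβ.trans hβα) b2⟩

namespace Facts

lemma γ_pos (F : M.Facts K₀ p) : 0 < p.γ := F.δ_pos.trans F.δγ

lemma β_pos (F : M.Facts K₀ p) : 0 < p.β := F.γ_pos.trans F.γβ

lemma α_pos (F : M.Facts K₀ p) : 0 < p.α := F.β_pos.trans F.βα

lemma Bc_eq (F : M.Facts K₀ p) : M.Bc p.α = M.QU p.β - M.qc (-K₀) p.β := by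
  have := F.crit_α.Q_eq
  unfold Qa at this
  unfold Bc
  linarith

lemma h_lt (F : M.Facts K₀ p) (hM : M.Admissible) {s : ℝ} (hs : 0 < s) (hsβ : s ≤ p.β) : M.h s < M.r * (-K₀) :=
  (hM.h_mono hs F.β_pos hsβ).trans_lt F.h_β

lemma Γ₂_eq (F : M.Facts K₀ p) (hM : M.Admissible) : M.Γ₂ K₀ p = (M.qc (-K₀) p.γ - M.QU p.γ + M.Bc p.α) / M.C := by
  rw [Γ₂_eq_J, hM.J_n_sub _ F.γ_pos F.β_pos, F.Bc_eq]
  have := hM.sol_U.Q_eq p.γ p.β F.γ_pos F.β_pos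
  rw [this]
  ring

lemma B_pos (F : M.Facts K₀ p) (hM : M.Admissible) : 0 < M.B p := by
  rw [hM.B_eq F.α_pos]
  exact div_pos F.Bc_pos hM.C_pos

/-- A weighted integral of a negative function that is integrable at zero is negative. -/
lemma PU_lt (F : M.Facts K₀ p) (hM : M.Admissible) {x : ℝ} (hx : 0 < x) (hxβ : x ≤ p.β) : M.PU x < M.pc (-K₀) x := by
  have h2 : 0 < x / 2 := by positivity
  have h1 : M.PU (x / 2) - M.pc (-K₀) (x / 2) ≤ 0 := by
    rw [← hM.integral_zero_sub _ h2, intervalIntegral.integral_of_le h2.le]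
    refine setIntegral_nonpos measurableSet_Ioc fun s hs => ?_
    exact mul_nonpos_of_nonneg_of_nonpos (Real.rpow_nonneg hs.1.le _)
      (sub_neg.2 (F.h_lt hM hs.1 (by linarith [hs.2]))).le
  have h3 := J_neg (hM.tame_h.sub_const (M.r * (-K₀))) M.m h2 (by linarith : x / 2 < x)
    fun s hs => sub_neg.2 (F.h_lt hM (h2.trans hs.1) (hs.2.le.trans hxβ))
  rw [hM.J_m_sub _ h2 hx] at h3
  have h4 := hM.sol_U.P_eq (x / 2) x h2 hx
  linarith

lemma A_pos (F : M.Facts K₀ p) (hM : M.Admissible) : 0 < M.A K₀ p := by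
  rw [hM.A_eq F.β_pos]
  exact div_pos (sub_pos.2 (F.PU_lt hM F.β_pos le_rfl)) hM.C_pos

lemma Γ₁_pos (F : M.Facts K₀ p) (hM : M.Admissible) : 0 < M.Γ₁ K₀ p := by
  rw [hM.Γ₁_eq F.γ_pos]
  exact div_pos (sub_pos.2 (F.PU_lt hM F.γ_pos F.γβ.le)) hM.C_pos

lemma Γ₂_pos (F : M.Facts K₀ p) (hM : M.Admissible) : 0 < M.Γ₂ K₀ p := by
  rw [Γ₂_eq_J]
  refine div_pos (neg_pos.2 (J_neg (hM.tame_h.sub_const _) _ F.γ_pos F.γβ fun s hs => ?_)) hM.C_pos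
  exact sub_neg.2 (F.h_lt hM (F.γ_pos.trans hs.1) hs.2.le)

/-! #### Values of the candidates -/

lemma val_U (F : M.Facts K₀ p) (x : ℝ) : M.val (M.Pa (-K₀) p.β) M.QU x =
    M.val (M.Pa (-K₀) p.β) (M.Qa (-K₀) p.β) x + x ^ M.n * M.Bc p.α / M.C := by
  rw [← val_b, Qb_eq_of_crit F.crit_α]

lemma A_mul_add_R (F : M.Facts K₀ p) (hM : M.Admissible) {x : ℝ} : M.A K₀ p * x ^ M.m + M.R x = M.val (M.Pa (-K₀) p.β) M.QU x := by
  rw [hM.A_eq F.β_pos, R_eq_val]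
  unfold val Pa
  ring

lemma Γ_mul_add_R (F : M.Facts K₀ p) (hM : M.Admissible) {x : ℝ} : M.Γ₁ K₀ p * x ^ M.m + M.Γ₂ K₀ p * x ^ M.n + M.R x =
    M.val (M.Pa (-K₀) p.γ) (M.Qb (-K₀) (M.Bc p.α) p.γ) x := by
  rw [hM.Γ₁_eq F.γ_pos, F.Γ₂_eq hM, R_eq_val]
  unfold val Pa Qb Qa
  ring

lemma w₁_of_le_δ {x : ℝ} (hx : x ≤ p.δ) : M.w₁ K₀ p x = -M.K := if_pos hx

lemma w₁_of_mem_δγ (F : M.Facts K₀ p) (hM : M.Admissible) {x : ℝ} (hx : p.δ < x) (hx' : x ≤ p.γ) :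
    M.w₁ K₀ p x = M.val (M.Pa (-K₀) p.γ) (M.Qb (-K₀) (M.Bc p.α) p.γ) x := by
  unfold w₁
  rw [if_neg (not_le.2 hx)]
  rcases hx'.lt_or_eq with h | h
  · rw [if_pos h, F.Γ_mul_add_R hM]
  · rw [if_neg (not_lt.2 h.ge), if_pos (h.le.trans F.γβ.le), h, hM.val_b_self _ _ F.γ_pos,
      hM.B_eq F.α_pos]
    ring

lemma w₁_of_mem_γβ (F : M.Facts K₀ p) (hM : M.Admissible) {x : ℝ} (hx : p.γ ≤ x) (hx' : x ≤ p.β) :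
    M.w₁ K₀ p x = x ^ M.n * M.Bc p.α / M.C - K₀ := by
  unfold w₁
  rw [if_neg (not_le.2 (F.δγ.trans_le hx)), if_neg (not_lt.2 hx), if_pos hx', hM.B_eq F.α_pos]
  ring

lemma w₁_of_β_lt (F : M.Facts K₀ p) (hM : M.Admissible) {x : ℝ} (hx : p.β < x) :
    M.w₁ K₀ p x = M.val (M.Pa (-K₀) p.β) M.QU x := by
  unfold w₁
  rw [if_neg (not_le.2 ((F.δγ.trans F.γβ).trans hx)), if_neg (not_lt.2 (F.γβ.trans hx).le),
    if_neg (not_le.2 hx), F.A_mul_add_R hM]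

lemma w₀_of_le_α (F : M.Facts K₀ p) (hM : M.Admissible) {x : ℝ} (hx : x ≤ p.α) : M.w₀ K₀ p x = x ^ M.n * M.Bc p.α / M.C := by
  unfold w₀
  rcases hx.lt_or_eq with h | h
  · rw [if_pos h, hM.B_eq F.α_pos]; ring
  · rw [if_neg (not_lt.2 h.ge), F.A_mul_add_R hM, F.val_U, h,
      ((hM.crit_iff F.α_pos).1 F.crit_α).2]
    ring

lemma w₀_of_α_le (F : M.Facts K₀ p) (hM : M.Admissible) {x : ℝ} (hx : p.α ≤ x) :
    M.w₀ K₀ p x = M.val (M.Pa (-K₀) p.β) M.QU x - M.K₁ := by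
  unfold w₀
  rw [if_neg (not_lt.2 hx), F.A_mul_add_R hM]

end Facts

end

end Model

end SwitchAbandon

namespace SwitchAbandon

namespace Model

variable {M : Model} {K₀ : ℝ} {p : Boundary}

/-! #### The candidates as solutions -/

/-- The payoff for which the candidate in the open mode is a solution. -/
noncomputable def f₁ (M : Model) (K₀ : ℝ) (p : Boundary) : ℝ → ℝ :=
  glue p.δ (fun _ => M.r * (-M.K)) (glue p.γ M.h (glue p.β (fun _ => M.r * (-K₀)) M.h))

/-- The first coefficient of the candidate in the open mode. -/
noncomputable def P₁ (M : Model) (K₀ : ℝ) (p : Boundary) : ℝ → ℝ :=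
  glue p.δ (M.pc (-M.K)) (glue p.γ (M.Pa (-K₀) p.γ)
    (glue p.β (fun s => M.pc (-K₀) s + 0) (M.Pa (-K₀) p.β)))

/-- The second coefficient of the candidate in the open mode. -/
noncomputable def Q₁ (M : Model) (K₀ : ℝ) (p : Boundary) : ℝ → ℝ :=
  glue p.δ (M.qc (-M.K)) (glue p.γ (M.Qb (-K₀) (M.Bc p.α) p.γ)
    (glue p.β (fun s => M.qc (-K₀) s + M.Bc p.α) M.QU))

/-- The payoff for which the candidate in the closed mode is a solution. -/
noncomputable def f₀ (M : Model) (p : Boundary) : ℝ → ℝ :=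
  glue p.α (fun _ => 0) (fun s => M.h s + M.r * (-M.K₁))

/-- The first coefficient of the candidate in the closed mode. -/
noncomputable def P₀ (M : Model) (K₀ : ℝ) (p : Boundary) : ℝ → ℝ :=
  glue p.α (fun _ => 0) (fun s => M.Pa (-K₀) p.β s + M.pc (-M.K₁) s)

/-- The second coefficient of the candidate in the closed mode. -/
noncomputable def Q₀ (M : Model) (p : Boundary) : ℝ → ℝ :=
  glue p.α (fun _ => M.Bc p.α) (fun s => M.QU s + M.qc (-M.K₁) s)

namespace Facts

/-- On [γ, β] the piece Bxⁿ − K₀ is a solution for the constant payoff −rK₀. Gluing at β and γ uses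
the prescribed critical value −K₀, and gluing at δ is the condition `crit_δ`. -/
lemma sol_w₁ (F : M.Facts K₀ p) (hM : M.Admissible) :
    M.Sol (M.f₁ K₀ p) (M.P₁ K₀ p) (M.Q₁ K₀ p) := by
  have h1 := ((hM.sol_const (-K₀)).add_hom 0 (M.Bc p.α)).glue (hM.sol_U_a (-K₀) p.β) F.β_pos
    (by rw [(crit_a M (-K₀) p.β).P_eq, add_zero]) (by rw [F.Bc_eq]; ring)
  have h2 := (hM.sol_b (-K₀) (M.Bc p.α) p.γ).glue h1 F.γ_pos
    (by rw [glue_of_le _ _ F.γβ.le, (crit_a M (-K₀) p.γ).P_eq, add_zero])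
    (by rw [glue_of_le _ _ F.γβ.le, Qb, (crit_a M (-K₀) p.γ).Q_eq])
  exact (hM.sol_const (-M.K)).glue h2 F.δ_pos
    (by rw [glue_of_le _ _ F.δγ.le, F.crit_δ.P_eq]) (by rw [glue_of_le _ _ F.δγ.le, F.crit_δ.Q_eq])

lemma sol_w₀ (F : M.Facts K₀ p) (hM : M.Admissible) :
    M.Sol (M.f₀ p) (M.P₀ K₀ p) (M.Q₀ p) := by
  refine (sol_hom 0 (M.Bc p.α)).glue ((hM.sol_U_a (-K₀) p.β).add (hM.sol_const (-M.K₁))) F.α_pos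
    ?_ ?_
  · rw [F.crit_α.P_eq]; unfold pc; ring
  · unfold Bc qc; ring

lemma val_hom_add (hM : M.Admissible) (c : ℝ) {x : ℝ} (hx : 0 < x) (B : ℝ) :
    M.val (fun s => M.pc c s + 0) (fun s => M.qc c s + B) x = x ^ M.n * B / M.C + c := by
  simp only [add_zero]
  rw [val_add_Q, (hM.crit_const c hx).2, add_comm]

lemma slope_hom_add (hM : M.Admissible) (c : ℝ) {x : ℝ} (hx : 0 < x) (B : ℝ) :
    M.slope (fun s => M.pc c s + 0) (fun s => M.qc c s + B) x = M.n * x ^ M.n * B / M.C := by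
  simp only [add_zero]
  rw [slope_add_Q, (hM.crit_const c hx).1, zero_add]

lemma w₁_eqOn (F : M.Facts K₀ p) (hM : M.Admissible) :
    EqOn (M.w₁ K₀ p) (M.val (M.P₁ K₀ p) (M.Q₁ K₀ p)) (Ioi 0) := by
  intro x hx
  unfold P₁ Q₁
  rcases le_or_gt x p.δ with h1 | h1
  · rw [w₁_of_le_δ h1, val_glue_of_le _ _ _ _ h1, (hM.crit_const _ hx).2]
  rw [val_glue_of_gt _ _ _ _ h1]
  rcases le_or_gt x p.γ with h2 | h2
  · rw [F.w₁_of_mem_δγ hM h1 h2, val_glue_of_le _ _ _ _ h2]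
  rw [val_glue_of_gt _ _ _ _ h2]
  rcases le_or_gt x p.β with h3 | h3
  · rw [F.w₁_of_mem_γβ hM h2.le h3, val_glue_of_le _ _ _ _ h3, val_hom_add hM _ hx]
    ring
  · rw [F.w₁_of_β_lt hM h3, val_glue_of_gt _ _ _ _ h3]

lemma w₀_eqOn (F : M.Facts K₀ p) (hM : M.Admissible) :
    EqOn (M.w₀ K₀ p) (M.val (M.P₀ K₀ p) (M.Q₀ p)) (Ioi 0) := by
  intro x hx
  unfold P₀ Q₀
  rcases le_or_gt x p.α with h1 | h1
  · rw [F.w₀_of_le_α hM h1, val_glue_of_le _ _ _ _ h1]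
    unfold val
    ring
  · rw [F.w₀_of_α_le hM h1.le, val_glue_of_gt _ _ _ _ h1, sub_eq_add_neg]
    nth_rewrite 1 [← (hM.crit_const (-M.K₁) hx).2]
    unfold val
    ring

/-- At β the function has the positive slope of Bxⁿ − K₀, and a solution of minimal growth that
increases at one point keeps increasing. -/
lemma slope_U_pos (F : M.Facts K₀ p) (hM : M.Admissible) {x : ℝ} (hx : p.β ≤ x) :
    0 < M.slope (M.Pa (-K₀) p.β) M.QU x := by
  refine (hM.sol_U_a (-K₀) p.β).slope_pos_QU hM F.β_pos ?_ hx
  have := hM.slope_b_self_pos (-K₀) F.Bc_pos F.β_pos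
  rwa [Qb_eq_of_crit F.crit_α] at this

lemma slope_power_nonneg (F : M.Facts K₀ p) (hM : M.Admissible) {x : ℝ} (hx : 0 < x) :
    0 ≤ M.n * x ^ M.n * M.Bc p.α / M.C :=
  div_nonneg (mul_nonneg (mul_nonneg hM.n_pos.le (Real.rpow_nonneg hx.le _)) F.Bc_pos.le)
    hM.C_pos.le

lemma power_pos (F : M.Facts K₀ p) (hM : M.Admissible) {x : ℝ} (hx : 0 < x) :
    0 < x ^ M.n * M.Bc p.α / M.C :=
  div_pos (mul_pos (Real.rpow_pos_of_pos hx _) F.Bc_pos) hM.C_pos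

end Facts

lemma Sol.monotoneOn_Ioi {f P Q : ℝ → ℝ} (hM : M.Admissible) (h : M.Sol f P Q)
    (hs : ∀ x, 0 < x → 0 ≤ M.slope P Q x) : MonotoneOn (M.val P Q) (Ioi 0) :=
  fun _ hx _ _ hxy => h.monotoneOn hM hx (fun s hs' => hs s (lt_trans hx hs'.1))
    (left_mem_Icc.2 hxy) (right_mem_Icc.2 hxy) hxy

namespace Facts

lemma monotoneOn_w₁ (F : M.Facts K₀ p) (hM : M.Admissible) :
    MonotoneOn (M.w₁ K₀ p) (Ioi 0) := by
  refine ((F.sol_w₁ hM).monotoneOn_Ioi hM fun x hx => ?_).congr (F.w₁_eqOn hM).symm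
  unfold P₁ Q₁
  rcases le_or_gt x p.δ with h1 | h1
  · rw [slope_glue_of_le _ _ _ _ h1, (hM.crit_const _ hx).1]
  rw [slope_glue_of_gt _ _ _ _ h1]
  rcases le_or_gt x p.γ with h2 | h2
  · rw [slope_glue_of_le _ _ _ _ h2]
    exact ((hM.abandon_facts F.δ_pos F.δγ F.Bc_pos F.crit_δ).2.2 x ⟨h1, h2⟩).le
  rw [slope_glue_of_gt _ _ _ _ h2]
  rcases le_or_gt x p.β with h3 | h3
  · rw [slope_glue_of_le _ _ _ _ h3, slope_hom_add hM _ hx]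
    exact F.slope_power_nonneg hM hx
  · rw [slope_glue_of_gt _ _ _ _ h3]
    exact (F.slope_U_pos hM h3.le).le

lemma monotoneOn_w₀ (F : M.Facts K₀ p) (hM : M.Admissible) :
    MonotoneOn (M.w₀ K₀ p) (Ioi 0) := by
  refine ((F.sol_w₀ hM).monotoneOn_Ioi hM fun x hx => ?_).congr (F.w₀_eqOn hM).symm
  unfold P₀ Q₀
  rcases le_or_gt x p.α with h1 | h1
  · rw [slope_glue_of_le _ _ _ _ h1]
    refine le_of_le_of_eq (F.slope_power_nonneg hM hx) ?_
    unfold slope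
    ring
  · rw [slope_glue_of_gt _ _ _ _ h1]
    refine le_of_le_of_eq (F.slope_U_pos hM (F.βα.le.trans h1.le)).le ?_
    have := (hM.crit_const (-M.K₁) hx).1
    rw [← add_zero (M.slope (M.Pa (-K₀) p.β) M.QU x), ← this]
    unfold slope
    ring

/-! #### The variational inequalities -/

lemma neg_K_le_w₁ (F : M.Facts K₀ p) (hM : M.Admissible) {x : ℝ} (hx : 0 < x) :
    -M.K ≤ M.w₁ K₀ p x := by
  rcases le_total x p.δ with h | h
  · exact (w₁_of_le_δ h).ge
  · rw [← w₁_of_le_δ (M := M) (K₀ := K₀) (le_refl p.δ)]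
    exact F.monotoneOn_w₁ hM F.δ_pos hx h

lemma w₀_pos (F : M.Facts K₀ p) (hM : M.Admissible) {x : ℝ} (hx : 0 < x) :
    0 < M.w₀ K₀ p x := by
  rcases le_total x p.α with h | h
  · rw [F.w₀_of_le_α hM h]
    exact F.power_pos hM hx
  · refine lt_of_lt_of_le ?_ (F.monotoneOn_w₀ hM F.α_pos hx h)
    rw [F.w₀_of_le_α hM le_rfl]
    exact F.power_pos hM F.α_pos

/-- The difference of the candidates between the abandonment and the lower switching point. -/
lemma val_a_mem (F : M.Facts K₀ p) (hM : M.Admissible) {x : ℝ} (hx : p.δ ≤ x) (hx' : x ≤ p.γ) :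
    -K₀ ≤ M.val (M.Pa (-K₀) p.γ) (M.Qa (-K₀) p.γ) x ∧
      M.val (M.Pa (-K₀) p.γ) (M.Qa (-K₀) p.γ) x + p.δ ^ M.n * M.Bc p.α / M.C ≤ -M.K := by
  have hanti := (hM.sol_a (-K₀) p.γ).antitoneOn hM F.δ_pos (b := p.γ) fun s hs =>
    ((hM.sol_a (-K₀) p.γ).slope_neg_left hM (F.δ_pos.trans hs.1) (crit_a M (-K₀) p.γ) hs.2
      fun t ht => F.h_lt hM ((F.δ_pos.trans hs.1).trans ht.1) (ht.2.le.trans F.γβ.le)).le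
  have h1 := hanti ⟨hx, hx'⟩ (right_mem_Icc.2 F.δγ.le) hx'
  have h2 := hanti (left_mem_Icc.2 F.δγ.le) ⟨hx, hx'⟩ hx
  rw [((hM.crit_iff F.γ_pos).1 (crit_a M (-K₀) p.γ)).2] at h1
  have h3 := ((hM.crit_iff F.δ_pos).1 F.crit_δ).2
  rw [val_b] at h3
  exact ⟨h1, by linarith⟩

lemma w₀_sub_w₁_le (F : M.Facts K₀ p) (hM : M.Admissible) (hK₀ : 0 < K₀) {x : ℝ} (hx : 0 < x) :
    M.w₀ K₀ p x - M.w₁ K₀ p x - K₀ ≤ 0 := by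
  have hK1 := hM.K₁_pos
  rcases le_or_gt x p.δ with h1 | h1
  · rw [w₁_of_le_δ h1, F.w₀_of_le_α hM (h1.trans ((F.δγ.trans F.γβ).trans F.βα).le)]
    have a1 := F.val_a_mem hM le_rfl F.δγ.le
    have a2 := hM.rpow_n_mono F.Bc_pos hx h1
    linarith
  rcases le_or_gt x p.γ with h2 | h2
  · rw [F.w₁_of_mem_δγ hM h1 h2, F.w₀_of_le_α hM (h2.trans (F.γβ.trans F.βα).le), val_b]
    linarith [(F.val_a_mem hM h1.le h2).1]
  rcases le_or_gt x p.β with h3 | h3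
  · rw [F.w₁_of_mem_γβ hM h2.le h3, F.w₀_of_le_α hM (h3.trans F.βα.le)]
    linarith
  rcases le_total x p.α with h4 | h4
  · rw [F.w₁_of_β_lt hM h3, F.w₀_of_le_α hM h4, F.val_U]
    linarith [hM.switch_ge F.β_pos F.βα (by linarith) F.crit_α hx h4]
  · rw [F.w₁_of_β_lt hM h3, F.w₀_of_α_le hM h4]
    linarith

lemma w₁_sub_w₀_le (F : M.Facts K₀ p) (hM : M.Admissible) (hK₀ : 0 < K₀) (hK : 0 ≤ M.K) {x : ℝ}
    (hx : 0 < x) : M.w₁ K₀ p x - M.w₀ K₀ p x - M.K₁ ≤ 0 := by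
  have hK1 := hM.K₁_pos
  rcases le_or_gt x p.δ with h1 | h1
  · rw [w₁_of_le_δ h1]
    linarith [F.w₀_pos hM hx]
  rcases le_or_gt x p.γ with h2 | h2
  · rw [F.w₁_of_mem_δγ hM h1 h2, F.w₀_of_le_α hM (h2.trans (F.γβ.trans F.βα).le), val_b]
    linarith [(F.val_a_mem hM h1.le h2).2, F.power_pos hM F.δ_pos]
  rcases le_or_gt x p.β with h3 | h3
  · rw [F.w₁_of_mem_γβ hM h2.le h3, F.w₀_of_le_α hM (h3.trans F.βα.le)]
    linarith
  rcases le_total x p.α with h4 | h4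
  · rw [F.w₁_of_β_lt hM h3, F.w₀_of_le_α hM h4, F.val_U]
    linarith [hM.switch_le F.β_pos F.βα (by linarith) F.crit_α h3.le h4]
  · rw [F.w₁_of_β_lt hM h3, F.w₀_of_α_le hM h4]
    linarith

lemma continuousAt_f₁ {x : ℝ} (h1 : x ≠ p.δ) (h2 : x ≠ p.γ) (h3 : x ≠ p.β)
    (hc : ContinuousAt M.h x) : ContinuousAt (M.f₁ K₀ p) x :=
  continuousAt_glue h1 continuousAt_const (continuousAt_glue h2 hc
    (continuousAt_glue h3 continuousAt_const hc))

lemma continuousAt_f₀ {x : ℝ} (h1 : x ≠ p.α) (hc : ContinuousAt M.h x) :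
    ContinuousAt (M.f₀ p) x :=
  continuousAt_glue h1 continuousAt_const (hc.add continuousAt_const)

lemma max_max_eq_zero {a b c : ℝ} (ha : a ≤ 0) (hb : b ≤ 0) (hc : c ≤ 0)
    (h : a = 0 ∨ b = 0 ∨ c = 0) : max (max a b) c = 0 := by
  refine le_antisymm (max_le (max_le ha hb) hc) ?_
  rcases h with h | h | h
  · exact h.ge.trans ((le_max_left _ _).trans (le_max_left _ _))
  · exact h.ge.trans ((le_max_right _ _).trans (le_max_left _ _))
  · exact h.ge.trans (le_max_right _ _)

/-- As w₁ solves the equation with payoff `f₁`, the differential expression for `h` equals h − f₁ at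
continuity points of `f₁`. It is zero in the waiting regions and negative elsewhere, because h(δ) <
−rK, h(β) < −rK₀ and `h` is monotone. -/
lemma hjb_w₁ (F : M.Facts K₀ p) (hM : M.Admissible) (hK₀ : 0 < K₀) {x : ℝ} (hx : 0 < x) :
    max (max (M.h x - M.f₁ K₀ p x) (M.w₀ K₀ p x - M.w₁ K₀ p x - K₀)) (-M.w₁ K₀ p x - M.K) = 0 := by
  have hb := F.w₀_sub_w₁_le hM hK₀ hx
  have hc : -M.w₁ K₀ p x - M.K ≤ 0 := by linarith [F.neg_K_le_w₁ hM hx]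
  unfold f₁
  rcases le_or_gt x p.δ with h1 | h1
  · rw [glue_of_le _ _ h1]
    refine max_max_eq_zero ?_ hb hc (Or.inr (Or.inr (by rw [w₁_of_le_δ h1]; ring)))
    have a1 := (hM.abandon_facts F.δ_pos F.δγ F.Bc_pos F.crit_δ).1
    linarith [hM.h_mono hx F.δ_pos h1]
  rw [glue_of_gt _ _ h1]
  rcases le_or_gt x p.γ with h2 | h2
  · rw [glue_of_le _ _ h2]
    exact max_max_eq_zero (sub_self _).le hb hc (Or.inl (sub_self _))
  rw [glue_of_gt _ _ h2]
  rcases le_or_gt x p.β with h3 | h3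
  · rw [glue_of_le _ _ h3]
    refine max_max_eq_zero (sub_neg.2 (F.h_lt hM hx h3)).le hb hc (Or.inr (Or.inl ?_))
    rw [F.w₁_of_mem_γβ hM h2.le h3, F.w₀_of_le_α hM (h3.trans F.βα.le)]
    ring
  · rw [glue_of_gt _ _ h3]
    exact max_max_eq_zero (sub_self _).le hb hc (Or.inl (sub_self _))

lemma hjb_w₀ (F : M.Facts K₀ p) (hM : M.Admissible) (hK₀ : 0 < K₀) (hK : 0 ≤ M.K) {x : ℝ}
    (hx : 0 < x) :
    max (max (-M.f₀ p x) (M.w₁ K₀ p x - M.w₀ K₀ p x - M.K₁)) (-M.w₀ K₀ p x - M.K) = 0 := by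
  have hb := F.w₁_sub_w₀_le hM hK₀ hK hx
  have hc : -M.w₀ K₀ p x - M.K ≤ 0 := by linarith [F.w₀_pos hM hx]
  unfold f₀
  rcases le_or_gt x p.α with h1 | h1
  · rw [glue_of_le _ _ h1]
    exact max_max_eq_zero neg_zero.le hb hc (Or.inl neg_zero)
  · rw [glue_of_gt _ _ h1]
    refine max_max_eq_zero ?_ hb hc (Or.inr (Or.inl ?_))
    · linarith [F.h_α, hM.h_mono F.α_pos hx h1.le]
    · rw [F.w₁_of_β_lt hM (F.βα.trans h1), F.w₀_of_α_le hM h1.le]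
      ring

end Facts

/-! ### The HJB equation for the candidates and the sign of the abandonment cost -/

lemma SolvesHJB.congr {v₁ v₀ u₁ u₀ : ℝ → ℝ} (h : M.SolvesHJB K₀ v₁ v₀)
    (h₁ : EqOn u₁ v₁ (Ioi 0)) (h₀ : EqOn u₀ v₀ (Ioi 0)) : M.SolvesHJB K₀ u₁ u₀ := by
  have ev : ∀ {u v : ℝ → ℝ}, EqOn u v (Ioi 0) → ∀ {x : ℝ}, 0 < x → u =ᶠ[𝓝 x] v :=
    fun huv _ hx => huv.eventuallyEq_of_mem (Ioi_mem_nhds hx)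
  have d₁ : EqOn (deriv u₁) (deriv v₁) (Ioi 0) := fun x hx => (ev h₁ hx).deriv_eq
  have d₀ : EqOn (deriv u₀) (deriv v₀) (Ioi 0) := fun x hx => (ev h₀ hx).deriv_eq
  have lip : ∀ {u v : ℝ → ℝ}, EqOn u v (Ioi 0) → LocallyLipschitzOn (Ioi 0) v →
      LocallyLipschitzOn (Ioi 0) u := by
    intro u v huv hv x hx
    obtain ⟨K, t, ht, hK⟩ := hv hx
    refine ⟨K, t ∩ Ioi 0, inter_mem ht self_mem_nhdsWithin, fun y hy z hz => ?_⟩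
    rw [huv hy.2, huv hz.2]
    exact hK hy.1 hz.1
  refine ⟨h.contDiffOn_w₁.congr h₁, h.contDiffOn_w₀.congr h₀, lip d₁ h.lipschitz_w₁,
    lip d₀ h.lipschitz_w₀, ?_⟩
  obtain ⟨S, hS, hjb⟩ := h.hjb
  refine ⟨S, hS, fun x hx hxS => ?_⟩
  obtain ⟨c1, c2⟩ := hjb x hx hxS
  refine ⟨fun hc => ⟨(c1 hc).1.congr_of_eventuallyEq (ev h₁ hx),
    (c1 hc).2.congr_of_eventuallyEq (ev h₀ hx)⟩, fun hc => ?_⟩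
  obtain ⟨e1, e2, e3, e4⟩ := c2 hc
  refine ⟨e1.congr_of_eventuallyEq (ev d₁ hx), e2.congr_of_eventuallyEq (ev d₀ hx), ?_, ?_⟩
  · rw [(ev d₁ hx).deriv_eq, d₁ hx, h₁ hx, h₀ hx]; exact e3
  · rw [(ev d₀ hx).deriv_eq, d₀ hx, h₁ hx, h₀ hx]; exact e4

lemma Facts.solvesHJB (F : M.Facts K₀ p) (hM : M.Admissible) (hK₀ : 0 < K₀) (hK : 0 ≤ M.K) :
    M.SolvesHJB K₀ (M.w₁ K₀ p) (M.w₀ K₀ p) := by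
  have s₁ := F.sol_w₁ hM
  have s₀ := F.sol_w₀ hM
  have e₁ := F.w₁_eqOn hM
  have e₀ := F.w₀_eqOn hM
  refine SolvesHJB.congr ⟨s₁.contDiffOn hM, s₀.contDiffOn hM, s₁.locallyLipschitzOn_deriv hM,
    s₀.locallyLipschitzOn_deriv hM, {p.δ, p.γ, p.β, p.α}, by simp, fun x hx hxS => ?_⟩ e₁ e₀
  simp only [mem_insert_iff, mem_singleton_iff, not_or] at hxS
  obtain ⟨n1, n2, n3, n4⟩ := hxS
  refine ⟨fun hc => ⟨s₁.contDiffAt_two hM hx ?_, s₀.contDiffAt_two hM hx ?_⟩, fun hc => ?_⟩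
  · filter_upwards [hc, isOpen_ne.mem_nhds n1, isOpen_ne.mem_nhds n2, isOpen_ne.mem_nhds n3]
      with y hy m1 m2 m3
    exact continuousAt_f₁ m1 m2 m3 hy
  · filter_upwards [hc, isOpen_ne.mem_nhds n4] with y hy m4
    exact continuousAt_f₀ m4 hy
  · obtain ⟨a1, a2⟩ := s₁.ode hM hx (continuousAt_f₁ n1 n2 n3 hc)
    obtain ⟨b1, b2⟩ := s₀.ode hM hx (continuousAt_f₀ n4 hc)
    refine ⟨a1, b1, ?_, ?_⟩
    · rw [← F.hjb_w₁ hM hK₀ hx, e₁ hx, e₀ hx]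
      congr 2
      linarith
    · rw [← F.hjb_w₀ hM hK₀ hK hx, e₁ hx, e₀ hx]
      congr 2
      linarith

/-- The abandonment cost is nonnegative if the candidates solve the HJB equation. -/
lemma Facts.K_nonneg (F : M.Facts K₀ p) (hM : M.Admissible)
    (h : M.SolvesHJB K₀ (M.w₁ K₀ p) (M.w₀ K₀ p)) : 0 ≤ M.K := by
  obtain ⟨S, hS, hjb⟩ := h.hjb
  by_contra! hneg
  -- close to zero, `w₀` is smaller than `-K`
  have hlim : Tendsto (fun x : ℝ => x ^ M.n * M.Bc p.α / M.C) (𝓝[>] 0) (𝓝 0) := by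
    have h1 : ContinuousAt (fun x : ℝ => x ^ M.n * M.Bc p.α / M.C) 0 :=
      ((Real.continuousAt_rpow_const _ _ (Or.inr hM.n_pos.le)).mul continuousAt_const).div_const _
    have h2 := h1.tendsto.mono_left (nhdsWithin_le_nhds (s := Ioi 0))
    rwa [Real.zero_rpow hM.n_pos.ne', zero_mul, zero_div] at h2
  obtain ⟨u, hu, hu'⟩ := mem_nhdsGT_iff_exists_Ioc_subset.1
    (hlim.eventually (gt_mem_nhds (show 0 < -M.K by linarith)))
  have hu : 0 < u := hu
  have hv : 0 < min u p.α := lt_min hu F.α_pos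
  -- The inequality w₀ ≥ −K is available only at continuity points of `h` outside `S`. The excluded
  -- points are countable, so they cannot fill an interval at zero.
  have hcount : ({x ∈ Ioi (0 : ℝ) | ¬ContinuousWithinAt M.h (Ioi 0) x} ∪ S).Countable :=
    hM.h_mono.countable_not_continuousWithinAt.union hS.countable
  obtain ⟨x, hx, hxn⟩ : (Ioo 0 (min u p.α) \
      ({x ∈ Ioi (0 : ℝ) | ¬ContinuousWithinAt M.h (Ioi 0) x} ∪ S)).Nonempty := by
    rw [sdiff_nonempty]
    intro hsub
    exact (Cardinal.Real.Ioo_countable_iff.1 (hcount.mono hsub)).not_gt hv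
  simp only [mem_union, not_or] at hxn
  have hc : ContinuousAt M.h x := by
    have h1 : ContinuousWithinAt M.h (Ioi 0) x := by
      by_contra hcon
      exact hxn.1 ⟨hx.1, hcon⟩
    exact h1.continuousAt (Ioi_mem_nhds hx.1)
  obtain ⟨-, -, -, h4⟩ := (hjb x hx.1 hxn.2).2 hc
  have h5 := (le_max_right _ _).trans h4.le
  rw [F.w₀_of_le_α hM (hx.2.le.trans (min_le_right _ _))] at h5
  have h6 : x ^ M.n * M.Bc p.α / M.C < -M.K := hu' ⟨hx.1, hx.2.le.trans (min_le_left _ _)⟩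
  linarith

end Model

end SwitchAbandon

theorem mainTheorem7 (M : SwitchAbandon.Model) (hM : M.Admissible) (K₀ : ℝ) (hK₀ : 0 < K₀) :
    (0 ≤ M.K → M.hZero < ((-(M.r * M.K) : ℝ) : EReal) →
      (∃! k : ℝ, M.IsCriticalCost k) ∧
      ∀ k : ℝ, M.IsCriticalCost k → M.K < k ∧ M.hZero < ((-(M.r * k) : ℝ) : EReal)) ∧
    (((∃! p : SwitchAbandon.Boundary, M.SolvesSystem K₀ p) ∧
        ∀ p : SwitchAbandon.Boundary, M.SolvesSystem K₀ p →
          0 < M.A K₀ p ∧ 0 < M.B p ∧ 0 < M.Γ₁ K₀ p ∧ 0 < M.Γ₂ K₀ p ∧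
          MonotoneOn (M.w₁ K₀ p) (Set.Ioi 0) ∧ MonotoneOn (M.w₀ K₀ p) (Set.Ioi 0) ∧
          M.SolvesHJB K₀ (M.w₁ K₀ p) (M.w₀ K₀ p)) ↔
      0 ≤ M.K ∧ M.hZero < ((-(M.r * K₀) : ℝ) : EReal) ∧ M.K < K₀ ∧
        ∃ k : ℝ, M.IsCriticalCost k ∧ K₀ < k) := by
  simp only [hM.hZero_lt_iff]
  refine ⟨fun hK h0 => hM.criticalCost hK h0, ?_⟩
  constructor
  · rintro ⟨⟨p, hp, -⟩, hall⟩
    -- Only 0 ≤ K is read off from the HJB equation; the other conditions then follow from the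
    -- solvability of the system.
    have hK := (hM.facts hK₀ hp).K_nonneg hM (hall p hp).2.2.2.2.2.2
    obtain ⟨h1, h2, h3⟩ := hM.necessary hK₀ hp hK
    exact ⟨hK, h1, h2, h3⟩
  · rintro ⟨hK, h0, hKK, k, hk, hlt⟩
    obtain ⟨p, hp⟩ := hM.exists_solvesSystem hK₀ hK h0 hKK hk hlt
    refine ⟨⟨p, hp, fun q hq => hM.solvesSystem_unique hK₀ hq hp⟩, fun q hq => ?_⟩
    have F := hM.facts hK₀ hq
    exact ⟨F.A_pos hM, F.B_pos hM, F.Γ₁_pos hM, F.Γ₂_pos hM, F.monotoneOn_w₁ hM,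
      F.monotoneOn_w₀ hM, F.solvesHJB hM hK₀ hK⟩
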